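/- Let $F$ be a number field with adele ring $\mathbb{A}$, let $n\ge 2$, and let $\mathrm{Sp}_{2n}=\{g\in \mathrm{GL}_{2n}: {}^tg\,J\,g=J\}$ with $J=\begin{pmatrix}0&w\\-w&0\end{pmatrix}$, where $w$ is the $n\times n$ antidiagonal matrix of ones. Let $N\subset \mathrm{Sp}_{2n}$ be the subgroup of upper triangular unipotent matrices, let $U=\{u\in N: u_{1,2}=u_{2n-1,2n}=0\}$, and let $\alpha(t)=\mathrm{diag}(t,1,\dots,1,t^{-1})$. Let $\psi:F\backslash\mathbb{A}\to\mathbb{C}^\times$ be a non-trivial continuous additive character and put $\psi_N(u)=\psi\big(\sum_{i=1}^n u_{i,i+1}\big)$ for $u\in N(\mathbb{A})$. Let $\varphi$ be a cusp form on $\mathrm{Sp}_{2n}(\mathbb{A})$ (for instance, any $\varphi$ in the space of an irreducible cuspidal automorphic generic representation of $\mathrm{Sp}_{2n}(\mathbb{A})$); only the following is required: $\varphi:\mathrm{Sp}_{2n}(\mathbb{A})\to\mathbb{C}$ is left invariant under $\mathrm{Sp}_{2n}(F)$; it is smooth, i.e. near every point it depends only on the archimedean component and is a $C^\infty$ function of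 it; and $\int_{R(F)\backslash R(\mathbb{A})}\varphi(rg)\,dr=0$ for all $g\in\mathrm{Sp}_{2n}(\mathbb{A})$ and the unipotent radical $R$ of every standard maximal parabolic subgroup of $\mathrm{Sp}_{2n}$. For each unipotent subgroup $H$ occurring here, let the measure on $H(F)\backslash H(\mathbb{A})$ be the $H(\mathbb{A})$-invariant measure of total mass $1$, and put $$W_{\varphi,\psi_N}(g)=\int_{N(F)\backslash N(\mathbb{A})}\varphi(ug)\,\psi_N^{-1}(u)\,du .$$ Then for every $g\in \mathrm{Sp}_{2n}(\mathbb{A})$ $$\int_{U(F)\backslash U(\mathbb{A})}\varphi(ug)\,\psi_N^{-1}(u)\,du=\sum_{\xi\in F^\times}W_{\varphi,\psi_N}(\alpha(\xi)g),$$ where the integrals on both sides and the sum over $\xi$ converge absolutely. -/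

import Mathlib

open MeasureTheory Topology Filter
open scoped Matrix ContDiff

noncomputable section

namespace SpUnfolding

/-! ### The symplectic group in upper triangular coordinates -/

/-- The matrix `[0, w; -w, 0]`, where `w` is the `n × n` antidiagonal matrix of ones. -/
def formJ (n : ℕ) (R : Type*) [CommRing R] : Matrix (Fin (2 * n)) (Fin (2 * n)) R :=
  Matrix.of fun i j => if j = i.rev then (if (i : ℕ) < n then 1 else -1) else 0

/-- `Sp_{2n}(R)`, realised as `{g ∈ GL_{2n}(R) : gᵀ J g = J}`.  With this form the upper triangular
matrices in `Sp_{2n}` form a Borel subgroup. -/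
def spSubgroup (n : ℕ) (R : Type*) [CommRing R] : Subgroup (GL (Fin (2 * n)) R) where
  carrier := {g | (g : Matrix (Fin (2 * n)) (Fin (2 * n)) R)ᵀ * formJ n R *
    (g : Matrix (Fin (2 * n)) (Fin (2 * n)) R) = formJ n R}
  one_mem' := by simp
  mul_mem' := by
    intro a b ha hb
    simp only [Set.mem_ofPred_eq] at ha hb ⊢
    rw [Units.val_mul, Matrix.transpose_mul]
    calc _ = (b : Matrix (Fin (2 * n)) (Fin (2 * n)) R)ᵀ *
          ((a : Matrix (Fin (2 * n)) (Fin (2 * n)) R)ᵀ * formJ n R *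
            (a : Matrix (Fin (2 * n)) (Fin (2 * n)) R)) *
          (b : Matrix (Fin (2 * n)) (Fin (2 * n)) R) := by simp only [Matrix.mul_assoc]
      _ = _ := by rw [ha, hb]
  inv_mem' := by
    intro a ha
    simp only [Set.mem_ofPred_eq] at ha ⊢
    have h1 : (a : Matrix (Fin (2 * n)) (Fin (2 * n)) R) *
        ((a⁻¹ : GL (Fin (2 * n)) R) : Matrix (Fin (2 * n)) (Fin (2 * n)) R) = 1 := a.mul_inv
    have h2 : (((a⁻¹ : GL (Fin (2 * n)) R) : Matrix (Fin (2 * n)) (Fin (2 * n)) R))ᵀ *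
        (a : Matrix (Fin (2 * n)) (Fin (2 * n)) R)ᵀ = 1 := by
      rw [← Matrix.transpose_mul, h1, Matrix.transpose_one]
    set B := ((a⁻¹ : GL (Fin (2 * n)) R) : Matrix (Fin (2 * n)) (Fin (2 * n)) R)
    calc Bᵀ * formJ n R * B
        = Bᵀ * ((a : Matrix (Fin (2 * n)) (Fin (2 * n)) R)ᵀ * formJ n R *
            (a : Matrix (Fin (2 * n)) (Fin (2 * n)) R)) * B := by rw [ha]
      _ = (Bᵀ * (a : Matrix (Fin (2 * n)) (Fin (2 * n)) R)ᵀ) * formJ n R *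
            ((a : Matrix (Fin (2 * n)) (Fin (2 * n)) R) * B) := by simp only [Matrix.mul_assoc]
      _ = formJ n R := by rw [h1, h2, Matrix.one_mul, Matrix.mul_one]

/-- The group `Sp_{2n}(R)`; it carries the topology induced from `GL_{2n}(R)`. -/
abbrev Sp (n : ℕ) (R : Type*) [CommRing R] : Type _ := spSubgroup n R

/-- The `(i, j)` entry of a symplectic matrix. -/
def Sp.entry {n : ℕ} {R : Type*} [CommRing R] (g : Sp n R) (i j : Fin (2 * n)) : R :=
  (g : GL (Fin (2 * n)) R).val i j

theorem formJ_map {n : ℕ} {R S : Type*} [CommRing R] [CommRing S] (f : R →+* S) :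
    (formJ n R).map f = formJ n S := by
  ext i j
  simp only [formJ, Matrix.map_apply, Matrix.of_apply]
  split_ifs <;> simp

/-- The homomorphism `Sp_{2n}(R) → Sp_{2n}(S)` obtained by applying a ring homomorphism to all the
entries. -/
def Sp.map {n : ℕ} {R S : Type*} [CommRing R] [CommRing S] (f : R →+* S) : Sp n R →* Sp n S :=
  ((Matrix.GeneralLinearGroup.map f).comp (spSubgroup n R).subtype).codRestrict (spSubgroup n S) <| by
    rintro ⟨g, hg⟩
    have hg' : (g : Matrix (Fin (2 * n)) (Fin (2 * n)) R)ᵀ * formJ n R *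
      (g : Matrix (Fin (2 * n)) (Fin (2 * n)) R) = formJ n R := hg
    change ((g : Matrix (Fin (2 * n)) (Fin (2 * n)) R).map f)ᵀ * formJ n S *
      ((g : Matrix (Fin (2 * n)) (Fin (2 * n)) R).map f) = formJ n S
    rw [← formJ_map f, ← Matrix.transpose_map, ← Matrix.map_mul, ← Matrix.map_mul, hg']

/-- The diagonal entries `(t, 1, …, 1, t⁻¹)`. -/
def alphaDiag (n : ℕ) {R : Type*} [CommRing R] (t : Rˣ) (i : Fin (2 * n)) : R :=
  if (i : ℕ) = 0 then (t : R) else if (i : ℕ) + 1 = 2 * n then ((t⁻¹ : Rˣ) : R) else 1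

/-- The element `α(t) = diag(t, 1, …, 1, t⁻¹)` of `Sp_{2n}(R)`. -/
def alpha (n : ℕ) {R : Type*} [CommRing R] (t : Rˣ) : Sp n R :=
  ⟨⟨Matrix.diagonal (alphaDiag n t), Matrix.diagonal (alphaDiag n t⁻¹), by
      rw [Matrix.diagonal_mul_diagonal, ← Matrix.diagonal_one]
      congr 1; funext i; simp only [alphaDiag]; split_ifs <;> simp, by
      rw [Matrix.diagonal_mul_diagonal, ← Matrix.diagonal_one]
      congr 1; funext i; simp only [alphaDiag]; split_ifs <;> simp⟩, by
    change (Matrix.diagonal (alphaDiag n t))ᵀ * formJ n R * Matrix.diagonal (alphaDiag n t) =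
      formJ n R
    ext i j
    rw [Matrix.diagonal_transpose, Matrix.mul_diagonal, Matrix.diagonal_mul]
    simp only [formJ, Matrix.of_apply]
    by_cases hj : j = i.rev
    · have hij : alphaDiag n t i * alphaDiag n t j = 1 := by
        have h1 : (j : ℕ) + (i : ℕ) + 1 = 2 * n := by
          subst hj; rw [Fin.val_rev]; omega
        simp only [alphaDiag]
        split_ifs <;> first | omega | simp
      rw [mul_right_comm, hij, one_mul]
    · simp [hj]⟩

/-! ### Unipotent subgroups -/

/-- For a labelling `b` of the indices: the matrices in `Sp_{2n}(R)` whose entry `(i, j)` agrees with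
that of the identity matrix whenever `b j ≤ b i`.  If `b` is weakly increasing, these are the block
upper triangular matrices with identity diagonal blocks, the blocks being the fibres of `b`. -/
def blockUnipotent (n : ℕ) (R : Type*) [CommRing R] (b : Fin (2 * n) → ℕ) :
    Subgroup (Sp n R) where
  carrier := {g | ∀ i j, b j ≤ b i → g.entry i j = (1 : Matrix (Fin (2 * n)) (Fin (2 * n)) R) i j}
  one_mem' := by intro i j _; rfl
  mul_mem' := by
    intro g h hg hh i j hij
    change (((g : GL (Fin (2 * n)) R).val * (h : GL (Fin (2 * n)) R).val) i j) = _
    rw [Matrix.mul_apply, Finset.sum_eq_single i]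
    · have h1 := hg i i le_rfl
      have h2 := hh i j hij
      simp only [Sp.entry, Matrix.one_apply_eq] at h1 h2
      rw [h1, one_mul, h2]
    · intro k _ hk
      rcases le_or_gt (b k) (b i) with hki | hki
      · have h1 := hg i k hki
        rw [Matrix.one_apply_ne (Ne.symm hk)] at h1
        simp only [Sp.entry] at h1
        rw [h1, zero_mul]
      · have h2 := hh k j (by omega)
        rw [Matrix.one_apply_ne (by rintro rfl; omega)] at h2
        simp only [Sp.entry] at h2
        rw [h2, mul_zero]
    · simp
  inv_mem' := by
    intro g hg
    have hmul : ∀ i j, ∑ k, g.entry i k * (g⁻¹).entry k j =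
        (1 : Matrix (Fin (2 * n)) (Fin (2 * n)) R) i j := by
      intro i j
      have : (g : GL (Fin (2 * n)) R).val * ((g⁻¹ : Sp n R) : GL (Fin (2 * n)) R).val = 1 :=
        (g : GL (Fin (2 * n)) R).mul_inv
      rw [← this, Matrix.mul_apply]
      rfl
    have key : ∀ m i j, (∑ k, b k) - b i ≤ m → b j ≤ b i →
        (g⁻¹).entry i j = (1 : Matrix (Fin (2 * n)) (Fin (2 * n)) R) i j := by
      intro m
      induction m with
      | zero =>
        intro i j hm hij
        rw [← hmul i j, Finset.sum_eq_single i]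
        · rw [hg i i le_rfl, Matrix.one_apply_eq, one_mul]
        · intro k _ hk
          have hk2 : b k ≤ ∑ k, b k := Finset.single_le_sum (f := b) (by simp) (Finset.mem_univ k)
          rw [hg i k (by omega), Matrix.one_apply_ne (Ne.symm hk), zero_mul]
        · simp
      | succ m ih =>
        intro i j hm hij
        rw [← hmul i j, Finset.sum_eq_single i]
        · rw [hg i i le_rfl, Matrix.one_apply_eq, one_mul]
        · intro k _ hk
          have hk2 : b k ≤ ∑ k, b k := Finset.single_le_sum (f := b) (by simp) (Finset.mem_univ k)
          rcases le_or_gt (b k) (b i) with hki | hki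
          · rw [hg i k hki, Matrix.one_apply_ne (Ne.symm hk), zero_mul]
          · rw [ih k j (by omega) (by omega), Matrix.one_apply_ne (by rintro rfl; omega), mul_zero]
        · simp
    intro i j hij
    exact key _ i j le_rfl hij

/-- The standard maximal unipotent subgroup `N(R)`: upper triangular with ones on the diagonal. -/
def subgroupN (n : ℕ) (R : Type*) [CommRing R] : Subgroup (Sp n R) :=
  blockUnipotent n R fun i => (i : ℕ)

/-- The unipotent radical (for `1 ≤ k ≤ n`) of the standard maximal parabolic subgroup with Levi
subgroup `GL_k × Sp_{2n-2k}`: the diagonal blocks have sizes `k, 2n - 2k, k`. -/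
def parabolicRadical (n : ℕ) (R : Type*) [CommRing R] (k : ℕ) : Subgroup (Sp n R) :=
  blockUnipotent n R fun i => if (i : ℕ) < k then 0 else if (i : ℕ) + k < 2 * n then 1 else 2

theorem entry_mul_of_succ {n : ℕ} {R : Type*} [CommRing R] {g h : Sp n R}
    (hg : g ∈ subgroupN n R) (hh : h ∈ subgroupN n R) {i j : Fin (2 * n)}
    (hij : (j : ℕ) = (i : ℕ) + 1) : (g * h).entry i j = g.entry i j + h.entry i j := by
  have hne : i ≠ j := by rintro rfl; omega
  change (((g : GL (Fin (2 * n)) R).val * (h : GL (Fin (2 * n)) R).val) i j) = _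
  rw [Matrix.mul_apply]
  have h1 : ∑ k, (g : GL (Fin (2 * n)) R).val i k * (h : GL (Fin (2 * n)) R).val k j =
      ∑ k, ((if k = i then h.entry i j else 0) + if k = j then g.entry i j else 0) := by
    refine Finset.sum_congr rfl fun k _ => ?_
    change g.entry i k * h.entry k j = _
    by_cases hki : k = i
    · subst hki
      rw [hg k k le_rfl, Matrix.one_apply_eq]
      simp [hne]
    · by_cases hkj : k = j
      · subst hkj
        rw [hh k k le_rfl, Matrix.one_apply_eq]
        simp [hki]
      · rw [if_neg hki, if_neg hkj, add_zero]
        rcases lt_or_gt_of_ne (fun h => hki (Fin.ext h) : (k : ℕ) ≠ i) with hlt | hgt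
        · rw [hg i k hlt.le, Matrix.one_apply_ne (Ne.symm hki), zero_mul]
        · have : (k : ℕ) ≠ j := fun h => hkj (Fin.ext h)
          rw [hh k j (by omega : (j : ℕ) ≤ k), Matrix.one_apply_ne hkj, mul_zero]
  rw [h1, Finset.sum_add_distrib]
  simp [add_comm]

/-- The subgroup `U(R)` of `N(R)` where the entries `(1, 2)` and `(2n - 1, 2n)` (numbered from `1`)
vanish. -/
def subgroupU (n : ℕ) (R : Type*) [CommRing R] : Subgroup (Sp n R) where
  carrier := {g | g ∈ subgroupN n R ∧ ∀ i j : Fin (2 * n), (j : ℕ) = (i : ℕ) + 1 →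
    ((j : ℕ) = 1 ∨ (j : ℕ) + 1 = 2 * n) → g.entry i j = 0}
  one_mem' := by
    refine ⟨one_mem _, fun i j hij _ => ?_⟩
    exact Matrix.one_apply_ne (by rintro rfl; omega)
  mul_mem' := by
    intro g h hg hh
    refine ⟨mul_mem hg.1 hh.1, fun i j hij hj => ?_⟩
    rw [entry_mul_of_succ hg.1 hh.1 hij, hg.2 i j hij hj, hh.2 i j hij hj, add_zero]
  inv_mem' := by
    intro g hg
    refine ⟨inv_mem hg.1, fun i j hij hj => ?_⟩
    have h1 := entry_mul_of_succ hg.1 (inv_mem hg.1) hij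
    rw [mul_inv_cancel, hg.2 i j hij hj, zero_add] at h1
    rw [← h1]
    exact Matrix.one_apply_ne (by rintro rfl; omega)

/-! ### Adelic quotients -/

/-- The adele ring of the number field `F`. -/
abbrev Adele (F : Type*) [Field F] [NumberField F] : Type _ :=
  NumberField.AdeleRing (NumberField.RingOfIntegers F) F

/-- `Sp_{2n}(F)` as a subgroup of `Sp_{2n}(𝔸)`. -/
def rationalPoints (n : ℕ) (F : Type*) [Field F] [NumberField F] : Subgroup (Sp n (Adele F)) :=
  (Sp.map (n := n) (algebraMap F (Adele F))).range

/-- For a subgroup `H` of `Sp_{2n}(𝔸)`, the quotient `(H ∩ Sp_{2n}(F)) \ H`, with the quotient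
topology and its Borel `σ`-algebra.  For `H = U(𝔸)` this is `U(F) \ U(𝔸)`, and so on. -/
def AdelicQuotient {n : ℕ} {F : Type*} [Field F] [NumberField F]
    (H : Subgroup (Sp n (Adele F))) : Type _ :=
  Quotient (QuotientGroup.rightRel ((rationalPoints n F).subgroupOf H))

instance {n : ℕ} {F : Type*} [Field F] [NumberField F] (H : Subgroup (Sp n (Adele F))) :
    TopologicalSpace (AdelicQuotient H) :=
  inferInstanceAs (TopologicalSpace
    (Quotient (QuotientGroup.rightRel ((rationalPoints n F).subgroupOf H))))

instance {n : ℕ} {F : Type*} [Field F] [NumberField F] (H : Subgroup (Sp n (Adele F))) :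
    MeasurableSpace (AdelicQuotient H) := borel _

instance {n : ℕ} {F : Type*} [Field F] [NumberField F] (H : Subgroup (Sp n (Adele F))) :
    BorelSpace (AdelicQuotient H) := ⟨rfl⟩

/-- A representative in `H` of a coset; used only for functions that are constant on cosets. -/
def AdelicQuotient.rep {n : ℕ} {F : Type*} [Field F] [NumberField F]
    {H : Subgroup (Sp n (Adele F))} (q : AdelicQuotient H) : H :=
  Quotient.out q

/-- Right translation by `h ∈ H` on `(H ∩ Sp_{2n}(F)) \ H`. -/
def AdelicQuotient.rightTranslate {n : ℕ} {F : Type*} [Field F] [NumberField F]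
    {H : Subgroup (Sp n (Adele F))} (h : H) : AdelicQuotient H → AdelicQuotient H :=
  Quotient.map (fun x : H => x * h) <| by
    intro a b hab
    have hab' := QuotientGroup.rightRel_apply.1 hab
    exact QuotientGroup.rightRel_apply.2 (by simpa [mul_assoc] using hab')

/-- `μ` is the `H`-invariant Borel measure of total mass one on `(H ∩ Sp_{2n}(F)) \ H`. -/
structure IsInvariantProbability {n : ℕ} {F : Type*} [Field F] [NumberField F]
    {H : Subgroup (Sp n (Adele F))} (μ : Measure (AdelicQuotient H)) : Prop where
  isProbabilityMeasure : IsProbabilityMeasure μ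
  map_rightTranslate : ∀ h : H, μ.map (AdelicQuotient.rightTranslate h) = μ

/-! ### Cusp forms -/

/-- The archimedean coordinates of `g ∈ Sp_{2n}(𝔸)`: the family, over the archimedean places `v`,
of the matrices of `g` at `v`, with entries in `F_v ⊆ ℂ`.  This is `g ↦ g_∞`, where `Sp_{2n}(F_∞)` is
viewed as a closed real submanifold of a finite dimensional real vector space. -/
def archCoord {n : ℕ} {F : Type*} [Field F] [NumberField F] (g : Sp n (Adele F)) :
    Fin (2 * n) → Fin (2 * n) → NumberField.InfinitePlace F → ℂ :=
  fun i j v => NumberField.InfinitePlace.Completion.extensionEmbedding v ((g.entry i j).1 v)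

/-- Smooth functions on `Sp_{2n}(𝔸)`: near every point, the function depends only on the archimedean
component and is a `C^∞` function of it (a function on the submanifold `Sp_{2n}(F_∞)` is `C^∞` near a
point if and only if it extends to a `C^∞` function near that point of the ambient space). -/
def IsSmooth {n : ℕ} {F : Type*} [Field F] [NumberField F] (φ : Sp n (Adele F) → ℂ) : Prop :=
  ∀ g : Sp n (Adele F),
    ∃ Φ : (Fin (2 * n) → Fin (2 * n) → NumberField.InfinitePlace F → ℂ) → ℂ,
      ContDiffAt ℝ ∞ Φ (archCoord g) ∧ ∀ᶠ h in 𝓝 g, φ h = Φ (archCoord h)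

/-- Smooth cuspidal functions on `Sp_{2n}(F) \ Sp_{2n}(𝔸)`.  Every cusp form is one; conditions of
finiteness under a maximal compact subgroup and under the centre of the enveloping algebra, and of
growth, are not imposed. -/
structure IsSmoothCuspForm {n : ℕ} {F : Type*} [Field F] [NumberField F]
    (φ : Sp n (Adele F) → ℂ) : Prop where
  left_invariant : ∀ γ ∈ rationalPoints n F, ∀ g, φ (γ * g) = φ g
  smooth : IsSmooth φ
  cuspidal : ∀ k, 1 ≤ k → k ≤ n →
    ∀ μ : Measure (AdelicQuotient (parabolicRadical n (Adele F) k)), IsInvariantProbability μ →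
      ∀ g, ∫ q, φ ((q.rep : Sp n (Adele F)) * g) ∂μ = 0

/-! ### Fourier coefficients -/

/-- `ψ_N(u) = ψ(u_{1,2} + u_{2,3} + ⋯ + u_{n,n+1})` (numbered from `1`). -/
def psiN {n : ℕ} {F : Type*} [Field F] [NumberField F] (ψ : AddChar (Adele F) ℂ)
    (u : Sp n (Adele F)) : ℂ :=
  ψ (∑ i : Fin n, u.entry ⟨i, by omega⟩ ⟨i + 1, by omega⟩)

/-- The function `u ↦ φ(u g) ψ_N(u)⁻¹` on `H(F) \ H(𝔸)`, for a subgroup `H` of `N`. -/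
def fourierIntegrand {n : ℕ} {F : Type*} [Field F] [NumberField F]
    (H : Subgroup (Sp n (Adele F))) (ψ : AddChar (Adele F) ℂ) (φ : Sp n (Adele F) → ℂ)
    (g : Sp n (Adele F)) (q : AdelicQuotient H) : ℂ :=
  φ ((q.rep : Sp n (Adele F)) * g) * (psiN ψ (q.rep : Sp n (Adele F)))⁻¹

/-- The Whittaker function `W_{φ, ψ_N}(g) = ∫_{N(F) \ N(𝔸)} φ(u g) ψ_N(u)⁻¹ du`, where `du` is the
measure `μ`. -/
def whittaker {n : ℕ} {F : Type*} [Field F] [NumberField F]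
    (μ : Measure (AdelicQuotient (subgroupN n (Adele F)))) (ψ : AddChar (Adele F) ℂ)
    (φ : Sp n (Adele F) → ℂ) (g : Sp n (Adele F)) : ℂ :=
  ∫ q, fourierIntegrand (subgroupN n (Adele F)) ψ φ g q ∂μ

end SpUnfolding

end

noncomputable section

namespace SpUnfolding

/-! ### Compactness of the integral finite adeles. -/

section FiniteAdeles

open IsDedekindDomain HeightOneSpectrum NumberField WithZero

variable {F : Type*} [Field F] [NumberField F]

/-! Restrict the `U`-period to the first simple root subgroup and put f(t) = ∫ φ(u x₁₂(t) g)
ψ_N(u)⁻¹ du over U(F)\U(𝔸). Since U is normal in N and N = U · x₁₂(𝔸), f is a function on the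
compact group 𝔸/F, f(0) is the left side of the identity, and the sum is the Fourier series of f at
0.

The coefficient of f at ξ is the integral of φ(ug) over N(F)\N(𝔸) against ψ(ξ u₁₂ + u₂₃ + ⋯)⁻¹
(`integral_twist`). At ξ = 0 this character is trivial on the unipotent radical of the parabolic
with Levi GL₁ × Sp_{2n-2}, so cuspidality kills the coefficient (`integral_twist_zero`). For ξ ≠ 0,
conjugation by the rational element α(ξ) turns the character into ψ_N and the coefficient into
W(α(ξ)g) (`whittaker_alpha`).

Convergence comes from smoothness of φ, made uniform by the compactness of N(F)\N(𝔸): f is invariant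
under M·Ô for some integer M > 0, which confines the coefficients to a lattice, and its k-th
archimedean differences are O(‖h‖^k), which makes them decay faster than any power.
Stone–Weierstrass, with the fact that F is its own annihilator under ψ, identifies the sum
(`hasSum_fourier_of_smooth`).

The groups U, N and the radical are built from one-parameter subgroups, each central in N modulo the
preceding step. Averaging over 𝔸/F one step at a time (`CentralTower.exists_isAverage`) computes the
integral against every invariant probability measure, so neither disintegration of nested quotients
nor uniqueness of the invariant measure is needed. -/

theorem exists_ringOfIntegers_sub_lt (v : HeightOneSpectrum (𝓞 F)) {y : v.adicCompletion F}
    (hy : Valued.v y ≤ 1) (γ : (ℤᵐ⁰)ˣ) :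
    ∃ r : 𝓞 F, Valued.v (y - ((algebraMap (𝓞 F) F r : F) : v.adicCompletion F)) < (γ : ℤᵐ⁰) := by
  obtain ⟨δ, hδγ, hδ1⟩ : ∃ δ : (ℤᵐ⁰)ˣ, δ ≤ γ ∧ δ ≤ 1 := ⟨min γ 1, min_le_left _ _, min_le_right _ _⟩
  have hopen : {z : v.adicCompletion F | Valued.v (y - z) < (δ : ℤᵐ⁰)} ∈ 𝓝 y := by
    obtain ⟨d, hd⟩ := valuedAdicCompletion_surjective F v (δ : ℤᵐ⁰)
    rw [Valued.mem_nhds]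
    have hd0 : Valued.v.restrict d ≠ 0 := by
      rw [ne_eq, ← map_zero Valued.v.restrict, Valuation.restrict_inj, hd, map_zero]
      exact δ.ne_zero
    refine ⟨Units.mk0 _ hd0, fun z hz => ?_⟩
    have hz' : Valued.v.restrict (z - y) < Valued.v.restrict d := hz
    rw [Valuation.restrict_lt_iff, hd] at hz'
    change Valued.v (y - z) < _
    rwa [Valuation.map_sub_swap]
  obtain ⟨x, hx⟩ := (denseRange_algebraMap F v).exists_mem_open isOpen_interior
    ⟨y, mem_interior_iff_mem_nhds.2 hopen⟩
  have hx := interior_subset hx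
  have hx1 : v.valuation F x ≤ 1 := by
    rw [← valuedAdicCompletion_eq_valuation']
    have : ((x : F) : v.adicCompletion F) = y - (y - algebraMap F (v.adicCompletion F) x) := by
      rw [sub_sub_cancel]; rfl
    rw [this]
    refine (Valuation.map_sub _ _ _).trans (max_le hy (hx.le.trans ?_))
    exact_mod_cast hδ1
  obtain ⟨r, hr⟩ := v.exists_valuation_sub_lt_of_integer hx1 δ
  refine ⟨r, ?_⟩
  have h2 : y - ((algebraMap (𝓞 F) F r : F) : v.adicCompletion F) =
      (y - algebraMap F (v.adicCompletion F) x) -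
        (((algebraMap (𝓞 F) F r - x : F)) : v.adicCompletion F) := by
    have : (((algebraMap (𝓞 F) F r - x : F)) : v.adicCompletion F) =
      algebraMap F (v.adicCompletion F) (algebraMap (𝓞 F) F r - x) := rfl
    rw [this, map_sub, sub_sub_sub_cancel_right]
    rfl
  rw [h2]
  refine (Valuation.map_sub _ _ _).trans_lt (max_lt (hx.trans_le (by exact_mod_cast hδγ)) ?_)
  rw [valuedAdicCompletion_eq_valuation']
  exact hr.trans_le (by exact_mod_cast hδγ)

/-- Approximation to precision 1 shows that the integers of F already hit every residue class, so
the residue field is a quotient of the finite ring 𝓞/v. -/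
instance finite_residueField_adicCompletionIntegers (v : HeightOneSpectrum (𝓞 F)) :
    Finite (IsLocalRing.ResidueField (v.adicCompletionIntegers F)) := by
  have hfin : Finite (𝓞 F ⧸ v.asIdeal) := v.asIdeal.finiteQuotientOfFreeOfNeBot v.ne_bot
  let f : 𝓞 F →+* IsLocalRing.ResidueField (v.adicCompletionIntegers F) :=
    (IsLocalRing.residue _).comp (algebraMap (𝓞 F) (v.adicCompletionIntegers F))
  have hf : Function.Surjective f := by
    intro z
    obtain ⟨y, rfl⟩ := IsLocalRing.residue_surjective z
    obtain ⟨r, hr⟩ := exists_ringOfIntegers_sub_lt v y.2 1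
    refine ⟨r, ?_⟩
    rw [RingHom.comp_apply, eq_comm, ← sub_eq_zero, ← map_sub, IsLocalRing.residue_eq_zero_iff]
    rw [← not_not (a := _ ∈ _), IsLocalRing.notMem_maximalIdeal,
      adicCompletionIntegers.isUnit_iff_valued_eq_one]
    exact ne_of_lt (by simpa using hr)
  have hker : ∀ a ∈ v.asIdeal, f a = 0 := by
    intro a ha
    change IsLocalRing.residue _ _ = 0
    rw [IsLocalRing.residue_eq_zero_iff, ← not_not (a := _ ∈ _), IsLocalRing.notMem_maximalIdeal,
      adicCompletionIntegers.isUnit_iff_valued_eq_one]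
    refine ne_of_lt ?_
    change Valued.v ((algebraMap (𝓞 F) F a : F) : v.adicCompletion F) < 1
    rw [valuedAdicCompletion_eq_valuation', valuation_of_algebraMap]
    exact (intValuation_lt_one_iff_mem v a).2 ha
  exact Finite.of_surjective (Ideal.Quotient.lift v.asIdeal f hker)
    (Ideal.Quotient.lift_surjective_of_surjective _ _ hf)

instance compactSpace_adicCompletionIntegers (v : HeightOneSpectrum (𝓞 F)) :
    CompactSpace (v.adicCompletionIntegers F) := by
  have h : CompleteSpace (Valued.integer (v.adicCompletion F)) :=
    (Valued.isClosed_integer (v.adicCompletion F)).completeSpace_coe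
  exact Valued.integer.compactSpace_iff_completeSpace_and_isDiscreteValuationRing_and_finite_residueField.2
    ⟨h, inferInstanceAs (IsDiscreteValuationRing (v.adicCompletionIntegers F)),
      finite_residueField_adicCompletionIntegers v⟩

/-- The finite adeles which are integral at every place. -/
def integralFiniteAdeles (F : Type*) [Field F] [NumberField F] :
    Set (FiniteAdeleRing (𝓞 F) F) :=
  {a | ∀ v, a v ∈ v.adicCompletionIntegers F}

/-- Tychonoff: this set is the continuous image of the product of the compact local integer rings.
-/
theorem isCompact_integralFiniteAdeles : IsCompact (integralFiniteAdeles F) := by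
  have h : integralFiniteAdeles F = Set.range (RestrictedProduct.structureMap
      (fun v : HeightOneSpectrum (𝓞 F) => v.adicCompletion F)
      (fun v => (v.adicCompletionIntegers F : Set (v.adicCompletion F))) cofinite) := by
    exact (RestrictedProduct.range_structureMap ..).symm
  rw [h]
  have : ∀ v : HeightOneSpectrum (𝓞 F),
    CompactSpace (v.adicCompletionIntegers F : Set (v.adicCompletion F)) :=
    fun v => compactSpace_adicCompletionIntegers v
  exact isCompact_range RestrictedProduct.isEmbedding_structureMap.continuous

theorem isOpen_integralFiniteAdeles : IsOpen (integralFiniteAdeles F) :=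
  RestrictedProduct.isOpen_forall_mem fun _ => Valued.isOpen_valuationSubring _

end FiniteAdeles

/-! ### Approximation in the finite adeles: F + Ô is everything, and the sets N · Ô shrink to zero.
-/

section FiniteAdeles

open IsDedekindDomain HeightOneSpectrum NumberField WithZero

theorem exists_exp_neg_natCast_le (γ : (ℤᵐ⁰)ˣ) :
    ∃ k : ℕ, (exp (-(k : ℤ)) : ℤᵐ⁰) ≤ γ := by
  refine ⟨(log (γ : ℤᵐ⁰)).natAbs, ?_⟩
  refine le_trans ?_ (exp_log γ.ne_zero).le
  rw [exp_le_exp]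
  omega

variable {F : Type*} [Field F] [NumberField F]

/-- Only finitely many places have a denominator; the product of local denominators clears them all.
-/
theorem exists_ringOfIntegers_mul_mem (a : FiniteAdeleRing (𝓞 F) F) :
    ∃ N : 𝓞 F, N ≠ 0 ∧
      algebraMap F (FiniteAdeleRing (𝓞 F) F) (algebraMap (𝓞 F) F N) * a ∈
        integralFiniteAdeles F := by
  classical
  have hS : {v | ¬ a v ∈ v.adicCompletionIntegers F}.Finite := a.2
  choose b hb hab using fun v : HeightOneSpectrum (𝓞 F) =>
    adicCompletion.mul_nonZeroDivisor_mem_adicCompletionIntegers v (a v)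
  refine ⟨∏ v ∈ hS.toFinset, b v, Finset.prod_ne_zero_iff.2 fun v _ =>
    nonZeroDivisors.ne_zero (hb v), fun v => ?_⟩
  change ((algebraMap (𝓞 F) F (∏ v ∈ hS.toFinset, b v) : F) : v.adicCompletion F) * a v ∈ _
  by_cases hv : a v ∈ v.adicCompletionIntegers F
  · exact mul_mem (coe_mem_adicCompletionIntegers v _) hv
  · have hv' : v ∈ hS.toFinset := by simpa using hv
    rw [← Finset.mul_prod_erase _ _ hv', map_mul, adicCompletion.coe_mul, mul_right_comm]
    refine mul_mem ?_ (coe_mem_adicCompletionIntegers v _)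
    rw [mul_comm]
    exact hab v

/-- Clear denominators by M, approximate M·a by one global integer y through the Chinese remainder
theorem, and divide by M. The precision needed at v is v(M), so only the finitely many v dividing M
impose a condition. -/
theorem exists_sub_mem_integralFiniteAdeles (a : FiniteAdeleRing (𝓞 F) F) :
    ∃ x : F, a - algebraMap F (FiniteAdeleRing (𝓞 F) F) x ∈ integralFiniteAdeles F := by
  classical
  obtain ⟨N, hN0, hN⟩ := exists_ringOfIntegers_mul_mem a
  set M : F := algebraMap (𝓞 F) F N with hM
  have hM0 : M ≠ 0 := by simpa [hM] using hN0
  have hval : ∀ v : HeightOneSpectrum (𝓞 F), v.valuation F M ≠ 0 := fun v => by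
    rwa [ne_eq, Valuation.zero_iff]
  choose k hk using fun v : HeightOneSpectrum (𝓞 F) => exists_exp_neg_natCast_le (Units.mk0 _ (hval v))
  have hT : {v : HeightOneSpectrum (𝓞 F) | 1 < v.valuation F M⁻¹}.Finite :=
    HeightOneSpectrum.Support.finite (𝓞 F) M⁻¹
  choose r hr using fun v : HeightOneSpectrum (𝓞 F) =>
    exists_ringOfIntegers_sub_lt v (hN v) (Units.mk0 (exp (-(k v : ℤ))) exp_ne_zero)
  obtain ⟨y, hy⟩ := IsDedekindDomain.exists_forall_sub_mem_ideal (s := hT.toFinset)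
    (fun v : HeightOneSpectrum (𝓞 F) => v.asIdeal) k (fun v _ => v.prime)
    (fun v _ w _ hvw h => hvw (HeightOneSpectrum.ext h)) (fun v => r v)
  have key : ∀ v : HeightOneSpectrum (𝓞 F),
      Valued.v (((M : F) : v.adicCompletion F) * a v - ((algebraMap (𝓞 F) F y : F))) ≤
        Valued.v ((M : F) : v.adicCompletion F) := by
    intro v
    by_cases hv : v ∈ hT.toFinset
    · have h1 := hy v hv
      have h2 : ((M : F) : v.adicCompletion F) * a v - ((algebraMap (𝓞 F) F y : F)) =
        (((M : F) : v.adicCompletion F) * a v - ((algebraMap (𝓞 F) F (r v) : F))) -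
          (((algebraMap (𝓞 F) F (y - r v) : F)) : v.adicCompletion F) := by
        change _ - algebraMap F (v.adicCompletion F) (algebraMap (𝓞 F) F y) =
          (_ - algebraMap F (v.adicCompletion F) (algebraMap (𝓞 F) F (r v))) -
            algebraMap F (v.adicCompletion F) (algebraMap (𝓞 F) F (y - r v))
        rw [map_sub, map_sub, sub_sub, add_sub_cancel]
      rw [h2, valuedAdicCompletion_eq_valuation' v M]
      refine (Valuation.map_sub _ _ _).trans (max_le ((hr v).le.trans (hk v)) ?_)
      rw [valuedAdicCompletion_eq_valuation', valuation_of_algebraMap]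
      exact ((intValuation_le_pow_iff_mem v _ _).2 h1).trans (hk v)
    -- Here M is a unit at v, and any two integral elements are close enough.
    · have hv' : v.valuation F M⁻¹ ≤ 1 := by simpa using hv
      have h1 : 1 ≤ Valued.v ((M : F) : v.adicCompletion F) := by
        rw [valuedAdicCompletion_eq_valuation']
        rw [map_inv₀] at hv'
        exact (inv_le_one₀ (zero_lt_iff.2 (hval v))).1 hv'
      refine (sub_mem (hN v) (coe_mem_adicCompletionIntegers v y) :
        _ ∈ v.adicCompletionIntegers F).trans h1
  refine ⟨M⁻¹ * algebraMap (𝓞 F) F y, fun v => ?_⟩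
  have hMv : ((M : F) : v.adicCompletion F) ≠ 0 := by
    rw [← (Valued.v : Valuation (v.adicCompletion F) ℤᵐ⁰).ne_zero_iff,
      valuedAdicCompletion_eq_valuation']
    exact hval v
  have h5 : (algebraMap F (v.adicCompletion F) M) ≠ 0 := hMv
  have h4 : (a - algebraMap F (FiniteAdeleRing (𝓞 F) F) (M⁻¹ * algebraMap (𝓞 F) F y)) v =
      ((M : F) : v.adicCompletion F)⁻¹ *
        (((M : F) : v.adicCompletion F) * a v - ((algebraMap (𝓞 F) F y : F))) := by
    change a v - algebraMap F (v.adicCompletion F) (M⁻¹ * algebraMap (𝓞 F) F y) =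
      (algebraMap F (v.adicCompletion F) M)⁻¹ * (algebraMap F (v.adicCompletion F) M * a v -
        algebraMap F (v.adicCompletion F) (algebraMap (𝓞 F) F y))
    rw [map_mul, map_inv₀]
    field_simp
  rw [h4, mem_adicCompletionIntegers, map_mul, map_inv₀]
  exact (inv_mul_le_one₀ (zero_lt_iff.2 ((Valuation.ne_zero_iff _).2 hMv))).2 (key v)

/-- With q the norm of v, the integer q lies in v, and m! is divisible by any given power of q once
m is large. -/
theorem tendsto_factorial_adicCompletionIntegers (v : HeightOneSpectrum (𝓞 F)) :
    Tendsto (fun m : ℕ => ((m.factorial : ℕ) : v.adicCompletionIntegers F)) atTop (𝓝 0) := by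
  rw [tendsto_subtype_rng]
  have h : (𝓝 ((0 : v.adicCompletionIntegers F) : v.adicCompletion F)).HasBasis
      (fun _ => True) _ := Valued.hasBasis_nhds_zero (v.adicCompletion F) ℤᵐ⁰
  rw [h.tendsto_right_iff]
  rintro γ -
  obtain ⟨d, hd⟩ := MonoidWithZeroHom.ValueGroup₀.restrict₀_surjective (.ofClass (Valued.v : Valuation (v.adicCompletion F) ℤᵐ⁰)) (γ : _)
  rw [← Valuation.restrict_def] at hd
  have hd0 : Valued.v d ≠ 0 := by
    intro h0
    have := γ.ne_zero
    rw [← hd] at this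
    exact this (by rw [← map_zero Valued.v.restrict, Valuation.restrict_inj, h0, map_zero])
  obtain ⟨k, hk⟩ := exists_exp_neg_natCast_le (Units.mk0 _ hd0)
  set q := Ideal.absNorm v.asIdeal
  have hq : ((q : ℕ) : 𝓞 F) ∈ v.asIdeal := Ideal.absNorm_mem _
  filter_upwards [eventually_ge_atTop (q * (k + 1))] with m hm
  have h1 : q ^ (k + 1) ∣ m.factorial := by
    have h2 : q.factorial ^ (k + 1) ∣ (q * (k+1)).factorial := by
      have := Nat.prod_factorial_dvd_factorial_sum (Finset.range (k + 1)) (fun _ => q)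
      simpa [mul_comm] using this
    have hq0 : 0 < q := Nat.pos_of_ne_zero (by
      have : 1 < q := NumberField.HeightOneSpectrum.one_lt_absNorm v; omega)
    exact (pow_dvd_pow_of_dvd (Nat.dvd_factorial hq0 le_rfl) _).trans
      (h2.trans (Nat.factorial_dvd_factorial hm))
  have h3 : ((m.factorial : ℕ) : 𝓞 F) ∈ v.asIdeal ^ (k + 1) := by
    obtain ⟨c, hc⟩ := h1
    rw [hc, Nat.cast_mul, Nat.cast_pow]
    exact Ideal.mul_mem_right _ _ (Ideal.pow_mem_pow hq _)
  have h4 : ((((m.factorial : ℕ) : v.adicCompletionIntegers F)) : v.adicCompletion F) =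
      ((algebraMap (𝓞 F) F ((m.factorial : ℕ) : 𝓞 F) : F) : v.adicCompletion F) := by
    have : ((algebraMap (𝓞 F) F ((m.factorial : ℕ) : 𝓞 F) : F) : v.adicCompletion F) =
      algebraMap F (v.adicCompletion F) (algebraMap (𝓞 F) F ((m.factorial : ℕ) : 𝓞 F)) := rfl
    rw [this, map_natCast, map_natCast]
    simp
  change Valued.v.restrict _ < _
  rw [← hd, Valuation.restrict_lt_iff, h4, valuedAdicCompletion_eq_valuation',
    valuation_of_algebraMap]
  refine ((intValuation_le_pow_iff_mem v _ _).2 h3).trans_lt (lt_of_lt_of_le ?_ hk)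
  rw [exp_lt_exp]; push_cast; omega

/-- All the factorials lie in the product of the local integer rings, where convergence may be
tested one place at a time. -/
theorem tendsto_factorial_finiteAdeleRing :
    Tendsto (fun m : ℕ => ((m.factorial : ℕ) : FiniteAdeleRing (𝓞 F) F)) atTop (𝓝 0) := by
  have h1 : Tendsto (fun (m : ℕ) (v : HeightOneSpectrum (𝓞 F)) =>
      ((m.factorial : ℕ) : v.adicCompletionIntegers F)) atTop (𝓝 0) :=
    tendsto_pi_nhds.2 fun v => tendsto_factorial_adicCompletionIntegers v
  have h2 := (RestrictedProduct.isEmbedding_structureMap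
    (R := fun v : HeightOneSpectrum (𝓞 F) => v.adicCompletion F)
    (A := fun v => (v.adicCompletionIntegers F : Set (v.adicCompletion F)))
    (𝓕 := cofinite)).continuous.tendsto (fun _ => 0)
  have h3 : ∀ m : ℕ, (m : FiniteAdeleRing (𝓞 F) F) = RestrictedProduct.structureMap
      (fun v : HeightOneSpectrum (𝓞 F) => v.adicCompletion F)
      (fun v => (v.adicCompletionIntegers F : Set (v.adicCompletion F))) cofinite
      (fun v => (m : v.adicCompletionIntegers F)) := by
    intro m
    refine FiniteAdeleRing.ext F fun v => ?_
    rw [← map_natCast (algebraMap F (FiniteAdeleRing (𝓞 F) F))]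
    change algebraMap F (v.adicCompletion F) m = ((m : v.adicCompletionIntegers F) : v.adicCompletion F)
    rw [map_natCast]
    simp
  have h4 := h3 0
  simp only [Nat.cast_zero] at h4
  simp_rw [h3]
  rw [h4]
  exact h2.comp h1

/-- The sets `N · Ô`, for positive integers `N`, form a neighbourhood basis at zero. -/
theorem exists_nat_mul_integralFiniteAdeles_subset {W : Set (FiniteAdeleRing (𝓞 F) F)}
    (hW : W ∈ 𝓝 0) : ∃ N : ℕ, N ≠ 0 ∧ ∀ a ∈ integralFiniteAdeles F, (N : FiniteAdeleRing (𝓞 F) F) * a ∈ W := by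
  -- Multiplication is continuous at each (0, a); compactness of Ô makes the neighbourhood of zero
  -- uniform in a.
  have h1 : ∀ᶠ x : FiniteAdeleRing (𝓞 F) F in 𝓝 0, ∀ a ∈ integralFiniteAdeles F, x * a ∈ W := by
    refine isCompact_integralFiniteAdeles.eventually_forall_of_forall_eventually fun a _ => ?_
    have : Tendsto (fun z : FiniteAdeleRing (𝓞 F) F × FiniteAdeleRing (𝓞 F) F => z.1 * z.2)
      (𝓝 (0, a)) (𝓝 (0 * a)) := continuous_mul.tendsto _
    rw [zero_mul] at this
    exact this hW
  obtain ⟨m, hm⟩ := (tendsto_factorial_finiteAdeleRing.eventually h1).exists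
  exact ⟨m.factorial, m.factorial_ne_zero, hm⟩

end FiniteAdeles

/-! ### F is discrete and cocompact in 𝔸. -/

section Adeles

open IsDedekindDomain HeightOneSpectrum NumberField

variable {F : Type*} [Field F] [NumberField F]

instance t2Space_infiniteAdeleRing : T2Space (InfiniteAdeleRing F) :=
  inferInstanceAs (T2Space ((v : InfinitePlace F) → v.Completion))

instance t2Space_finiteAdeleRing : T2Space (FiniteAdeleRing (𝓞 F) F) :=
  inferInstanceAs (T2Space (RestrictedProduct (fun v : HeightOneSpectrum (𝓞 F) => v.adicCompletion F)
    (fun v => (v.adicCompletionIntegers F : Set (v.adicCompletion F))) cofinite))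

instance t2Space_adele : T2Space (Adele F) :=
  inferInstanceAs (T2Space (InfiniteAdeleRing F × FiniteAdeleRing (𝓞 F) F))

theorem continuous_adele_fst : Continuous (fun a : Adele F => a.1) :=
  (continuous_fst : Continuous (Prod.fst : InfiniteAdeleRing F × FiniteAdeleRing (𝓞 F) F → _))

theorem continuous_adele_snd : Continuous (fun a : Adele F => a.2) :=
  (continuous_snd : Continuous (Prod.snd : InfiniteAdeleRing F × FiniteAdeleRing (𝓞 F) F → _))

theorem continuous_adele_mk {X : Type*} [TopologicalSpace X] {f : X → InfiniteAdeleRing F}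
    {g : X → FiniteAdeleRing (𝓞 F) F} (hf : Continuous f) (hg : Continuous g) :
    Continuous (fun x => (f x, g x) : X → Adele F) :=
  (hf.prodMk hg : Continuous fun x => ((f x, g x) : InfiniteAdeleRing F × FiniteAdeleRing (𝓞 F) F))

theorem continuous_adele_infinite (v : InfinitePlace F) : Continuous (fun a : Adele F => a.1 v) :=
  (continuous_apply v : Continuous fun x : ((v : InfinitePlace F) → v.Completion) => x v).comp
    continuous_adele_fst

theorem continuous_adele_finite (v : HeightOneSpectrum (𝓞 F)) :
    Continuous (fun a : Adele F => a.2 v) :=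
  (RestrictedProduct.continuous_eval v).comp continuous_adele_snd

/-- The inclusion of the finite adeles in the adeles, as a homomorphism of additive groups. -/
def finiteAdele : FiniteAdeleRing (𝓞 F) F →+ Adele F where
  toFun a := (0, a)
  map_zero' := rfl
  map_add' _ _ := Prod.ext (add_zero (0 : InfiniteAdeleRing F)).symm rfl

theorem continuous_finiteAdele : Continuous (finiteAdele (F := F)) :=
  continuous_adele_mk continuous_const continuous_id

theorem continuous_ringEquiv_mixedSpace_symm {F : Type*} [Field F] :
    Continuous (InfiniteAdeleRing.ringEquiv_mixedSpace F).symm := by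
  refine continuous_pi (X := mixedEmbedding.mixedSpace F)
    (A := fun v : InfinitePlace F => v.Completion) fun v => ?_
  by_cases hv : v.IsReal
  · rw [(Isometry.isUniformInducing (InfinitePlace.Completion.isometry_extensionEmbeddingOfIsReal hv)).isInducing.continuous_iff]
    have : (InfinitePlace.Completion.extensionEmbeddingOfIsReal hv ∘
        fun x => (InfiniteAdeleRing.ringEquiv_mixedSpace F).symm x v) = fun x => x.1 ⟨v, hv⟩ := by
      funext x
      conv_rhs => rw [← (InfiniteAdeleRing.ringEquiv_mixedSpace F).apply_symm_apply x]
      rfl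
    rw [this]
    fun_prop
  · rw [InfinitePlace.not_isReal_iff_isComplex] at hv
    rw [(Isometry.isUniformInducing (InfinitePlace.Completion.isometry_extensionEmbedding v)).isInducing.continuous_iff]
    have : (InfinitePlace.Completion.extensionEmbedding v ∘
        fun x => (InfiniteAdeleRing.ringEquiv_mixedSpace F).symm x v) = fun x => x.2 ⟨v, hv⟩ := by
      funext x
      conv_rhs => rw [← (InfiniteAdeleRing.ringEquiv_mixedSpace F).apply_symm_apply x]
      rfl
    rw [this]
    fun_prop

/-- The inclusion of the archimedean space `ℝ ^ r₁ × ℂ ^ r₂` in the adeles. -/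
def archAdele : mixedEmbedding.mixedSpace F →+ Adele F where
  toFun x := ((InfiniteAdeleRing.ringEquiv_mixedSpace F).symm x, 0)
  map_zero' := by rw [map_zero]; rfl
  map_add' a b := by
    rw [map_add]
    exact Prod.ext rfl (add_zero (0 : FiniteAdeleRing (𝓞 F) F)).symm

theorem continuous_archAdele : Continuous (archAdele (F := F)) :=
  continuous_adele_mk continuous_ringEquiv_mixedSpace_symm continuous_const

theorem archAdele_mul (x y : mixedEmbedding.mixedSpace F) :
    archAdele (x * y) = archAdele x * archAdele y := by
  change ((InfiniteAdeleRing.ringEquiv_mixedSpace F).symm (x * y), _) = (_, _)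
  rw [map_mul]
  exact Prod.ext rfl (mul_zero (0 : FiniteAdeleRing (𝓞 F) F)).symm

theorem archAdele_mixedEmbedding_mul (ξ : F) (x : mixedEmbedding.mixedSpace F) :
    archAdele (mixedEmbedding F ξ * x) = algebraMap F (Adele F) ξ * archAdele x := by
  change ((InfiniteAdeleRing.ringEquiv_mixedSpace F).symm (_ * x), _) = (_, _)
  rw [map_mul, InfiniteAdeleRing.mixedEmbedding_eq_algebraMap_comp, RingEquiv.symm_apply_apply]
  exact Prod.ext rfl (mul_zero (algebraMap F (FiniteAdeleRing (𝓞 F) F) ξ)).symm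

theorem algebraMap_eq_add (ξ : F) : algebraMap F (Adele F) ξ =
    archAdele (mixedEmbedding F ξ) + finiteAdele (algebraMap F (FiniteAdeleRing (𝓞 F) F) ξ) := by
  refine Prod.ext ?_ (zero_add (algebraMap F (FiniteAdeleRing (𝓞 F) F) ξ)).symm
  change algebraMap F (InfiniteAdeleRing F) ξ =
    (InfiniteAdeleRing.ringEquiv_mixedSpace F).symm (mixedEmbedding F ξ) + 0
  rw [InfiniteAdeleRing.mixedEmbedding_eq_algebraMap_comp, RingEquiv.symm_apply_apply, add_zero]

theorem exists_archAdele_add_finiteAdele (a : Adele F) :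
    ∃ x y, a = archAdele x + finiteAdele y ∧ y = a.2 ∧
      x = InfiniteAdeleRing.ringEquiv_mixedSpace F a.1 := by
  refine ⟨InfiniteAdeleRing.ringEquiv_mixedSpace F a.1, a.2, ?_, rfl, rfl⟩
  refine Prod.ext ?_ (zero_add a.2).symm
  change a.1 = (InfiniteAdeleRing.ringEquiv_mixedSpace F).symm
    (InfiniteAdeleRing.ringEquiv_mixedSpace F a.1) + 0
  rw [RingEquiv.symm_apply_apply, add_zero]

/-- A compact set of representatives for the archimedean space modulo the ring of integers. -/
theorem exists_isCompact_mixedSpace : ∃ C : Set (mixedEmbedding.mixedSpace F), IsCompact C ∧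
    ∀ x, ∃ r : 𝓞 F, x - mixedEmbedding F r ∈ C := by
  classical
  refine ⟨closure (ZSpan.fundamentalDomain (mixedEmbedding.latticeBasis F)),
    (ZSpan.fundamentalDomain_isBounded _).isCompact_closure, fun x => ?_⟩
  obtain ⟨r, hr⟩ := (mixedEmbedding.mem_span_latticeBasis F).1
    (ZSpan.floor (mixedEmbedding.latticeBasis F) x).2
  refine ⟨r, subset_closure ?_⟩
  have hr' : mixedEmbedding F (r : F) = (ZSpan.floor (mixedEmbedding.latticeBasis F) x : _) := hr
  rw [hr']
  exact ZSpan.fract_mem_fundamentalDomain _ x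

theorem algebraMap_ringOfIntegers_mem (r : 𝓞 F) :
    algebraMap F (FiniteAdeleRing (𝓞 F) F) r ∈ integralFiniteAdeles F :=
  fun v => coe_mem_adicCompletionIntegers v r

theorem sub_mem_integralFiniteAdeles {a b : FiniteAdeleRing (𝓞 F) F}
    (ha : a ∈ integralFiniteAdeles F) (hb : b ∈ integralFiniteAdeles F) :
    a - b ∈ integralFiniteAdeles F := fun v => sub_mem (ha v) (hb v)

/-- `𝔸 = F + C + Ô` for some compact subset `C` of the archimedean space. -/
theorem exists_isCompact_archAdele : ∃ C : Set (mixedEmbedding.mixedSpace F), IsCompact C ∧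
    ∀ a : Adele F, ∃ ξ : F, ∃ x ∈ C, ∃ y ∈ integralFiniteAdeles F,
      a = algebraMap F (Adele F) ξ + archAdele x + finiteAdele y := by
  obtain ⟨C, hC, h⟩ := exists_isCompact_mixedSpace (F := F)
  refine ⟨C, hC, fun a => ?_⟩
  obtain ⟨x, y, rfl, -, -⟩ := exists_archAdele_add_finiteAdele a
  obtain ⟨η, hη⟩ := exists_sub_mem_integralFiniteAdeles y
  obtain ⟨r, hr⟩ := h (x - mixedEmbedding F η)
  refine ⟨η + r, _, hr, _, sub_mem_integralFiniteAdeles hη (algebraMap_ringOfIntegers_mem r), ?_⟩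
  rw [algebraMap_eq_add, map_add, map_add, map_add, map_sub, map_sub, map_sub, map_sub, map_add]
  abel

/-- The same with `Ô` replaced by `N · Ô`. -/
theorem exists_isCompact_archAdele_nat (N : ℕ) (hN : N ≠ 0) :
    ∃ C : Set (mixedEmbedding.mixedSpace F), IsCompact C ∧
    ∀ a : Adele F, ∃ ξ : F, ∃ x ∈ C, ∃ y ∈ integralFiniteAdeles F,
      a = algebraMap F (Adele F) ξ + archAdele x +
        finiteAdele ((N : FiniteAdeleRing (𝓞 F) F) * y) := by
  obtain ⟨C, hC, h⟩ := exists_isCompact_archAdele (F := F)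
  refine ⟨(fun x => (N : ℝ) • x) '' C, hC.image (continuous_const_smul _), fun a => ?_⟩
  -- Decompose a/N and multiply back by N: F is stable, C is dilated, and Ô becomes N · Ô.
  obtain ⟨ξ, x, hx, y, hy, hxy⟩ := h (algebraMap F (Adele F) (N : F)⁻¹ * a)
  refine ⟨N * ξ, _, ⟨x, hx, rfl⟩, y, hy, ?_⟩
  have hN' : (N : F) ≠ 0 := by exact_mod_cast hN
  have h1 : a = N • (algebraMap F (Adele F) (N : F)⁻¹ * a) := by
    rw [nsmul_eq_mul, ← mul_assoc, ← map_natCast (algebraMap F (Adele F)), ← map_mul,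
      mul_inv_cancel₀ hN', map_one, one_mul]
  rw [h1, hxy, smul_add, smul_add, ← map_nsmul, ← map_nsmul, ← map_nsmul, nsmul_eq_mul N ξ,
    nsmul_eq_mul N y]
  simp only [Nat.cast_smul_eq_nsmul]

theorem exists_isCompact_adele : ∃ D : Set (Adele F), IsCompact D ∧
    ∀ a : Adele F, ∃ ξ : F, ∃ d ∈ D, a = algebraMap F (Adele F) ξ + d := by
  obtain ⟨C, hC, h⟩ := exists_isCompact_archAdele (F := F)
  refine ⟨(fun z : mixedEmbedding.mixedSpace F × FiniteAdeleRing (𝓞 F) F =>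
    archAdele z.1 + finiteAdele z.2) '' (C ×ˢ integralFiniteAdeles F),
    (hC.prod isCompact_integralFiniteAdeles).image
      ((continuous_archAdele.comp continuous_fst).add (continuous_finiteAdele.comp continuous_snd)),
    fun a => ?_⟩
  obtain ⟨ξ, x, hx, y, hy, rfl⟩ := h a
  exact ⟨ξ, _, ⟨(x, y), ⟨hx, hy⟩, rfl⟩, add_assoc _ _ _⟩

/-- A neighbourhood of zero in the adeles contains no non-zero element of `F`. -/
theorem exists_nhds_inter_principal :
    ∃ W ∈ 𝓝 (0 : Adele F), ∀ ξ : F, algebraMap F (Adele F) ξ ∈ W → ξ = 0 := by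
  have h2 : {a : Adele F | a.2 ∈ integralFiniteAdeles F} ∈ 𝓝 (0 : Adele F) :=
    (isOpen_integralFiniteAdeles.preimage continuous_adele_snd).mem_nhds
      (fun v => zero_mem (v.adicCompletionIntegers F))
  have h1 : {a : Adele F | ∀ v : InfinitePlace F, ‖a.1 v‖ < 1} ∈ 𝓝 (0 : Adele F) := by
    rw [show {a : Adele F | ∀ v : InfinitePlace F, ‖a.1 v‖ < 1} =
      ⋂ v : InfinitePlace F, {a : Adele F | ‖a.1 v‖ < 1} by ext; simp]
    refine (Filter.iInter_mem).2 fun v => ?_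
    refine (isOpen_lt (continuous_adele_infinite v).norm continuous_const).mem_nhds ?_
    change ‖(0 : v.Completion)‖ < 1
    simp
  refine ⟨_, inter_mem h1 h2, fun ξ ⟨hξ1, hξ2⟩ => ?_⟩
  by_contra hξ
  have hint : ∀ v : HeightOneSpectrum (𝓞 F), v.valuation F ξ ≤ 1 := fun v => by
    have := hξ2 v
    change ((ξ : F) : v.adicCompletion F) ∈ _ at this
    rwa [mem_adicCompletionIntegers, valuedAdicCompletion_eq_valuation'] at this
  obtain ⟨r, rfl⟩ := HeightOneSpectrum.mem_integers_of_valuation_le_one F ξ hint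
  have hr0 : r ≠ 0 := by rintro rfl; simp at hξ
  -- A non-zero algebraic integer has norm at least 1 in absolute value, so its archimedean absolute
  -- values cannot all be less than 1.
  have h3 : ∏ v : InfinitePlace F, v (r : F) ^ v.mult < 1 := by
    have hlt : ∀ v : InfinitePlace F, v (r : F) ^ v.mult < 1 := fun v => by
      have : ‖((r : F) : v.Completion)‖ < 1 := hξ1 v
      rw [InfinitePlace.Completion.norm_coe] at this
      exact pow_lt_one₀ (apply_nonneg v _) this (InfinitePlace.mult_pos).ne'
    calc ∏ v : InfinitePlace F, v (r : F) ^ v.mult < ∏ v : InfinitePlace F, (1 : ℝ) :=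
          Finset.prod_lt_prod_of_nonempty
            (fun v _ => pow_pos (InfinitePlace.pos_iff.2 hξ) _) (fun v _ => hlt v)
            Finset.univ_nonempty
      _ = 1 := by simp
  rw [InfinitePlace.prod_eq_abs_norm] at h3
  have h4 : (Algebra.norm ℚ (r : F)) = ((Algebra.norm ℤ r : ℤ) : ℚ) :=
    (Algebra.coe_norm_int r).symm
  rw [h4] at h3
  have h5 : |Algebra.norm ℤ r| < 1 := by exact_mod_cast h3
  exact Algebra.norm_ne_zero_iff.2 hr0 (Int.abs_lt_one_iff.1 h5)

end Adeles

/-! ### The compact group 𝔸/F. -/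

section AdeleClassGroup

open IsDedekindDomain HeightOneSpectrum NumberField

variable {F : Type*} [Field F] [NumberField F]

instance discreteTopology_principalSubgroup :
    DiscreteTopology (AdeleRing.principalSubgroup (𝓞 F) F) := by
  obtain ⟨W, hW, hW0⟩ := exists_nhds_inter_principal (F := F)
  refine discreteTopology_of_isOpen_singleton_zero ?_
  rw [isOpen_singleton_iff_nhds_eq_pure, nhds_subtype_eq_comap]
  refine le_antisymm ?_ (by rw [← nhds_subtype_eq_comap]; exact pure_le_nhds 0)
  rw [Filter.le_pure_iff]
  refine ⟨W, hW, ?_⟩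
  rintro ⟨_, ⟨ξ, rfl⟩⟩ hξ
  have h0 : ξ = 0 := hW0 ξ hξ
  subst h0
  exact Subtype.ext (map_zero (algebraMap F (Adele F)))

instance isClosed_principalSubgroup :
    IsClosed (AdeleRing.principalSubgroup (𝓞 F) F : Set (Adele F)) :=
  AddSubgroup.isClosed_of_discrete

variable (F) in
/-- The compact group `𝔸 / F`. -/
abbrev AdeleClass : Type _ := Adele F ⧸ AdeleRing.principalSubgroup (𝓞 F) F

theorem mem_principalSubgroup (ξ : F) :
    algebraMap F (Adele F) ξ ∈ AdeleRing.principalSubgroup (𝓞 F) F := ⟨ξ, rfl⟩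

theorem adeleClass_mk_add (ξ : F) (a : Adele F) :
    ((algebraMap F (Adele F) ξ + a : Adele F) : AdeleClass F) = a := by
  rw [QuotientAddGroup.mk_add, (QuotientAddGroup.eq_zero_iff _).2 (mem_principalSubgroup ξ),
    zero_add]

instance compactSpace_adeleClass : CompactSpace (AdeleClass F) := by
  obtain ⟨D, hD, h⟩ := exists_isCompact_adele (F := F)
  refine ⟨(hD.image (f := fun a : Adele F => (a : AdeleClass F))
    continuous_quotient_mk').of_isClosed_subset isClosed_univ fun q _ => ?_⟩
  obtain ⟨a, rfl⟩ := QuotientAddGroup.mk_surjective q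
  obtain ⟨ξ, d, hd, rfl⟩ := h a
  exact ⟨d, hd, (adeleClass_mk_add ξ d).symm⟩

/-- A function on `𝔸` that is invariant under `F`, as a function on `𝔸 / F`. -/
def adeleLift {E : Type*} (f : Adele F → E)
    (hf : ∀ (ξ : F) a, f (algebraMap F (Adele F) ξ + a) = f a) : AdeleClass F → E :=
  Quotient.lift f (by
    intro a b hab
    obtain ⟨ξ, hξ⟩ := QuotientAddGroup.leftRel_apply.1 hab
    have : b = algebraMap F (Adele F) ξ + a := by
      rw [show algebraMap F (Adele F) ξ = -a + b from hξ]; abel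
    rw [this, hf])

theorem continuous_adeleLift {E : Type*} [TopologicalSpace E] {f : Adele F → E}
    (hf : ∀ (ξ : F) a, f (algebraMap F (Adele F) ξ + a) = f a) (hc : Continuous f) :
    Continuous (adeleLift f hf) := continuous_quot_lift _ hc

end AdeleClassGroup

/-! ### Characters of 𝔸/F: unitarity and non-triviality on factors of 𝔸. -/

section Characters

open IsDedekindDomain HeightOneSpectrum NumberField

variable {F : Type*} [Field F] [NumberField F]

/-- The complex numbers contain no small multiplicative semigroups. -/
theorem eq_one_of_norm_pow_sub_one_lt {z : ℂ} (h : ∀ m : ℕ, ‖z ^ m - 1‖ < 1 / 2) : z = 1 := by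
  by_contra hz
  have hpos : 0 < ‖z - 1‖ := norm_pos_iff.2 (sub_ne_zero.2 hz)
  -- As long as w = z^(2^k) is within 1/2 of 1, squaring multiplies w − 1 by w + 1, which has norm
  -- at least 3/2; the distance to 1 would grow without bound.
  have key : ∀ k : ℕ, (3 / 2 : ℝ) ^ k * ‖z - 1‖ ≤ ‖z ^ (2 ^ k) - 1‖ := by
    intro k
    induction k with
    | zero => simp
    | succ k ih =>
      have h1 : z ^ (2 ^ (k + 1)) - 1 = (z ^ 2 ^ k - 1) * (2 + (z ^ 2 ^ k - 1)) := by
        rw [pow_succ 2 k, pow_mul]; ring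
      have h2 : (3 / 2 : ℝ) ≤ ‖2 + (z ^ 2 ^ k - 1)‖ := by
        have h3 : ‖(2 : ℂ)‖ - ‖-(z ^ 2 ^ k - 1)‖ ≤ ‖(2 : ℂ) - -(z ^ 2 ^ k - 1)‖ := norm_sub_norm_le _ _
        rw [norm_neg, sub_neg_eq_add] at h3
        have h4 := h (2 ^ k)
        have h5 : ‖(2 : ℂ)‖ = 2 := by simp
        linarith
      rw [h1, norm_mul, pow_succ]
      calc (3 / 2 : ℝ) ^ k * (3 / 2) * ‖z - 1‖ = ((3 / 2 : ℝ) ^ k * ‖z - 1‖) * (3 / 2) := by ring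
        _ ≤ _ := mul_le_mul ih h2 (by norm_num) (norm_nonneg _)
  obtain ⟨k, hk⟩ := pow_unbounded_of_one_lt (1 / ‖z - 1‖) (by norm_num : (1 : ℝ) < 3 / 2)
  have h1 := key k
  have h2 := h (2 ^ k)
  rw [div_lt_iff₀ hpos] at hk
  linarith

variable {ψ : AddChar (Adele F) ℂ}

theorem addChar_algebraMap_add (hψ_F : ∀ x : F, ψ (algebraMap F (Adele F) x) = 1) (ξ : F)
    (a : Adele F) : ψ (algebraMap F (Adele F) ξ + a) = ψ a := by
  rw [AddChar.map_add_eq_mul, hψ_F, one_mul]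

/-- A compact set of representatives bounds ψ everywhere, hence bounds all powers of ψ(a) and of
ψ(-a). -/
theorem norm_addChar (hψ_cont : Continuous ψ)
    (hψ_F : ∀ x : F, ψ (algebraMap F (Adele F) x) = 1) (a : Adele F) : ‖ψ a‖ = 1 := by
  obtain ⟨D, hD, h⟩ := exists_isCompact_adele (F := F)
  obtain ⟨B, hB⟩ := hD.exists_bound_of_continuousOn hψ_cont.continuousOn
  have hle : ∀ a, ‖ψ a‖ ≤ 1 := by
    intro a
    by_contra! ha
    obtain ⟨k, hk⟩ := pow_unbounded_of_one_lt B ha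
    obtain ⟨ξ, d, hd, hkd⟩ := h (k • a)
    have h1 : ‖ψ (k • a)‖ ≤ B := by
      rw [hkd, addChar_algebraMap_add hψ_F]; exact hB d hd
    rw [AddChar.map_nsmul_eq_pow, norm_pow] at h1
    linarith
  refine le_antisymm (hle a) ?_
  have h1 : ‖ψ a‖ * ‖ψ (-a)‖ = 1 := by
    rw [← norm_mul, ← AddChar.map_add_eq_mul, add_neg_cancel, AddChar.map_zero_eq_one, norm_one]
  nlinarith [hle (-a), norm_nonneg (ψ a)]

/-- If a character is close to one on a set stable under multiples, it is trivial there. -/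
theorem addChar_eq_one_of_forall_nsmul {a : Adele F}
    (h : ∀ m : ℕ, ‖ψ (m • a) - 1‖ < 1 / 2) : ψ a = 1 :=
  eq_one_of_norm_pow_sub_one_lt fun m => by rw [← AddChar.map_nsmul_eq_pow]; exact h m

/-- Weak form of strong approximation: if `e` is an idempotent adele such that `e𝔸` is not
relatively compact, then there are non-zero elements of `F` which are small outside `e`. -/
theorem exists_ne_zero_one_sub_mul_mem {e : Adele F} (S : ℕ → Adele F)
    (hS : ∀ m, (1 - e) * S m = 0) {U : Set (Adele F)} (hU : U ∈ 𝓝 0)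
    (hSU : ∀ l m, l ≠ m → S l - S m ∉ U) {W : Set (Adele F)} (hW : W ∈ 𝓝 0) :
    ∃ ξ : F, ξ ≠ 0 ∧ (1 - e) * algebraMap F (Adele F) ξ ∈ W := by
  obtain ⟨D, hD, h⟩ := exists_isCompact_adele (F := F)
  have hW' : (fun x => (1 - e) * (-x)) ⁻¹' W ∈ 𝓝 (0 : Adele F) := by
    refine ContinuousAt.preimage_mem_nhds ?_ (by simpa using hW)
    exact (continuous_const.mul continuous_neg).continuousAt
  have hV : (fun z : Adele F × Adele F => z.1 - z.2) ⁻¹'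
      (U ∩ (fun x => (1 - e) * (-x)) ⁻¹' W) ∈ 𝓝 ((0 : Adele F), (0 : Adele F)) := by
    refine ContinuousAt.preimage_mem_nhds (continuous_fst.sub continuous_snd).continuousAt ?_
    simpa using inter_mem hU hW'
  rw [nhds_prod_eq, Filter.mem_prod_self_iff] at hV
  obtain ⟨V, hV0, hV⟩ := hV
  obtain ⟨t, -, ht⟩ := hD.elim_nhds_subcover (fun a => (fun x => x - a) ⁻¹' V) (fun a _ => by
    refine ContinuousAt.preimage_mem_nhds (continuous_id.sub continuous_const).continuousAt ?_
    simpa using hV0)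
  choose ξ d hd hξ using fun m => h (S m)
  have hex : ∀ m, ∃ a : t, d m - a ∈ V := fun m => by
    obtain ⟨a, ha⟩ := Set.mem_iUnion.1 (ht (hd m))
    obtain ⟨hat, ha'⟩ := Set.mem_iUnion.1 ha
    exact ⟨⟨a, hat⟩, ha'⟩
  choose a ha using hex
  -- Pigeonhole: two of the representatives `d m` are close. Their rational parts must differ, as
  -- otherwise `S l - S m` would be this small difference and lie in `U`; off `e` the sequence
  -- vanishes, so there the difference of rational parts is small.
  obtain ⟨l, m, hlm, hal⟩ := Finite.exists_ne_map_eq_of_infinite a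
  have h1 : d l - d m ∈ U ∩ (fun x => (1 - e) * (-x)) ⁻¹' W := by
    have h2 := @hV (d l - a l, d m - a m) ⟨ha l, ha m⟩
    simpa [hal] using h2
  have h3 : S l - S m = algebraMap F (Adele F) (ξ l - ξ m) + (d l - d m) := by
    rw [hξ l, hξ m, map_sub]; abel
  refine ⟨ξ l - ξ m, fun h0 => hSU l m hlm ?_, ?_⟩
  · rw [h3, h0, map_zero, zero_add]
    exact h1.1
  · have h4 : (1 - e) * algebraMap F (Adele F) (ξ l - ξ m) = (1 - e) * (-(d l - d m)) := by
      have h5 : algebraMap F (Adele F) (ξ l - ξ m) = (S l - S m) + (-(d l - d m)) := by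
        rw [h3]; abel
      rw [h5, mul_add, mul_sub, hS, hS, sub_zero, zero_add]
    rw [h4]
    exact h1.2

/-- A non-trivial character of `𝔸 / F` is non-trivial on `e𝔸`, if `e𝔸` is not relatively
compact. -/
theorem exists_addChar_mul_ne_one (hψ_cont : Continuous ψ) (hψ_ne : ψ ≠ 1)
    (hψ_F : ∀ x : F, ψ (algebraMap F (Adele F) x) = 1)
    {e : Adele F} (S : ℕ → Adele F) (hS : ∀ m, (1 - e) * S m = 0) {U : Set (Adele F)}
    (hU : U ∈ 𝓝 0) (hSU : ∀ l m, l ≠ m → S l - S m ∉ U) : ∃ a, ψ (e * a) ≠ 1 := by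
  by_contra! htriv
  obtain ⟨D, hD, h⟩ := exists_isCompact_adele (F := F)
  have h1 : ∀ᶠ x : Adele F in 𝓝 0, ∀ d ∈ D, ‖ψ (x * d) - 1‖ < 1 / 2 := by
    refine hD.eventually_forall_of_forall_eventually fun d _ => ?_
    have hc : ContinuousAt (fun z : Adele F × Adele F => ‖ψ (z.1 * z.2) - 1‖) (0, d) := by fun_prop
    refine hc.eventually_lt continuousAt_const ?_
    simp
  -- If ψ were trivial on e𝔸, then scaling a decomposition 𝔸 = F + D by this ξ would leave only the
  -- part (1 − e)ξD, on which ψ is close to 1. Every multiple of every adele would then have ψ close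
  -- to 1, forcing ψ = 1.
  obtain ⟨ξ, hξ0, hξ⟩ := exists_ne_zero_one_sub_mul_mem S hS hU hSU h1
  refine hψ_ne (DFunLike.ext _ _ fun a => ?_)
  refine addChar_eq_one_of_forall_nsmul fun m => ?_
  obtain ⟨η, d, hd, hηd⟩ := h (algebraMap F (Adele F) ξ⁻¹ * (m • a))
  have h2 : m • a = algebraMap F (Adele F) (ξ * η) + (e * (algebraMap F (Adele F) ξ * d) +
      (1 - e) * algebraMap F (Adele F) ξ * d) := by
    have : m • a = algebraMap F (Adele F) ξ * (algebraMap F (Adele F) ξ⁻¹ * (m • a)) := by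
      rw [← mul_assoc, ← map_mul, mul_inv_cancel₀ hξ0, map_one, one_mul]
    rw [this, hηd, map_mul]
    ring
  rw [h2, addChar_algebraMap_add hψ_F, AddChar.map_add_eq_mul, htriv, one_mul]
  exact hξ d hd

end Characters

/-! ### Non-degeneracy of the pairing ψ(xy), and F as its own annihilator. -/

section LocalNontriviality

open IsDedekindDomain HeightOneSpectrum NumberField mixedEmbedding
open scoped Classical

variable {F : Type*} [Field F] [NumberField F]

/-- The idempotents are those of the single coordinates; z inverts the coordinate of y of largest
absolute value, which gives the norm bound. -/
theorem exists_finite_idempotents : ∃ I : Set (mixedSpace F), I.Finite ∧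
    (∀ e ∈ I, e ≠ 0 ∧ e * e = e) ∧
      ∀ y : mixedSpace F, y ≠ 0 → ∃ e ∈ I, ∃ z, y * z = e ∧ ‖z‖ ≤ ‖y‖⁻¹ := by
  refine ⟨Set.range (fun v : {w : InfinitePlace F // w.IsReal} => ((Pi.single v 1, 0) : mixedSpace F)) ∪
    Set.range (fun v : {w : InfinitePlace F // w.IsComplex} => ((0, Pi.single v 1) : mixedSpace F)),
    (Set.finite_range _).union (Set.finite_range _), ?_, fun y hy => ?_⟩
  · rintro e (⟨v, rfl⟩ | ⟨v, rfl⟩)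
    · refine ⟨fun h => ?_, ?_⟩
      · simpa using congr_fun (congr_arg Prod.fst h) v
      · refine Prod.ext ?_ (zero_mul 0)
        change Pi.single v 1 * Pi.single v 1 = Pi.single v 1
        rw [← Pi.single_mul, one_mul]
    · refine ⟨fun h => ?_, ?_⟩
      · simpa using congr_fun (congr_arg Prod.snd h) v
      · refine Prod.ext (zero_mul 0) ?_
        change Pi.single v 1 * Pi.single v 1 = Pi.single v 1
        rw [← Pi.single_mul, one_mul]
  · have hypos : 0 < ‖y‖ := norm_pos_iff.2 hy
    rcases max_choice ‖y.1‖ ‖y.2‖ with hmax | hmax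
    · have hn : ‖y‖ = ‖y.1‖ := hmax
      obtain ⟨v, hv⟩ : ∃ v, ‖y.1‖ ≤ ‖y.1 v‖ := by
        by_contra! hlt
        exact lt_irrefl _ ((pi_norm_lt_iff (hn ▸ hypos)).2 hlt)
      rw [← hn] at hv
      have hv0 : y.1 v ≠ 0 := norm_pos_iff.1 (hypos.trans_le hv)
      refine ⟨_, Or.inl ⟨v, rfl⟩, (Pi.single v (y.1 v)⁻¹, 0), Prod.ext ?_ (mul_zero y.2), ?_⟩
      · change y.1 * Pi.single v (y.1 v)⁻¹ = Pi.single v 1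
        rw [← Pi.single_mul_right, mul_inv_cancel₀ hv0]
      · rw [Prod.norm_def]
        simp only [norm_zero, Pi.norm_single, norm_inv]
        rw [max_eq_left (by positivity)]
        exact inv_anti₀ hypos hv
    · have hn : ‖y‖ = ‖y.2‖ := hmax
      obtain ⟨v, hv⟩ : ∃ v, ‖y.2‖ ≤ ‖y.2 v‖ := by
        by_contra! hlt
        exact lt_irrefl _ ((pi_norm_lt_iff (hn ▸ hypos)).2 hlt)
      rw [← hn] at hv
      have hv0 : y.2 v ≠ 0 := norm_pos_iff.1 (hypos.trans_le hv)
      refine ⟨_, Or.inr ⟨v, rfl⟩, (0, Pi.single v (y.2 v)⁻¹), Prod.ext (mul_zero y.1) ?_, ?_⟩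
      · change y.2 * Pi.single v (y.2 v)⁻¹ = Pi.single v 1
        rw [← Pi.single_mul_right, mul_inv_cancel₀ hv0]
      · rw [Prod.norm_def]
        simp only [norm_zero, Pi.norm_single, norm_inv]
        rw [max_eq_right (by positivity)]
        exact inv_anti₀ hypos hv

theorem continuous_ringEquiv_mixedSpace {F : Type*} [Field F] :
    Continuous (InfiniteAdeleRing.ringEquiv_mixedSpace F) := by
  refine Continuous.prodMk (continuous_pi fun v => ?_) (continuous_pi fun v => ?_)
  · exact (InfinitePlace.Completion.isometry_extensionEmbeddingOfIsReal v.2).continuous.comp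
      (continuous_apply (v : InfinitePlace F) :
        Continuous fun x : ((v : InfinitePlace F) → v.Completion) => x v)
  · exact (InfinitePlace.Completion.isometry_extensionEmbedding v.1).continuous.comp
      (continuous_apply (v : InfinitePlace F) :
        Continuous fun x : ((v : InfinitePlace F) → v.Completion) => x v)

theorem ringEquiv_mixedSpace_archAdele (x : mixedSpace F) :
    InfiniteAdeleRing.ringEquiv_mixedSpace F (archAdele x).1 = x :=
  (InfiniteAdeleRing.ringEquiv_mixedSpace F).apply_symm_apply x

theorem archAdele_mul_eq (x : mixedSpace F) (a : Adele F) :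
    archAdele x * a = archAdele (x * InfiniteAdeleRing.ringEquiv_mixedSpace F a.1) := by
  change (_, _) = ((InfiniteAdeleRing.ringEquiv_mixedSpace F).symm (x * _), _)
  rw [map_mul, RingEquiv.symm_apply_apply]
  exact Prod.ext rfl (zero_mul a.2)

variable {ψ : AddChar (Adele F) ℂ}

/-- The multiples m·e are separated in norm, so e𝔸 is not relatively compact. -/
theorem exists_addChar_archAdele_ne_one (hψ_cont : Continuous ψ) (hψ_ne : ψ ≠ 1)
    (hψ_F : ∀ x : F, ψ (algebraMap F (Adele F) x) = 1) {e : mixedSpace F} (he0 : e ≠ 0)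
    (he : e * e = e) : ∃ x, ψ (archAdele (e * x)) ≠ 1 := by
  have hpos : 0 < ‖e‖ := norm_pos_iff.2 he0
  obtain ⟨a, ha⟩ := exists_addChar_mul_ne_one hψ_cont hψ_ne hψ_F (e := archAdele e)
    (fun m => archAdele (m • e)) (fun m => by
      rw [sub_mul, one_mul, ← archAdele_mul, mul_smul_comm, he, sub_self])
    (U := {a | ‖InfiniteAdeleRing.ringEquiv_mixedSpace F a.1‖ < ‖e‖})
    ((isOpen_lt (continuous_ringEquiv_mixedSpace.comp continuous_adele_fst).norm
      continuous_const).mem_nhds (by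
        change ‖InfiniteAdeleRing.ringEquiv_mixedSpace F (0 : InfiniteAdeleRing F)‖ < ‖e‖
        rwa [map_zero, norm_zero])) (by
      intro l m hlm hmem
      rw [← map_sub] at hmem
      change ‖InfiniteAdeleRing.ringEquiv_mixedSpace F (archAdele (l • e - m • e)).1‖ < ‖e‖ at hmem
      rw [ringEquiv_mixedSpace_archAdele, ← natCast_zsmul, ← natCast_zsmul, ← sub_smul,
        ← Int.cast_smul_eq_zsmul ℝ, _root_.norm_smul] at hmem
      have h1 : (1 : ℝ) ≤ ‖(((l : ℤ) - (m : ℤ) : ℤ) : ℝ)‖ := by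
        rw [Real.norm_eq_abs, ← Int.cast_abs]
        have : (1 : ℤ) ≤ |(l : ℤ) - m| := Int.one_le_abs (by omega)
        exact_mod_cast this
      nlinarith)
  exact ⟨_, by rwa [archAdele_mul_eq] at ha⟩

/-- The finite adele which is `x` at the place `v` and zero elsewhere. -/
def finiteSingle (v : HeightOneSpectrum (𝓞 F)) (x : v.adicCompletion F) :
    FiniteAdeleRing (𝓞 F) F := by
  exact ⟨Pi.single v x, by
    refine (Set.finite_singleton v).subset fun w hw => ?_
    by_contra hne
    have hz : Pi.single v x w = 0 := Pi.single_eq_of_ne (show w ≠ v from hne) x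
    refine hw ?_
    change Pi.single v x w ∈ w.adicCompletionIntegers F
    rw [hz]
    exact zero_mem _⟩

theorem finiteSingle_same (v : HeightOneSpectrum (𝓞 F)) (x : v.adicCompletion F) :
    finiteSingle v x v = x := by
  exact Pi.single_eq_same v x

theorem finiteSingle_ne {v w : HeightOneSpectrum (𝓞 F)} (h : w ≠ v) (x : v.adicCompletion F) :
    finiteSingle v x w = 0 := by
  exact Pi.single_eq_of_ne h x

theorem finiteSingle_one_mul (v : HeightOneSpectrum (𝓞 F)) (a : FiniteAdeleRing (𝓞 F) F) :
    finiteSingle v 1 * a = finiteSingle v (a v) := by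
  refine FiniteAdeleRing.ext F fun w => ?_
  change finiteSingle v 1 w * a w = finiteSingle v (a v) w
  by_cases h : w = v
  · subst h; rw [finiteSingle_same, finiteSingle_same, one_mul]
  · rw [finiteSingle_ne h, finiteSingle_ne h, zero_mul]

theorem mul_finiteSingle (v : HeightOneSpectrum (𝓞 F)) (a : FiniteAdeleRing (𝓞 F) F)
    (x : v.adicCompletion F) : a * finiteSingle v x = finiteSingle v (a v * x) := by
  refine FiniteAdeleRing.ext F fun w => ?_
  change a w * finiteSingle v x w = finiteSingle v (a v * x) w
  by_cases h : w = v
  · subst h; rw [finiteSingle_same, finiteSingle_same]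
  · rw [finiteSingle_ne h, finiteSingle_ne h, mul_zero]

theorem finiteAdele_mul_eq (x : FiniteAdeleRing (𝓞 F) F) (a : Adele F) :
    finiteAdele x * a = finiteAdele (x * a.2) :=
  Prod.ext (zero_mul a.1) rfl

/-- The powers of an inverse uniformizer serve as separated sequence: the difference of two distinct
ones is not integral. -/
theorem exists_addChar_finiteSingle_ne_one (hψ_cont : Continuous ψ) (hψ_ne : ψ ≠ 1)
    (hψ_F : ∀ x : F, ψ (algebraMap F (Adele F) x) = 1) (v : HeightOneSpectrum (𝓞 F)) :
    ∃ x, ψ (finiteAdele (finiteSingle v x)) ≠ 1 := by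
  obtain ⟨π, hπ⟩ := v.valuation_exists_uniformizer F
  have hS : ∀ m : ℕ, Valued.v (algebraMap F (v.adicCompletion F) (π⁻¹ ^ m)) =
      WithZero.exp (m : ℤ) := fun m => by
    change Valued.v (((π⁻¹ ^ m : F)) : v.adicCompletion F) = _
    rw [valuedAdicCompletion_eq_valuation', map_pow, map_inv₀, hπ, ← WithZero.exp_neg, neg_neg,
      ← WithZero.exp_nsmul]
    simp
  obtain ⟨a, ha⟩ := exists_addChar_mul_ne_one hψ_cont hψ_ne hψ_F
    (e := finiteAdele (finiteSingle v 1))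
    (fun m => finiteAdele (finiteSingle v (algebraMap F (v.adicCompletion F) (π⁻¹ ^ m))))
    (fun m => by
      rw [sub_mul, one_mul, finiteAdele_mul_eq, finiteSingle_one_mul]
      change _ - finiteAdele (finiteSingle v (finiteSingle v _ v)) = 0
      rw [finiteSingle_same, sub_self])
    (U := {a | a.2 v ∈ v.adicCompletionIntegers F})
    (((Valued.isOpen_valuationSubring _).preimage (continuous_adele_finite v)).mem_nhds
      (zero_mem (v.adicCompletionIntegers F))) (by
      intro l m hlm hmem
      change finiteSingle v (algebraMap F (v.adicCompletion F) (π⁻¹ ^ l)) v -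
        finiteSingle v (algebraMap F (v.adicCompletion F) (π⁻¹ ^ m)) v ∈
          v.adicCompletionIntegers F at hmem
      rw [finiteSingle_same, finiteSingle_same, mem_adicCompletionIntegers] at hmem
      rcases lt_or_gt_of_ne hlm with hlt | hlt
      · rw [Valuation.map_sub_eq_of_lt_right _ (by
          rw [hS, hS, WithZero.exp_lt_exp]; exact_mod_cast hlt), hS, ← WithZero.exp_zero,
          WithZero.exp_le_exp] at hmem
        omega
      · rw [Valuation.map_sub_eq_of_lt_left _ (by
          rw [hS, hS, WithZero.exp_lt_exp]; exact_mod_cast hlt), hS, ← WithZero.exp_zero,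
          WithZero.exp_le_exp] at hmem
        omega)
  refine ⟨a.2 v, ?_⟩
  rwa [finiteAdele_mul_eq, finiteSingle_one_mul] at ha

/-- A non-zero component of t could be inverted, so that ψ would be trivial on a whole local factor
(or archimedean coordinate). -/
theorem eq_zero_of_addChar_mul_eq_one (hψ_cont : Continuous ψ) (hψ_ne : ψ ≠ 1)
    (hψ_F : ∀ x : F, ψ (algebraMap F (Adele F) x) = 1) {t : Adele F}
    (ht : ∀ a, ψ (t * a) = 1) : t = 0 := by
  obtain ⟨y, z, rfl, -, -⟩ := exists_archAdele_add_finiteAdele t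
  have hy : y = 0 := by
    by_contra hy
    obtain ⟨I, -, hI, h⟩ := exists_finite_idempotents (F := F)
    obtain ⟨e, heI, y', hy', -⟩ := h y hy
    obtain ⟨x, hx⟩ := exists_addChar_archAdele_ne_one hψ_cont hψ_ne hψ_F (hI e heI).1 (hI e heI).2
    have h1 := ht (archAdele (y' * x))
    rw [mul_comm, archAdele_mul_eq] at h1
    change ψ (archAdele (y' * x * InfiniteAdeleRing.ringEquiv_mixedSpace F ((archAdele y).1 + 0))) = 1 at h1
    rw [add_zero, ringEquiv_mixedSpace_archAdele, mul_comm (y' * x), ← mul_assoc, hy'] at h1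
    exact hx h1
  have hz : z = 0 := by
    refine FiniteAdeleRing.ext F fun v => ?_
    by_contra hz
    obtain ⟨x, hx⟩ := exists_addChar_finiteSingle_ne_one hψ_cont hψ_ne hψ_F v
    have h1 := ht (finiteAdele (finiteSingle v ((z v)⁻¹ * x)))
    rw [mul_comm, finiteAdele_mul_eq] at h1
    change ψ (finiteAdele (finiteSingle v ((z v)⁻¹ * x) * (0 + z))) = 1 at h1
    rw [zero_add, mul_comm, mul_finiteSingle, mul_inv_cancel_left₀ hz] at h1
    exact hx h1
  rw [hy, hz, map_zero, map_zero, add_zero]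

/-- For every character there are archimedean elements of size `O(‖y‖⁻¹)` on which the character
`x ↦ ψ(y x)` is far from one. -/
theorem exists_norm_le_addChar_archAdele (hψ_cont : Continuous ψ) (hψ_ne : ψ ≠ 1)
    (hψ_F : ∀ x : F, ψ (algebraMap F (Adele F) x) = 1) :
    ∃ C : ℝ, 0 ≤ C ∧ ∀ y : mixedSpace F, y ≠ 0 →
      ∃ h, ‖h‖ ≤ C * ‖y‖⁻¹ ∧ 1 / 2 ≤ ‖ψ (archAdele (y * h)) - 1‖ := by
  obtain ⟨I, hfin, hI, h⟩ := exists_finite_idempotents (F := F)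
  -- Passing to an integer multiple moves a non-trivial value of ψ to distance at least 1/2 from 1.
  have hex : ∀ e : I, ∃ x, 1 / 2 ≤ ‖ψ (archAdele (e * x)) - 1‖ := by
    intro e
    obtain ⟨x, hx⟩ := exists_addChar_archAdele_ne_one hψ_cont hψ_ne hψ_F (hI e e.2).1 (hI e e.2).2
    by_contra! hlt
    refine hx (addChar_eq_one_of_forall_nsmul fun m => ?_)
    rw [← map_nsmul, ← mul_smul_comm]
    exact hlt _
  choose x hx using hex
  have := hfin.to_subtype
  obtain ⟨C, hC⟩ := (Set.finite_range fun e : I => ‖x e‖).bddAbove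
  refine ⟨max C 0, le_max_right _ _, fun y hy => ?_⟩
  obtain ⟨e, he, z, hz, hzn⟩ := h y hy
  refine ⟨z * x ⟨e, he⟩, ?_, ?_⟩
  · refine (norm_mul_le _ _).trans ?_
    rw [mul_comm]
    exact mul_le_mul ((hC ⟨_, rfl⟩).trans (le_max_left _ _)) hzn (norm_nonneg _) (le_max_right _ _)
  · rw [← mul_assoc, hz]
    exact hx ⟨e, he⟩

/-- `F` is its own annihilator with respect to a non-trivial character of `𝔸 / F`. -/
theorem mem_principalSubgroup_of_addChar_eq_one (hψ_cont : Continuous ψ) (hψ_ne : ψ ≠ 1)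
    (hψ_F : ∀ x : F, ψ (algebraMap F (Adele F) x) = 1) {t : Adele F}
    (ht : ∀ ξ : F, ψ (algebraMap F (Adele F) ξ * t) = 1) :
    t ∈ AdeleRing.principalSubgroup (𝓞 F) F := by
  obtain ⟨D, hD, h⟩ := exists_isCompact_adele (F := F)
  have h1 : ∀ᶠ x : Adele F in 𝓝 0, ∀ d ∈ D, ‖ψ (x * d) - 1‖ < 1 / 2 := by
    refine hD.eventually_forall_of_forall_eventually fun d _ => ?_
    have hc : ContinuousAt (fun z : Adele F × Adele F => ‖ψ (z.1 * z.2) - 1‖) (0, d) := by fun_prop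
    refine hc.eventually_lt continuousAt_const ?_
    simp
  -- The annihilator of F has no small non-zero elements: if s kills F and ψ is nearly trivial on
  -- sD, then ψ is nearly trivial on all multiples of s𝔸 = s(F + D).
  have hsmall : ∀ s : Adele F, (∀ ξ : F, ψ (algebraMap F (Adele F) ξ * s) = 1) →
      (∀ d ∈ D, ‖ψ (s * d) - 1‖ < 1 / 2) → s = 0 := by
    intro s hs hsd
    refine eq_zero_of_addChar_mul_eq_one hψ_cont hψ_ne hψ_F fun a => ?_
    refine addChar_eq_one_of_forall_nsmul fun m => ?_
    obtain ⟨ξ, d, hd, hξd⟩ := h (m • a)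
    rw [← mul_smul_comm, hξd, mul_add, AddChar.map_add_eq_mul, mul_comm s, hs, one_mul]
    exact hsd d hd
  have hV : (fun z : Adele F × Adele F => z.1 - z.2) ⁻¹'
      {x | ∀ d ∈ D, ‖ψ (x * d) - 1‖ < 1 / 2} ∈ 𝓝 ((0 : Adele F), (0 : Adele F)) := by
    refine ContinuousAt.preimage_mem_nhds (continuous_fst.sub continuous_snd).continuousAt ?_
    rw [sub_zero]
    exact h1
  rw [nhds_prod_eq, Filter.mem_prod_self_iff] at hV
  obtain ⟨V, hV0, hV⟩ := hV
  obtain ⟨s, -, hs⟩ := hD.elim_nhds_subcover (fun a => (fun x => x - a) ⁻¹' V) (fun a _ => by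
    refine ContinuousAt.preimage_mem_nhds (continuous_id.sub continuous_const).continuousAt ?_
    simpa using hV0)
  choose ξ d hd hξ using fun m : ℕ => h (algebraMap F (Adele F) (m : F) * t)
  have hex : ∀ m, ∃ a : s, d m - a ∈ V := fun m => by
    obtain ⟨a, ha⟩ := Set.mem_iUnion.1 (hs (hd m))
    obtain ⟨hat, ha'⟩ := Set.mem_iUnion.1 ha
    exact ⟨⟨a, hat⟩, ha'⟩
  choose a ha using hex
  -- Pigeonhole on the multiples of t modulo F: (l − m)t minus an element of F is small and still
  -- annihilates F, hence is zero; dividing by l − m puts t in F.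
  obtain ⟨l, m, hlm, hal⟩ := Finite.exists_ne_map_eq_of_infinite a
  have h2 : ∀ x ∈ D, ‖ψ ((d l - d m) * x) - 1‖ < 1 / 2 := by
    have h2 := @hV (d l - a l, d m - a m) ⟨ha l, ha m⟩
    simpa [hal] using h2
  have h3 : d l - d m = algebraMap F (Adele F) ((l : F) - m) * t -
      algebraMap F (Adele F) (ξ l - ξ m) := by
    rw [map_sub, map_sub, sub_mul, hξ l, hξ m]; abel
  have h4 := hsmall (d l - d m) (fun η => by
    rw [h3, mul_sub, ← mul_assoc, ← map_mul, ← map_mul, AddChar.map_sub_eq_div, ht, hψ_F,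
      div_one]) h2
  have hlm' : (l : F) - m ≠ 0 := sub_ne_zero.2 (by exact_mod_cast hlm)
  rw [h3, sub_eq_zero] at h4
  have h5 : t = algebraMap F (Adele F) (((l : F) - m)⁻¹ * (ξ l - ξ m)) := by
    rw [map_mul, ← h4, ← mul_assoc, ← map_mul, inv_mul_cancel₀ hlm', map_one, one_mul]
  rw [h5]
  exact mem_principalSubgroup _

end LocalNontriviality

/-! ### Fourier series on 𝔸/F with summable coefficients. -/

section FourierSeries

open IsDedekindDomain HeightOneSpectrum NumberField mixedEmbedding
open scoped Classical

variable {F : Type*} [Field F] [NumberField F]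

instance : MeasurableSpace (AdeleClass F) := borel _

instance : BorelSpace (AdeleClass F) := ⟨rfl⟩

variable (F) in
/-- The Haar probability measure on `𝔸 / F`. -/
def adeleClassMeasure : Measure (AdeleClass F) := Measure.addHaarMeasure ⊤

instance : (adeleClassMeasure F).IsAddHaarMeasure :=
  inferInstanceAs (Measure.addHaarMeasure ⊤).IsAddHaarMeasure

instance : IsProbabilityMeasure (adeleClassMeasure F) :=
  ⟨by
    have h := Measure.addHaarMeasure_self (G := AdeleClass F) (K₀ := ⊤)
    rwa [TopologicalSpace.PositiveCompacts.coe_top] at h⟩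

/-- The character `a ↦ ψ(ξ a)`. -/
def classChar {ψ : AddChar (Adele F) ℂ} (hψ_cont : Continuous ψ)
    (hψ_F : ∀ x : F, ψ (algebraMap F (Adele F) x) = 1) (ξ : F) : C(AdeleClass F, ℂ) where
  toFun := adeleLift (fun a => ψ (algebraMap F (Adele F) ξ * a)) (fun η a => by
    rw [mul_add, ← map_mul, addChar_algebraMap_add hψ_F])
  continuous_toFun := continuous_adeleLift _ (by fun_prop)

variable {ψ : AddChar (Adele F) ℂ} (hψ_cont : Continuous ψ) (hψ_ne : ψ ≠ 1)
  (hψ_F : ∀ x : F, ψ (algebraMap F (Adele F) x) = 1)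

theorem classChar_mk (ξ : F) (a : Adele F) :
    classChar hψ_cont hψ_F ξ (a : AdeleClass F) = ψ (algebraMap F (Adele F) ξ * a) := rfl

theorem classChar_add_apply (ξ : F) (s t : AdeleClass F) :
    classChar hψ_cont hψ_F ξ (s + t) = classChar hψ_cont hψ_F ξ s * classChar hψ_cont hψ_F ξ t := by
  obtain ⟨a, rfl⟩ := QuotientAddGroup.mk_surjective s
  obtain ⟨b, rfl⟩ := QuotientAddGroup.mk_surjective t
  rw [← QuotientAddGroup.mk_add, classChar_mk, classChar_mk, classChar_mk, mul_add,
    AddChar.map_add_eq_mul]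

theorem classChar_zero_apply (ξ : F) : classChar hψ_cont hψ_F ξ 0 = 1 := by
  rw [← QuotientAddGroup.mk_zero, classChar_mk, mul_zero, AddChar.map_zero_eq_one]

theorem classChar_mul (ξ η : F) : classChar hψ_cont hψ_F ξ * classChar hψ_cont hψ_F η =
    classChar hψ_cont hψ_F (ξ + η) := by
  ext s
  obtain ⟨a, rfl⟩ := QuotientAddGroup.mk_surjective s
  rw [ContinuousMap.mul_apply, classChar_mk, classChar_mk, classChar_mk, map_add, add_mul,
    AddChar.map_add_eq_mul]

theorem classChar_zero : classChar hψ_cont hψ_F (0 : F) = 1 := by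
  ext s
  obtain ⟨a, rfl⟩ := QuotientAddGroup.mk_surjective s
  rw [classChar_mk, map_zero, zero_mul, AddChar.map_zero_eq_one, ContinuousMap.one_apply]

theorem norm_classChar_apply (ξ : F) (s : AdeleClass F) : ‖classChar hψ_cont hψ_F ξ s‖ = 1 := by
  obtain ⟨a, rfl⟩ := QuotientAddGroup.mk_surjective s
  rw [classChar_mk, norm_addChar hψ_cont hψ_F]

theorem star_classChar (ξ : F) :
    star (classChar hψ_cont hψ_F ξ) = classChar hψ_cont hψ_F (-ξ) := by
  ext s
  have h1 : classChar hψ_cont hψ_F ξ s * classChar hψ_cont hψ_F (-ξ) s = 1 := by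
    rw [← ContinuousMap.mul_apply, classChar_mul, add_neg_cancel, classChar_zero,
      ContinuousMap.one_apply]
  rw [ContinuousMap.star_apply, RCLike.star_def, ← RCLike.inv_eq_conj
    (norm_classChar_apply hψ_cont hψ_F ξ s)]
  exact (eq_inv_of_mul_eq_one_right h1).symm

theorem integrable_continuousMap (f : C(AdeleClass F, ℂ)) : Integrable f (adeleClassMeasure F) :=
  f.continuous.integrable_of_hasCompactSupport (HasCompactSupport.of_compactSpace _)

/-- Integration over `𝔸 / F` as a continuous linear functional. -/
def adeleClassIntegral : C(AdeleClass F, ℂ) →L[ℂ] ℂ :=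
  LinearMap.mkContinuous
    { toFun := fun f => ∫ t, f t ∂adeleClassMeasure F
      map_add' := fun f g => integral_add (integrable_continuousMap f) (integrable_continuousMap g)
      map_smul' := fun c f => integral_const_mul c _ } 1 (fun f => by
    rw [one_mul]
    refine (norm_integral_le_of_norm_le_const (ae_of_all _ fun t => f.norm_coe_le_norm t)).trans ?_
    simp)

theorem adeleClassIntegral_apply (f : C(AdeleClass F, ℂ)) :
    adeleClassIntegral f = ∫ t, f t ∂adeleClassMeasure F := rfl

include hψ_ne in
theorem adeleClassIntegral_classChar {ξ : F} (hξ : ξ ≠ 0) :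
    adeleClassIntegral (classChar hψ_cont hψ_F ξ) = 0 := by
  obtain ⟨b, hb⟩ : ∃ b, ψ b ≠ 1 := by
    by_contra! h
    exact hψ_ne (DFunLike.ext _ _ h)
  set t : AdeleClass F := ((algebraMap F (Adele F) ξ⁻¹ * b : Adele F) : AdeleClass F) with ht
  have h1 : classChar hψ_cont hψ_F ξ t ≠ 1 := by
    rw [ht, classChar_mk, ← mul_assoc, ← map_mul, mul_inv_cancel₀ hξ, map_one, one_mul]
    exact hb
  have h2 := integral_add_right_eq_self (μ := adeleClassMeasure F) (classChar hψ_cont hψ_F ξ) t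
  simp_rw [classChar_add_apply] at h2
  rw [integral_mul_const] at h2
  rw [adeleClassIntegral_apply]
  by_contra h3
  exact h1 (mul_left_cancel₀ h3 (by rw [h2, mul_one]))

include hψ_ne in
-- Stone–Weierstrass; the characters separate points exactly because F is its own annihilator under
-- ψ.
theorem span_classChar_closure_eq_top :
    (Submodule.span ℂ (Set.range (classChar hψ_cont hψ_F))).topologicalClosure = ⊤ := by
  let A : StarSubalgebra ℂ C(AdeleClass F, ℂ) :=
    { toSubalgebra := Algebra.adjoin ℂ (Set.range (classChar hψ_cont hψ_F))
      star_mem' := by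
        change Algebra.adjoin ℂ (Set.range (classChar hψ_cont hψ_F)) ≤
          star (Algebra.adjoin ℂ (Set.range (classChar hψ_cont hψ_F)))
        refine Algebra.adjoin_le ?_
        rintro - ⟨ξ, rfl⟩
        exact Algebra.subset_adjoin ⟨-ξ, (star_classChar hψ_cont hψ_F ξ).symm⟩ }
  have hsep : A.SeparatesPoints := by
    intro s t hst
    obtain ⟨a, rfl⟩ := QuotientAddGroup.mk_surjective s
    obtain ⟨b, rfl⟩ := QuotientAddGroup.mk_surjective t
    by_contra! h
    refine hst (QuotientAddGroup.eq.2 ?_)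
    refine mem_principalSubgroup_of_addChar_eq_one hψ_cont hψ_ne hψ_F fun ξ => ?_
    have h1 := h _ ⟨_, Algebra.subset_adjoin ⟨ξ, rfl⟩, rfl⟩
    change ψ (algebraMap F (Adele F) ξ * a) = ψ (algebraMap F (Adele F) ξ * b) at h1
    rw [neg_add_eq_sub, mul_sub, AddChar.map_sub_eq_div, h1, div_self]
    rw [← norm_ne_zero_iff, norm_addChar hψ_cont hψ_F]
    exact one_ne_zero
  have hspan : Subalgebra.toSubmodule A.toSubalgebra =
      Submodule.span ℂ (Set.range (classChar hψ_cont hψ_F)) := by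
    refine Algebra.adjoin_eq_span_of_subset _ ?_
    refine Set.Subset.trans ?_ Submodule.subset_span
    intro x hx
    refine Submonoid.closure_induction (fun _ => id) ⟨0, ?_⟩ ?_ hx
    · exact classChar_zero hψ_cont hψ_F
    · rintro _ _ _ _ ⟨m, rfl⟩ ⟨k, rfl⟩
      exact ⟨m + k, (classChar_mul hψ_cont hψ_F m k).symm⟩
  rw [← hspan]
  exact congr_arg (Subalgebra.toSubmodule <| StarSubalgebra.toSubalgebra ·)
    (ContinuousMap.starSubalgebra_topologicalClosure_eq_top_of_separatesPoints A hsep)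

include hψ_ne in
-- By density of the characters f is orthogonal to every continuous function, in particular to
-- itself.
theorem eq_zero_of_adeleClassIntegral_eq_zero (f : C(AdeleClass F, ℂ))
    (hf : ∀ ξ, adeleClassIntegral (f * classChar hψ_cont hψ_F ξ) = 0) : f = 0 := by
  let Λ : C(AdeleClass F, ℂ) →L[ℂ] ℂ := adeleClassIntegral.comp (ContinuousLinearMap.mul ℂ _ f)
  have h1 : Submodule.span ℂ (Set.range (classChar hψ_cont hψ_F)) ≤ LinearMap.ker Λ.toLinearMap := by
    rw [Submodule.span_le]
    rintro _ ⟨ξ, rfl⟩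
    exact hf ξ
  have h2 := Submodule.topologicalClosure_minimal _ h1 Λ.isClosed_ker
  rw [span_classChar_closure_eq_top hψ_cont hψ_ne hψ_F] at h2
  have h3 : ∫ t, f t * star (f t) ∂adeleClassMeasure F = 0 := h2 (Submodule.mem_top (x := star f))
  have h4 : ∫ t, ‖f t‖ ^ 2 ∂adeleClassMeasure F = 0 := by
    have : ∀ t, f t * star (f t) = ((‖f t‖ ^ 2 : ℝ) : ℂ) := fun t => by
      rw [RCLike.star_def, RCLike.mul_conj]; norm_cast
    simp_rw [this, integral_complex_ofReal] at h3
    exact_mod_cast h3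
  have hc : Continuous fun t => ‖f t‖ ^ 2 := by fun_prop
  rw [integral_eq_zero_iff_of_nonneg (fun t => by positivity)
    (hc.integrable_of_hasCompactSupport (HasCompactSupport.of_compactSpace _))] at h4
  have h5 := (hc.ae_eq_iff_eq (adeleClassMeasure F) continuous_zero).1 h4
  ext t
  have := congr_fun h5 t
  simpa using this

include hψ_ne in
-- The series converges uniformly to a continuous g with the same coefficients as f, hence g = f;
-- evaluate at 0, where all characters are 1.
theorem hasSum_classChar_coeff (f : C(AdeleClass F, ℂ))
    (hs : Summable fun ξ => adeleClassIntegral (f * classChar hψ_cont hψ_F (-ξ))) :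
    HasSum (fun ξ => adeleClassIntegral (f * classChar hψ_cont hψ_F (-ξ))) (f 0) := by
  set c : F → ℂ := fun ξ => adeleClassIntegral (f * classChar hψ_cont hψ_F (-ξ)) with hc
  have hs' : Summable fun ξ => c ξ • classChar hψ_cont hψ_F ξ := by
    refine Summable.of_norm_bounded hs.norm fun ξ => ?_
    rw [_root_.norm_smul]
    refine mul_le_of_le_one_right (norm_nonneg _) ?_
    refine (ContinuousMap.norm_le _ zero_le_one).2 fun t => ?_
    rw [norm_classChar_apply]
  obtain ⟨g, hg⟩ := hs'
  have hfg : f - g = 0 := by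
    refine eq_zero_of_adeleClassIntegral_eq_zero hψ_cont hψ_ne hψ_F _ fun η => ?_
    have h1 := hg.mapL (adeleClassIntegral.comp
      (ContinuousLinearMap.mul ℂ _ (classChar hψ_cont hψ_F η)))
    have h2 : ∀ ξ, (adeleClassIntegral.comp
      (ContinuousLinearMap.mul ℂ _ (classChar hψ_cont hψ_F η))) (c ξ • classChar hψ_cont hψ_F ξ) =
        if ξ = -η then c ξ else 0 := by
      intro ξ
      change adeleClassIntegral (classChar hψ_cont hψ_F η * (c ξ • classChar hψ_cont hψ_F ξ)) = _
      rw [mul_smul_comm, map_smul, classChar_mul]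
      split_ifs with h
      · rw [h, add_neg_cancel, classChar_zero, adeleClassIntegral_apply]
        simp
      · rw [adeleClassIntegral_classChar hψ_cont hψ_ne hψ_F, smul_zero]
        intro h'
        exact h (eq_neg_of_add_eq_zero_right h')
    simp_rw [h2] at h1
    have h3 := h1.unique (hasSum_ite_eq (-η) (c (-η)) |>.congr_fun (fun ξ => by
      split_ifs with h
      · rw [h]
      · rfl))
    change adeleClassIntegral (classChar hψ_cont hψ_F η * g) = _ at h3
    rw [sub_mul, map_sub, mul_comm g, h3, hc]
    simp only [neg_neg, sub_self]
  have h4 := hg.mapL (ContinuousMap.evalCLM ℂ (0 : AdeleClass F))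
  rw [sub_eq_zero] at hfg
  rw [hfg]
  change HasSum c ((ContinuousMap.evalCLM ℂ (0 : AdeleClass F)) g)
  convert h4 using 2 with ξ
  change c ξ = c ξ • classChar hψ_cont hψ_F ξ 0
  rw [classChar_zero_apply, smul_eq_mul, mul_one]

end FourierSeries

/-! ### Smooth functions on 𝔸/F have summable Fourier coefficients. -/

section Decay

open IsDedekindDomain HeightOneSpectrum NumberField mixedEmbedding
open scoped Classical

variable {F : Type*} [Field F] [NumberField F] {ψ : AddChar (Adele F) ℂ}
  (hψ_cont : Continuous ψ) (hψ_ne : ψ ≠ 1) (hψ_F : ∀ x : F, ψ (algebraMap F (Adele F) x) = 1)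

/-- The elements `ξ` of `F` such that `y ↦ ψ(ξ y)` is trivial on `N · Ô`. -/
def conductorSubgroup (ψ : AddChar (Adele F) ℂ) (N : ℕ) :
    AddSubgroup F where
  carrier := {ξ | ∀ y ∈ integralFiniteAdeles F, ψ (algebraMap F (Adele F) ξ *
    finiteAdele ((N : FiniteAdeleRing (𝓞 F) F) * y)) = 1}
  zero_mem' := fun y _ => by rw [map_zero, zero_mul, AddChar.map_zero_eq_one]
  add_mem' := fun {ξ η} hξ hη y hy => by
    rw [map_add, add_mul, AddChar.map_add_eq_mul, hξ y hy, hη y hy, one_mul]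
  neg_mem' := fun {ξ} hξ y hy => by
    rw [map_neg, neg_mul, AddChar.map_neg_eq_inv, hξ y hy, inv_one]

/-- The lattice in `ℝ ^ r₁ × ℂ ^ r₂` attached to `conductorSubgroup`. -/
def conductorLattice (ψ : AddChar (Adele F) ℂ) (N : ℕ) :
    Submodule ℤ (mixedSpace F) :=
  AddSubgroup.toIntSubmodule ((conductorSubgroup ψ N).map (mixedEmbedding F).toAddMonoidHom)

include hψ_cont hψ_ne hψ_F in
-- Decompose 𝔸 = F + C + N·Ô. If ξ is trivial on N·Ô and archimedeanly small, then ψ(ξ·) is close to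
-- 1 on every multiple of every adele, so it is trivial and ξ = 0.
theorem discreteTopology_conductorLattice {N : ℕ} (hN : N ≠ 0) :
    DiscreteTopology (conductorLattice ψ N) := by
  obtain ⟨C, hC, h⟩ := exists_isCompact_archAdele_nat (F := F) N hN
  have h1 : ∀ᶠ x : mixedSpace F in 𝓝 0, ∀ c ∈ C, ‖ψ (archAdele (x * c)) - 1‖ < 1 / 2 := by
    refine hC.eventually_forall_of_forall_eventually fun c _ => ?_
    have hc : ContinuousAt (fun z : mixedSpace F × mixedSpace F =>
        ‖ψ (archAdele (z.1 * z.2)) - 1‖) (0, c) :=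
      ((hψ_cont.comp (continuous_archAdele.comp (continuous_fst.mul continuous_snd))).sub
        continuous_const).norm.continuousAt
    refine hc.eventually_lt continuousAt_const ?_
    simp
  refine discreteTopology_of_isOpen_singleton_zero ?_
  rw [isOpen_singleton_iff_nhds_eq_pure, nhds_subtype_eq_comap]
  refine le_antisymm ?_ (by rw [← nhds_subtype_eq_comap]; exact pure_le_nhds 0)
  rw [Filter.le_pure_iff]
  refine ⟨_, h1, ?_⟩
  rintro ⟨_, ⟨ξ, hξ, rfl⟩⟩ hξC
  have hξC : ∀ c ∈ C, ‖ψ (archAdele (mixedEmbedding F ξ * c)) - 1‖ < 1 / 2 := hξC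
  have h2 : ∀ a, ψ (algebraMap F (Adele F) ξ * a) = 1 := by
    intro a
    refine addChar_eq_one_of_forall_nsmul fun m => ?_
    obtain ⟨η, x, hx, y, hy, hxy⟩ := h (m • a)
    rw [← mul_smul_comm, hxy, mul_add, mul_add, AddChar.map_add_eq_mul, hξ y hy, mul_one, ← map_mul,
      addChar_algebraMap_add hψ_F, ← archAdele_mixedEmbedding_mul]
    exact hξC x hx
  have h3 : algebraMap F (Adele F) ξ = 0 := eq_zero_of_addChar_mul_eq_one hψ_cont hψ_ne hψ_F h2
  have h4 : ξ = 0 := AdeleRing.algebraMap_injective (𝓞 F) F (by rw [h3, map_zero])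
  subst h4
  exact Subtype.ext (map_zero (mixedEmbedding F))

/-- A function on `F` supported on `conductorSubgroup` which decays faster than any power of the
archimedean absolute value is summable. -/
theorem summable_of_decay (hψ_cont : Continuous ψ) (hψ_ne : ψ ≠ 1)
    (hψ_F : ∀ x : F, ψ (algebraMap F (Adele F) x) = 1) {N : ℕ} (hN : N ≠ 0) {c : F → ℂ}
    (hsupp : ∀ ξ, c ξ ≠ 0 → ξ ∈ conductorSubgroup ψ N)
    (hdecay : ∀ k : ℕ, ∃ B : ℝ, ∀ ξ, ξ ≠ 0 → ‖c ξ‖ ≤ B * (‖mixedEmbedding F ξ‖⁻¹) ^ k) :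
    Summable c := by
  have hdisc := discreteTopology_conductorLattice hψ_cont hψ_ne hψ_F hN
  obtain ⟨B, hB⟩ := hdecay (Module.finrank ℤ (conductorLattice ψ N) + 1)
  -- Over a lattice of rank d the sum of ‖x‖^(-(d+1)) over non-zero x converges.
  have h1 := ZLattice.summable_norm_pow_inv (conductorLattice ψ N)
    (Module.finrank ℤ (conductorLattice ψ N) + 1) (Nat.lt_succ_self _)
  let ι : conductorSubgroup ψ N → conductorLattice ψ N := fun ξ =>
    ⟨mixedEmbedding F ξ, ⟨ξ, ξ.2, rfl⟩⟩
  have hι : Function.Injective ι := fun ξ η h =>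
    Subtype.ext (mixedEmbedding_injective F (congr_arg Subtype.val h))
  -- The bound at ξ = 0 reads zero because the inverse of 0 is 0, so the term `‖c 0‖` is added by
  -- hand.
  have h2 : Summable fun ξ : conductorSubgroup ψ N =>
      B * (‖mixedEmbedding F ξ‖⁻¹) ^ (Module.finrank ℤ (conductorLattice ψ N) + 1) +
        if ξ = 0 then ‖c 0‖ else 0 :=
    ((h1.comp_injective hι).mul_left B).add (hasSum_ite_eq 0 _).summable
  have h3 : Summable fun ξ : conductorSubgroup ψ N => c ξ := by
    refine Summable.of_norm_bounded h2 fun ξ => ?_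
    by_cases hξ : ξ = 0
    · subst hξ
      simp
    · rw [if_neg hξ, add_zero]
      exact hB ξ (by simpa using hξ)
  refine (Function.Injective.summable_iff Subtype.val_injective ?_).1 h3
  intro ξ hξ
  by_contra h
  exact hξ ⟨⟨ξ, hsupp ξ h⟩, rfl⟩

theorem adeleClassIntegral_translate (f g : C(AdeleClass F, ℂ)) (ξ : F) (a : Adele F)
    (hg : ∀ s, g s = f (s + a)) :
    adeleClassIntegral (g * classChar hψ_cont hψ_F (-ξ)) = ψ (algebraMap F (Adele F) ξ * a) *
      adeleClassIntegral (f * classChar hψ_cont hψ_F (-ξ)) := by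
  have h1 := integral_add_right_eq_self (μ := adeleClassMeasure F)
    (f * classChar hψ_cont hψ_F (-ξ)) (a : AdeleClass F)
  rw [adeleClassIntegral_apply, adeleClassIntegral_apply, ← h1, ← integral_const_mul]
  refine integral_congr_ae (ae_of_all _ fun s => ?_)
  have h2 : ψ (algebraMap F (Adele F) ξ * a) * ψ (algebraMap F (Adele F) (-ξ) * a) = 1 := by
    rw [← AddChar.map_add_eq_mul, ← add_mul, ← map_add, add_neg_cancel, map_zero, zero_mul,
      AddChar.map_zero_eq_one]
  change g s * classChar hψ_cont hψ_F (-ξ) s = _ * (f (s + a) * classChar hψ_cont hψ_F (-ξ) (s + a))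
  rw [classChar_add_apply, classChar_mk, hg]
  linear_combination (-(f (s + a) * classChar hψ_cont hψ_F (-ξ) s)) * h2

/-- The difference of a function on `𝔸 / F` and its translate. -/
def classDiff (f : C(AdeleClass F, ℂ)) (a : Adele F) : C(AdeleClass F, ℂ) where
  toFun s := f (s + a) - f s

/-- Translation multiplies the coefficient at ξ by ψ(ξa). A k-fold difference therefore gains (ψ(ξa)
− 1)^k, the substitute for k integrations by parts. -/
theorem adeleClassIntegral_classDiff (f : C(AdeleClass F, ℂ)) (ξ : F) (a : Adele F) (k : ℕ) :
    adeleClassIntegral (((fun g => classDiff g a)^[k] f) * classChar hψ_cont hψ_F (-ξ)) =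
      (ψ (algebraMap F (Adele F) ξ * a) - 1) ^ k *
        adeleClassIntegral (f * classChar hψ_cont hψ_F (-ξ)) := by
  induction k with
  | zero => simp
  | succ k ih =>
    rw [Function.iterate_succ_apply']
    set g := (fun g => classDiff g a)^[k] f
    have h1 : classDiff g a * classChar hψ_cont hψ_F (-ξ) =
        (classDiff g a + g) * classChar hψ_cont hψ_F (-ξ) - g * classChar hψ_cont hψ_F (-ξ) := by
      ring
    rw [h1, map_sub, adeleClassIntegral_translate hψ_cont hψ_F g (classDiff g a + g) ξ a
      (fun s => sub_add_cancel _ _), ih]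
    ring

/-- The Fourier expansion of a smooth function on `𝔸 / F`. -/
theorem hasSum_fourier_of_smooth (f : C(AdeleClass F, ℂ)) {N : ℕ} (hN : N ≠ 0)
    (hinv : ∀ s, ∀ y ∈ integralFiniteAdeles F,
      f (s + (finiteAdele ((N : FiniteAdeleRing (𝓞 F) F) * y) : Adele F)) = f s)
    (hdiff : ∀ k : ℕ, ∃ B : ℝ, ∀ (h : mixedSpace F) s,
      ‖((fun g => classDiff g (archAdele h))^[k] f) s‖ ≤ B * ‖h‖ ^ k) (hψ_ne : ψ ≠ 1) :
    HasSum (fun ξ => adeleClassIntegral (f * classChar hψ_cont hψ_F (-ξ))) (f 0) := by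
  refine hasSum_classChar_coeff hψ_cont hψ_ne hψ_F f ?_
  refine summable_of_decay hψ_cont hψ_ne hψ_F hN (fun ξ hξ y hy => ?_) (fun k => ?_)
  -- Invariance gives c(ξ) = ψ(ξNy) c(ξ), so a non-zero coefficient forces ξ into the conductor.
  · have h1 := adeleClassIntegral_translate hψ_cont hψ_F f f ξ
      (finiteAdele ((N : FiniteAdeleRing (𝓞 F) F) * y)) (fun s => (hinv s y hy).symm)
    exact mul_right_cancel₀ hξ (by rw [← h1, one_mul])
  · obtain ⟨C, hC0, hC⟩ := exists_norm_le_addChar_archAdele hψ_cont hψ_ne hψ_F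
    obtain ⟨B, hB⟩ := hdiff k
    refine ⟨2 ^ k * (|B| * C ^ k), fun ξ hξ => ?_⟩
    have hy : mixedEmbedding F ξ ≠ 0 := fun h0 =>
      hξ (mixedEmbedding_injective F (by rw [h0, map_zero]))
    -- Take the shift h of size O(‖ξ‖⁻¹) with |ψ(ξh) − 1| ≥ 1/2: the k-th difference along h is then
    -- O(‖ξ‖^(-k)) and at least 2^(-k)|c(ξ)|.
    obtain ⟨h, hh, hhψ⟩ := hC _ hy
    rw [archAdele_mixedEmbedding_mul] at hhψ
    have h1 := adeleClassIntegral_classDiff hψ_cont hψ_F f ξ (archAdele h) k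
    set c := adeleClassIntegral (f * classChar hψ_cont hψ_F (-ξ))
    have h2 : ‖adeleClassIntegral (((fun g => classDiff g (archAdele h))^[k] f) *
        classChar hψ_cont hψ_F (-ξ))‖ ≤ |B| * ‖h‖ ^ k := by
      rw [adeleClassIntegral_apply]
      refine (norm_integral_le_of_norm_le_const (C := |B| * ‖h‖ ^ k) (ae_of_all _ fun s => ?_)).trans ?_
      · rw [ContinuousMap.mul_apply, norm_mul, norm_classChar_apply, mul_one]
        exact (hB h s).trans (mul_le_mul_of_nonneg_right (le_abs_self B) (by positivity))
      · simp
    rw [h1, norm_mul, norm_pow] at h2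
    have h3 : (1 / 2 : ℝ) ^ k * ‖c‖ ≤ |B| * (C * ‖mixedEmbedding F ξ‖⁻¹) ^ k :=
      calc (1 / 2 : ℝ) ^ k * ‖c‖ ≤ ‖ψ (algebraMap F (Adele F) ξ * archAdele h) - 1‖ ^ k * ‖c‖ := by
            gcongr
        _ ≤ |B| * ‖h‖ ^ k := h2
        _ ≤ _ := by gcongr
    calc ‖c‖ = 2 ^ k * ((1 / 2 : ℝ) ^ k * ‖c‖) := by
          rw [← mul_assoc, ← mul_pow]; norm_num
      _ ≤ 2 ^ k * (|B| * (C * ‖mixedEmbedding F ξ‖⁻¹) ^ k) := by gcongr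
      _ = _ := by rw [mul_pow]; ring

end Decay

/-! ### One-parameter root subgroups of the symplectic group. -/

section RootSubgroups

variable {n : ℕ} {R : Type*} [CommRing R]

theorem Sp.ext_entry {g h : Sp n R} (H : ∀ i j, g.entry i j = h.entry i j) : g = h :=
  Subtype.ext (Units.ext (Matrix.ext H))

theorem Sp.entry_one (i j : Fin (2 * n)) :
    (1 : Sp n R).entry i j = (1 : Matrix (Fin (2 * n)) (Fin (2 * n)) R) i j := rfl

theorem Sp.entry_mul (g h : Sp n R) (i j : Fin (2 * n)) :
    (g * h).entry i j = ∑ k, g.entry i k * h.entry k j := rfl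

theorem Sp.entry_map {S : Type*} [CommRing S] (f : R →+* S) (g : Sp n R) (i j : Fin (2 * n)) :
    (Sp.map f g).entry i j = f (g.entry i j) := rfl

variable (n R) in
/-- The sign `1` for the first half of the indices, and `-1` for the second half. -/
def halfSign (i : Fin (2 * n)) : R := if (i : ℕ) < n then 1 else -1

theorem halfSign_mul_self (i : Fin (2 * n)) : halfSign n R i * halfSign n R i = 1 := by
  unfold halfSign; split_ifs <;> simp

theorem halfSign_rev (i : Fin (2 * n)) : halfSign n R i.rev = -halfSign n R i := by
  have h1 : (i.rev : ℕ) = 2 * n - (i + 1) := Fin.val_rev i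
  have h2 := i.2
  unfold halfSign
  split_ifs <;> first | omega | simp

theorem rev_ne_self (i : Fin (2 * n)) : i.rev ≠ i := by
  intro h
  have h1 : (i.rev : ℕ) = 2 * n - (i + 1) := Fin.val_rev i
  rw [h] at h1
  omega

theorem Sp.sum_entry_mul_entry (g : Sp n R) (a b : Fin (2 * n)) :
    ∑ c, g.entry c a * halfSign n R c * g.entry c.rev b = formJ n R a b := by
  have h : (g.1.val)ᵀ * formJ n R * g.1.val = formJ n R := g.2
  rw [← h, Matrix.mul_assoc, Matrix.mul_apply]
  refine Finset.sum_congr rfl fun c _ => ?_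
  rw [Matrix.mul_apply, Finset.sum_eq_single c.rev]
  · simp only [Matrix.transpose_apply, formJ, Matrix.of_apply, if_true]
    exact mul_assoc _ _ _
  · intro d _ hd
    simp [formJ, hd]
  · simp

/-- The nilpotent matrix spanning the root space of `(i, j)`. -/
def rootMatrix (R : Type*) [CommRing R] (i j : Fin (2 * n)) : Matrix (Fin (2 * n)) (Fin (2 * n)) R :=
  Matrix.of fun a b => if a = i ∧ b = j then 1 else
    if a = j.rev ∧ b = i.rev then -(halfSign n R i * halfSign n R j) else 0

/-- The non-zero rows i, j.rev are disjoint from the non-zero columns j, i.rev. Hence 1 + tX is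
already the exponential of tX. -/
theorem rootMatrix_mul_self {i j : Fin (2 * n)} (hij : i ≠ j) :
    rootMatrix R i j * rootMatrix R i j = 0 := by
  ext a b
  rw [Matrix.mul_apply, Matrix.zero_apply]
  refine Finset.sum_eq_zero fun c _ => ?_
  have hi := rev_ne_self i
  have hj := rev_ne_self j
  have hrev : i.rev ≠ j.rev := fun h => hij (Fin.rev_injective h)
  simp only [rootMatrix, Matrix.of_apply]
  by_cases h1 : c = j
  · subst h1
    simp [Ne.symm hij, Ne.symm hj]
  · by_cases h2 : c = i.rev
    · subst h2
      simp [hi, hrev]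
    · simp [h1, h2]

/-- This is membership in the Lie algebra of the symplectic group; together with X² = 0 it makes 1 +
tX symplectic. -/
theorem transpose_rootMatrix_mul {i j : Fin (2 * n)} :
    (rootMatrix R i j)ᵀ * formJ n R = -(formJ n R * rootMatrix R i j) := by
  ext a b
  have h1 : ((rootMatrix R i j)ᵀ * formJ n R) a b =
      rootMatrix R i j b.rev a * halfSign n R b.rev := by
    rw [Matrix.mul_apply, Finset.sum_eq_single b.rev]
    · simp [formJ, halfSign]
    · intro c _ hc
      have : b ≠ c.rev := fun h => hc (by rw [h, Fin.rev_rev])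
      simp [formJ, this]
    · simp
  have h2 : (formJ n R * rootMatrix R i j) a b = halfSign n R a * rootMatrix R i j a.rev b := by
    rw [Matrix.mul_apply, Finset.sum_eq_single a.rev]
    · simp [formJ, halfSign]
    · intro c _ hc
      simp [formJ, hc]
    · simp
  rw [Matrix.neg_apply, h1, h2, halfSign_rev]
  simp only [rootMatrix, Matrix.of_apply, Fin.rev_eq_iff]
  by_cases hP : a = j ∧ b = i.rev
  · obtain ⟨rfl, rfl⟩ := hP
    by_cases hQ : a = i.rev
    · subst hQ
      simp
    · have h3 : i ≠ a.rev := fun h => hQ (by rw [h, Fin.rev_rev])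
      simp only [hQ, Fin.rev_rev, and_self, if_true, false_and, if_false, halfSign_rev]
      linear_combination (-halfSign n R i) * halfSign_mul_self (R := R) a
  · by_cases hQ : a = i.rev ∧ b = j
    · obtain ⟨rfl, rfl⟩ := hQ
      have h3 : ¬ (b = i.rev ∧ i.rev = b) := fun h => hP ⟨h.2, h.1⟩
      simp only [h3, Fin.rev_rev, and_self, if_true, if_false, halfSign_rev]
      linear_combination (halfSign n R i) * halfSign_mul_self (R := R) b
    · have h3 : ¬ (b = i.rev ∧ a = j) := fun h => hP ⟨h.2, h.1⟩
      have h4 : ¬ (b = j ∧ a = i.rev) := fun h => hQ ⟨h.2, h.1⟩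
      have h5 : ¬ (a = j.rev.rev ∧ b = i.rev) := by rwa [Fin.rev_rev]
      have h6 : ¬ (b = j.rev.rev ∧ a = i.rev) := by rwa [Fin.rev_rev]
      simp only [h3, hQ, h5, h6, if_false]
      simp

theorem one_add_rootMatrix_mul {i j : Fin (2 * n)} (hij : i ≠ j) (s t : R) :
    (1 + s • rootMatrix R i j) * (1 + t • rootMatrix R i j) = 1 + (s + t) • rootMatrix R i j := by
  simp only [mul_add, add_mul, Matrix.smul_mul, Matrix.mul_smul, rootMatrix_mul_self hij,
    one_mul, mul_one, smul_zero, add_zero, add_smul, add_assoc]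

/-- The root subgroup `t ↦ 1 + t X` attached to `(i, j)`. -/
def rootHom {i j : Fin (2 * n)} (hij : i ≠ j) (t : R) : Sp n R :=
  ⟨⟨1 + t • rootMatrix R i j, 1 + (-t) • rootMatrix R i j, by
      rw [one_add_rootMatrix_mul hij]; simp, by rw [one_add_rootMatrix_mul hij]; simp⟩, by
    change (1 + t • rootMatrix R i j)ᵀ * formJ n R * (1 + t • rootMatrix R i j) = formJ n R
    rw [Matrix.transpose_add, Matrix.transpose_one, Matrix.transpose_smul, add_mul, one_mul,
      Matrix.smul_mul, transpose_rootMatrix_mul]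
    have h1 : formJ n R + t • -(formJ n R * rootMatrix R i j) =
        formJ n R * (1 + (-t) • rootMatrix R i j) := by
      rw [mul_add, mul_one, Matrix.mul_smul, smul_neg, neg_smul]
    rw [h1, mul_assoc, one_add_rootMatrix_mul hij]
    simp⟩

theorem entry_rootHom {i j : Fin (2 * n)} (hij : i ≠ j) (t : R) (a b : Fin (2 * n)) :
    (rootHom hij t).entry a b = (1 : Matrix (Fin (2 * n)) (Fin (2 * n)) R) a b +
      t * rootMatrix R i j a b := rfl

theorem rootHom_add {i j : Fin (2 * n)} (hij : i ≠ j) (s t : R) :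
    rootHom hij (s + t) = rootHom hij s * rootHom hij t :=
  Subtype.ext (Units.ext (one_add_rootMatrix_mul hij s t).symm)

theorem map_rootHom {S : Type*} [CommRing S] (f : R →+* S) {i j : Fin (2 * n)} (hij : i ≠ j)
    (t : R) : Sp.map f (rootHom hij t) = rootHom hij (f t) := by
  refine Sp.ext_entry fun a b => ?_
  rw [Sp.entry_map, entry_rootHom, entry_rootHom, map_add, map_mul]
  congr 1
  · rw [Matrix.one_apply, Matrix.one_apply]; split_ifs <;> simp
  · simp only [rootMatrix, halfSign, Matrix.of_apply]
    congr 1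
    split_ifs <;> simp

theorem continuous_rootHom [TopologicalSpace R] [IsTopologicalRing R] {i j : Fin (2 * n)}
    (hij : i ≠ j) : Continuous (rootHom hij : R → Sp n R) := by
  refine Continuous.subtype_mk (Units.continuous_iff.2 ⟨?_, ?_⟩) _
  · change Continuous fun t : R => 1 + t • rootMatrix R i j
    fun_prop
  · change Continuous fun t : R => 1 + (-t) • rootMatrix R i j
    fun_prop

end RootSubgroups

/-! ### Filtrations of N with central root subgroup quotients. -/

section Filtration

variable {n : ℕ} {R : Type*} [CommRing R]

theorem entry_self_of_mem {g : Sp n R} (hg : g ∈ subgroupN n R) (i : Fin (2 * n)) :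
    g.entry i i = 1 := by rw [hg i i le_rfl, Matrix.one_apply_eq]

theorem entry_eq_zero_of_lt {g : Sp n R} (hg : g ∈ subgroupN n R) {i j : Fin (2 * n)} (h : j < i) :
    g.entry i j = 0 := by
  rw [hg i j (Fin.le_def.1 h.le), Matrix.one_apply_ne h.ne']

theorem entry_mul_of_forall {g h : Sp n R} (hg : g ∈ subgroupN n R) (hh : h ∈ subgroupN n R)
    {i j : Fin (2 * n)} (hij : i < j)
    (H : ∀ k, i < k → k < j → g.entry i k * h.entry k j = 0) :
    (g * h).entry i j = g.entry i j + h.entry i j := by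
  rw [Sp.entry_mul, ← Finset.sum_subset (Finset.subset_univ {i, j}), Finset.sum_pair hij.ne,
    entry_self_of_mem hg, entry_self_of_mem hh, one_mul, mul_one, add_comm]
  intro k _ hk
  simp only [Finset.mem_insert, Finset.mem_singleton, not_or] at hk
  rcases lt_or_gt_of_ne hk.1 with hki | hki
  · rw [entry_eq_zero_of_lt hg hki, zero_mul]
  · rcases lt_or_gt_of_ne hk.2 with hkj | hkj
    · exact H k hki hkj
    · rw [entry_eq_zero_of_lt hh hkj, mul_zero]

/-- Numberings of the positive roots, given as positions above the diagonal, along which the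
unipotent group `N` has a central filtration by root subgroups. -/
structure IsRootOrder (n : ℕ) (ρ : Fin (2 * n) → Fin (2 * n) → ℕ) : Prop where
  lt_left : ∀ {i j k}, i < j → j < k → ρ i j < ρ i k
  lt_right : ∀ {i j k}, i < j → j < k → ρ j k < ρ i k
  symm : ∀ i j, ρ j.rev i.rev = ρ i j
  inj : ∀ {i j a b}, i < j → a < b → ρ a b = ρ i j → (a = i ∧ b = j) ∨ (a = j.rev ∧ b = i.rev)

variable {ρ : Fin (2 * n) → Fin (2 * n) → ℕ}

/-- Induction on the root number, comparing entries in g = (gh⁻¹)h: in the product formula all mixed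
terms involve an entry of gh⁻¹ with smaller number. -/
theorem entry_mul_inv_eq_zero (hρ : IsRootOrder n ρ) {g h : Sp n R} (hg : g ∈ subgroupN n R)
    (hh : h ∈ subgroupN n R) {r : ℕ} (H : ∀ a b, a < b → ρ a b < r → g.entry a b = h.entry a b) :
    ∀ a b, a < b → ρ a b < r → (g * h⁻¹).entry a b = 0 := by
  suffices ∀ m a b, ρ a b = m → a < b → ρ a b < r → (g * h⁻¹).entry a b = 0 from
    fun a b => this _ a b rfl
  intro m
  induction m using Nat.strong_induction_on with
  | _ m ih =>
    intro a b hm hab hr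
    have h1 := entry_mul_of_forall (mul_mem hg (inv_mem hh)) hh hab (fun c hac hcb => by
      have hlt := hρ.lt_left hac hcb
      rw [ih _ (hm ▸ hlt) a c rfl hac (hlt.trans hr), zero_mul])
    rw [inv_mul_cancel_right, H a b hab hr] at h1
    exact left_eq_add.1 (by rw [add_comm]; exact h1)

variable (R) in
/-- The filtration of `N` attached to a numbering of the positive roots. -/
def rootFiltration (hρ : IsRootOrder n ρ) (r : ℕ) : Subgroup (Sp n R) where
  carrier := {g | g ∈ subgroupN n R ∧ ∀ a b, a < b → ρ a b < r → g.entry a b = 0}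
  one_mem' := ⟨one_mem _, fun a b hab _ => Matrix.one_apply_ne hab.ne⟩
  mul_mem' := by
    intro g h hg hh
    refine ⟨mul_mem hg.1 hh.1, fun a b hab hr => ?_⟩
    rw [entry_mul_of_forall hg.1 hh.1 hab, hg.2 a b hab hr, hh.2 a b hab hr, add_zero]
    intro c hac hcb
    rw [hg.2 a c hac ((hρ.lt_left hac hcb).trans hr), zero_mul]
  inv_mem' := by
    intro g hg
    refine ⟨inv_mem hg.1, fun a b hab hr => ?_⟩
    have h1 := entry_mul_inv_eq_zero hρ (one_mem _) hg.1 (r := r) (fun a b hab hr => by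
      rw [hg.2 a b hab hr]; exact Matrix.one_apply_ne hab.ne) a b hab hr
    rwa [one_mul] at h1

variable (hρ : IsRootOrder n ρ)

theorem rootFiltration_le (r : ℕ) : rootFiltration R hρ r ≤ subgroupN n R := fun _ hg => hg.1

theorem rootFiltration_anti {r s : ℕ} (hrs : r ≤ s) :
    rootFiltration R hρ s ≤ rootFiltration R hρ r :=
  fun _ hg => ⟨hg.1, fun a b hab h => hg.2 a b hab (h.trans_le hrs)⟩

theorem mul_inv_mem_rootFiltration {g h : Sp n R} (hg : g ∈ subgroupN n R)
    (hh : h ∈ subgroupN n R) {r : ℕ} (H : ∀ a b, a < b → ρ a b < r → g.entry a b = h.entry a b) :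
    g * h⁻¹ ∈ rootFiltration R hρ r :=
  ⟨mul_mem hg (inv_mem hh), entry_mul_inv_eq_zero hρ hg hh H⟩

/-- Splitting a root as a sum strictly lowers the number of both summands. Hence at numbers up to r
included, the mixed terms vanish and both gu and ug have the sum of the entries. -/
theorem comm_mem_rootFiltration {g u : Sp n R} {r : ℕ} (hg : g ∈ subgroupN n R)
    (hu : u ∈ rootFiltration R hρ r) : (g * u) * (u * g)⁻¹ ∈ rootFiltration R hρ (r + 1) := by
  refine mul_inv_mem_rootFiltration hρ (mul_mem hg hu.1) (mul_mem hu.1 hg) fun a b hab hr => ?_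
  rw [entry_mul_of_forall hg hu.1 hab, entry_mul_of_forall hu.1 hg hab, add_comm]
  · intro c hac hcb
    rw [hu.2 a c hac ((hρ.lt_left hac hcb).trans_le (Nat.lt_succ_iff.1 hr)), zero_mul]
  · intro c hac hcb
    rw [hu.2 c b hcb ((hρ.lt_right hac hcb).trans_le (Nat.lt_succ_iff.1 hr)), mul_zero]

theorem conj_mem_rootFiltration {g u : Sp n R} {r : ℕ} (hg : g ∈ subgroupN n R)
    (hu : u ∈ rootFiltration R hρ r) : g * u * g⁻¹ ∈ rootFiltration R hρ r := by
  have h1 := rootFiltration_anti hρ (Nat.le_succ r) (comm_mem_rootFiltration hρ hg hu)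
  have h2 : g * u * g⁻¹ = ((g * u) * (u * g)⁻¹) * u := by group
  rw [h2]
  exact mul_mem h1 hu

include hρ in
-- In the symplectic relation between columns i.rev and j only the two terms with a diagonal factor
-- survive; every other term contains a zero entry of u, either below the diagonal or of smaller
-- number.
theorem entry_rev_rev {u : Sp n R} {i j : Fin (2 * n)} (hij : i < j)
    (hu : u ∈ rootFiltration R hρ (ρ i j)) :
    u.entry j.rev i.rev = -(halfSign n R i * halfSign n R j) * u.entry i j := by
  have h1 := Sp.sum_entry_mul_entry u i.rev j
  have h0 : formJ n R i.rev j = 0 := by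
    simp [formJ, Fin.rev_rev, hij.ne']
  have hne : i.rev ≠ j.rev := fun h => hij.ne (Fin.rev_injective h)
  rw [h0, ← Finset.sum_subset (Finset.subset_univ {i.rev, j.rev}), Finset.sum_pair hne,
    Fin.rev_rev, Fin.rev_rev, entry_self_of_mem hu.1, entry_self_of_mem hu.1, halfSign_rev,
    halfSign_rev] at h1
  · linear_combination (-(halfSign n R j)) * h1 -
      (u.entry j.rev i.rev) * halfSign_mul_self (R := R) j
  · intro c _ hc
    simp only [Finset.mem_insert, Finset.mem_singleton, not_or] at hc
    rcases lt_or_gt_of_ne hc.1 with hci | hci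
    · rcases lt_or_gt_of_ne hc.2 with hcj | hcj
      · have : j < c.rev := by rw [← Fin.rev_rev j]; exact Fin.rev_lt_rev.2 hcj
        rw [entry_eq_zero_of_lt hu.1 this, mul_zero]
      · have h2 : c.rev < j := by rw [← Fin.rev_rev j]; exact Fin.rev_lt_rev.2 hcj
        have h3 : i < c.rev := by rw [← Fin.rev_rev i]; exact Fin.rev_lt_rev.2 hci
        rw [hu.2 c i.rev hci, zero_mul, zero_mul]
        have h4 := hρ.symm i c.rev
        rw [Fin.rev_rev] at h4
        rw [h4]
        exact hρ.lt_left h3 h2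
    · rw [entry_eq_zero_of_lt hu.1 hci, zero_mul, zero_mul]

theorem rootMatrix_eq_zero {i j a b : Fin (2 * n)} (h1 : ¬ (a = i ∧ b = j))
    (h2 : ¬ (a = j.rev ∧ b = i.rev)) : rootMatrix R i j a b = 0 := by
  simp only [rootMatrix, Matrix.of_apply, if_neg h1, if_neg h2]

theorem rootHom_mem {i j : Fin (2 * n)} (hij : i < j) (t : R) :
    rootHom hij.ne t ∈ rootFiltration R hρ (ρ i j) := by
  have hrev : j.rev < i.rev := Fin.rev_lt_rev.2 hij
  refine ⟨fun a b hba => ?_, fun a b hab hr => ?_⟩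
  · have hba : b ≤ a := hba
    rw [entry_rootHom, rootMatrix_eq_zero, mul_zero, add_zero]
    · rintro ⟨rfl, rfl⟩; exact absurd hij hba.not_gt
    · rintro ⟨rfl, rfl⟩; exact absurd hrev hba.not_gt
  · rw [entry_rootHom, rootMatrix_eq_zero, mul_zero, add_zero, Matrix.one_apply_ne hab.ne]
    · rintro ⟨rfl, rfl⟩; exact lt_irrefl _ hr
    · rintro ⟨rfl, rfl⟩; rw [hρ.symm] at hr; exact lt_irrefl _ hr

/-- Every element of a step of the filtration is, modulo the next step, in the root subgroup. -/
theorem mul_rootHom_inv_mem {i j : Fin (2 * n)} (hij : i < j) {u : Sp n R}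
    (hu : u ∈ rootFiltration R hρ (ρ i j)) :
    u * (rootHom hij.ne (u.entry i j))⁻¹ ∈ rootFiltration R hρ (ρ i j + 1) := by
  have hx := rootHom_mem hρ hij (u.entry i j)
  refine mul_inv_mem_rootFiltration hρ hu.1 hx.1 fun a b hab hr => ?_
  rcases (Nat.lt_succ_iff.1 hr).lt_or_eq with hlt | heq
  · rw [hu.2 a b hab hlt, hx.2 a b hab hlt]
  · rcases hρ.inj hij hab heq with ⟨rfl, rfl⟩ | ⟨rfl, rfl⟩
    · rw [entry_rootHom, Matrix.one_apply_ne hab.ne, zero_add]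
      simp [rootMatrix]
    · rw [entry_rev_rev hρ hij hu, entry_rootHom, Matrix.one_apply_ne hab.ne, zero_add]
      -- The long roots, where the position coincides with its reflection and the root matrix has a
      -- single entry.
      by_cases h : j.rev = i ∧ i.rev = j
      · have h2 := halfSign_rev (R := R) i
        rw [h.2] at h2
        simp only [rootMatrix, Matrix.of_apply, h, and_self, if_true, mul_one]
        rw [h2]
        linear_combination u.entry i j * halfSign_mul_self (R := R) i
      · simp only [rootMatrix, Matrix.of_apply, h, and_self, if_true, if_false]
        ring

theorem rootFiltration_succ_of_forall_ne {r : ℕ} (h : ∀ i j, i < j → ρ i j ≠ r) :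
    rootFiltration R hρ (r + 1) = rootFiltration R hρ r := by
  refine le_antisymm (rootFiltration_anti hρ (Nat.le_succ r)) fun g hg => ⟨hg.1, fun a b hab hr => ?_⟩
  exact hg.2 a b hab (lt_of_le_of_ne (Nat.lt_succ_iff.1 hr) (h a b hab))

theorem rootFiltration_eq_bot {r : ℕ} (h : ∀ i j, i < j → ρ i j < r) :
    rootFiltration R hρ r = ⊥ := by
  refine (Subgroup.eq_bot_iff_forall _).2 fun g hg => Sp.ext_entry fun a b => ?_
  rw [Sp.entry_one]
  rcases lt_trichotomy a b with hab | rfl | hab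
  · rw [hg.2 a b hab (h a b hab), Matrix.one_apply_ne hab.ne]
  · rw [entry_self_of_mem hg.1, Matrix.one_apply_eq]
  · rw [entry_eq_zero_of_lt hg.1 hab, Matrix.one_apply_ne hab.ne']

theorem rootFiltration_zero : rootFiltration R hρ 0 = subgroupN n R :=
  le_antisymm (rootFiltration_le hρ 0) fun _ hg => ⟨hg, fun _ _ _ h => absurd h (Nat.not_lt_zero _)⟩

end Filtration

/-! ### Two numberings of the positive roots, adapted to U and to the radical. -/

section RootOrders

variable (n : ℕ) (R : Type*) [CommRing R]

/-- The numbering of the positive roots by their height. -/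
def heightOrder (i j : Fin (2 * n)) : ℕ := ((j : ℕ) - i) * (2 * n) + min (i : ℕ) (2 * n - 1 - j)

variable {n}

theorem heightOrder_lt {i j : Fin (2 * n)} (hij : i < j) :
    heightOrder n i j < ((j : ℕ) - i + 1) * (2 * n) := by
  have hi := i.isLt
  have := Nat.min_le_left (i : ℕ) (2 * n - 1 - j)
  rw [heightOrder, add_mul, one_mul]
  omega

theorem heightOrder_lt_of_lt {i j a b : Fin (2 * n)} (hij : i < j)
    (h : (j : ℕ) - i < (b : ℕ) - a) : heightOrder n i j < heightOrder n a b := by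
  refine (heightOrder_lt hij).trans_le ?_
  rw [heightOrder]
  exact (Nat.mul_le_mul_right _ h).trans (Nat.le_add_right _ _)

theorem heightOrder_lt_sq {i j : Fin (2 * n)} (hij : i < j) :
    heightOrder n i j < 4 * n ^ 2 := by
  refine (heightOrder_lt hij).trans_le ?_
  have h : (j : ℕ) - i + 1 ≤ 2 * n := by
    have := j.isLt
    have : (i : ℕ) < j := hij
    omega
  calc _ ≤ (2 * n) * (2 * n) := Nat.mul_le_mul_right _ h
    _ = _ := by ring

theorem heightOrder_symm (i j : Fin (2 * n)) : heightOrder n j.rev i.rev = heightOrder n i j := by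
  have h1 := i.isLt
  have h2 := j.isLt
  have h3 : ((i.rev : ℕ) - j.rev) = (j : ℕ) - i := by rw [Fin.val_rev, Fin.val_rev]; omega
  have h4 : min (j.rev : ℕ) (2 * n - 1 - i.rev) = min (i : ℕ) (2 * n - 1 - j) := by
    rw [Fin.val_rev, Fin.val_rev]; omega
  rw [heightOrder, h3, h4, heightOrder]

/-- The summand `min` is less than 2n, so the number determines the height j − i; among positions of
equal height the minimum determines the position up to reflection. -/
theorem heightOrder_inj {i j a b : Fin (2 * n)} (hij : i < j) (hab : a < b)
    (h : heightOrder n a b = heightOrder n i j) :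
    (a = i ∧ b = j) ∨ (a = j.rev ∧ b = i.rev) := by
  have h1 : (b : ℕ) - a = (j : ℕ) - i := by
    rcases lt_trichotomy ((b : ℕ) - a) ((j : ℕ) - i) with hlt | heq | hgt
    · exact absurd h (heightOrder_lt_of_lt hab hlt).ne
    · exact heq
    · exact absurd h (heightOrder_lt_of_lt hij hgt).ne'
  rw [heightOrder, heightOrder, h1, Nat.add_left_cancel_iff] at h
  have hij' : (i : ℕ) < j := hij
  have hab' : (a : ℕ) < b := hab
  have := j.isLt
  have := b.isLt
  simp only [Fin.ext_iff, Fin.val_rev]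
  omega

variable (n) in
theorem isRootOrder_heightOrder : IsRootOrder n (heightOrder n) where
  lt_left := fun {i j k} hij hjk => heightOrder_lt_of_lt hij (by
    have : (i : ℕ) < j := hij
    have : (j : ℕ) < k := hjk
    omega)
  lt_right := fun {i j k} hij hjk => heightOrder_lt_of_lt hjk (by
    have : (i : ℕ) < j := hij
    have : (j : ℕ) < k := hjk
    omega)
  symm := heightOrder_symm
  inj := heightOrder_inj

/-- The first simple root has number 2n and every other positive root a larger one, so the cutoff 2n
+ 1 removes exactly this root. -/
theorem subgroupU_eq_rootFiltration :
    subgroupU n R = rootFiltration R (isRootOrder_heightOrder n) (2 * n + 1) := by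
  ext g
  refine and_congr_right fun hg => ⟨fun h a b hab hr => ?_, fun h a b hab hb => ?_⟩
  · have hab' : (a : ℕ) < b := hab
    have h1 : (b : ℕ) - a = 1 := by
      by_contra hne
      have h2 : 2 ≤ (b : ℕ) - a := by omega
      have h3 := Nat.mul_le_mul_right (2 * n) h2
      have := a.isLt
      rw [heightOrder] at hr
      omega
    rw [heightOrder, h1] at hr
    exact h a b (by omega) (by omega)
  · have hab' : (a : ℕ) < b := by omega
    refine h a b hab' ?_
    have h1 : (b : ℕ) - a = 1 := by omega
    rw [heightOrder, h1]
    omega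

variable (n) in
/-- A numbering of the positive roots for which those in the unipotent radical of the first maximal
parabolic subgroup come last. -/
def radicalOrder (i j : Fin (2 * n)) : ℕ :=
  heightOrder n i j + if (i : ℕ) = 0 ∨ (j : ℕ) + 1 = 2 * n then 4 * n ^ 2 else 0

theorem radicalOrder_lt_iff {i j : Fin (2 * n)} (hij : i < j) :
    radicalOrder n i j < 4 * n ^ 2 ↔ ¬ ((i : ℕ) = 0 ∨ (j : ℕ) + 1 = 2 * n) := by
  have := heightOrder_lt_sq hij
  unfold radicalOrder
  split_ifs with h
  · simp [h]
  · simpa [h] using this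

variable (n) in
theorem isRootOrder_radicalOrder : IsRootOrder n (radicalOrder n) where
  lt_left := fun {i j k} hij hjk => by
    have h1 := (isRootOrder_heightOrder n).lt_left hij hjk
    have : (i : ℕ) < j := hij
    have : (j : ℕ) < k := hjk
    have := k.isLt
    unfold radicalOrder
    split_ifs <;> omega
  lt_right := fun {i j k} hij hjk => by
    have h1 := (isRootOrder_heightOrder n).lt_right hij hjk
    have : (i : ℕ) < j := hij
    have : (j : ℕ) < k := hjk
    have := k.isLt
    unfold radicalOrder
    split_ifs <;> omega
  symm := fun i j => by
    have hi := i.isLt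
    have hj := j.isLt
    have : ((j.rev : ℕ) = 0 ∨ (i.rev : ℕ) + 1 = 2 * n) ↔ ((i : ℕ) = 0 ∨ (j : ℕ) + 1 = 2 * n) := by
      rw [Fin.val_rev, Fin.val_rev]; omega
    simp only [radicalOrder, heightOrder_symm, this]
  inj := fun {i j a b} hij hab h => by
    have h1 := heightOrder_lt_sq hij
    have h2 := heightOrder_lt_sq hab
    refine heightOrder_inj hij hab ?_
    unfold radicalOrder at h
    split_ifs at h <;> omega

/-- All heights are numbered below 4n², so the shift by 4n² places the roots in the first row or
last column exactly above this cutoff. -/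
theorem parabolicRadical_one_eq_rootFiltration :
    parabolicRadical n R 1 = rootFiltration R (isRootOrder_radicalOrder n) (4 * n ^ 2) := by
  ext g
  constructor
  · refine fun hg => ⟨fun a b hab => hg a b ?_, fun a b hab hr => ?_⟩
    · have hab : (b : ℕ) ≤ a := hab
      have := a.isLt
      dsimp only
      split_ifs <;> omega
    · rw [radicalOrder_lt_iff hab, not_or] at hr
      have := hg a b (by
        have := b.isLt
        dsimp only
        split_ifs <;> omega)
      rwa [Matrix.one_apply_ne hab.ne] at this
  · refine fun hg a b hab => ?_
    rcases le_or_gt b a with hba | hba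
    · exact hg.1 a b hba
    · rw [Matrix.one_apply_ne hba.ne]
      refine hg.2 a b hba ((radicalOrder_lt_iff hba).2 ?_)
      have h1 : (a : ℕ) < b := hba
      have := a.isLt
      have := b.isLt
      dsimp only at hab
      split_ifs at hab <;> omega

end RootOrders

/-! ### N, U and the radical as towers of central one-parameter extensions. -/

section Towers

variable {n : ℕ} {F : Type*} [Field F] [NumberField F]

/-- Subgroups of `Sp_{2n}(𝔸)` which are obtained from the trivial group by successive extensions by
one-parameter subgroups defined over `F`, centralised by the given group modulo the preceding step. -/
inductive CentralTower (S : Subgroup (Sp n (Adele F))) : Subgroup (Sp n (Adele F)) → Prop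
  | bot : CentralTower S ⊥
  | step {H H' : Subgroup (Sp n (Adele F))} (x : Adele F → Sp n (Adele F)) (hxc : Continuous x)
      (hadd : ∀ a b, x (a + b) = x a * x b)
      (hrat : ∀ ξ : F, x (algebraMap F (Adele F) ξ) ∈ rationalPoints n F)
      (hle : H ≤ H') (hx : ∀ a, x a ∈ H') (hH' : ∀ u ∈ H', ∃ c ∈ H, ∃ a, u = c * x a)
      (hcomm : ∀ s ∈ S, ∀ a, (s * x a) * (x a * s)⁻¹ ∈ H)
      (hconj : ∀ s ∈ S, ∀ c ∈ H, s * c * s⁻¹ ∈ H) (hH : CentralTower S H) : CentralTower S H'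

theorem CentralTower.mono {S S' H : Subgroup (Sp n (Adele F))} (hS : S' ≤ S)
    (h : CentralTower S H) : CentralTower S' H := by
  induction h with
  | bot => exact .bot
  | step x hxc hadd hrat hle hx hH' hcomm hconj _ ih =>
    exact .step x hxc hadd hrat hle hx hH' (fun s hs => hcomm s (hS hs))
      (fun s hs => hconj s (hS hs)) ih

theorem rootHom_algebraMap_mem {i j : Fin (2 * n)} (hij : i ≠ j) (ξ : F) :
    rootHom hij (algebraMap F (Adele F) ξ) ∈ rationalPoints n F :=
  ⟨rootHom hij ξ, map_rootHom _ hij ξ⟩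

/-- Descending induction from a cutoff beyond all the root numbers: each r either adds one root
subgroup or leaves the group unchanged. -/
theorem centralTower_rootFiltration {ρ : Fin (2 * n) → Fin (2 * n) → ℕ} (hρ : IsRootOrder n ρ)
    (r : ℕ) : CentralTower (subgroupN n (Adele F)) (rootFiltration (Adele F) hρ r) := by
  obtain ⟨M, hM⟩ : ∃ M, ∀ i j, ρ i j < M := by
    refine ⟨(∑ i, ∑ j, ρ i j) + 1, fun i j => Nat.lt_succ_of_le ?_⟩
    exact (Finset.single_le_sum (f := fun j => ρ i j) (fun _ _ => Nat.zero_le _)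
      (Finset.mem_univ j)).trans (Finset.single_le_sum (f := fun i => ∑ j, ρ i j)
        (fun _ _ => Nat.zero_le _) (Finset.mem_univ i))
  rcases le_or_gt M r with hr | hr
  · rw [rootFiltration_eq_bot hρ fun i j _ => (hM i j).trans_le hr]
    exact .bot
  · refine Nat.decreasingInduction (n := M) (motive := fun r _ => CentralTower
      (subgroupN n (Adele F)) (rootFiltration (Adele F) hρ r)) (fun r _ ih => ?_) ?_ hr.le
    · by_cases h : ∃ i j, i < j ∧ ρ i j = r
      · obtain ⟨i, j, hij, rfl⟩ := h
        refine .step (rootHom hij.ne) (continuous_rootHom hij.ne) (rootHom_add hij.ne)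
          (rootHom_algebraMap_mem hij.ne) (rootFiltration_anti hρ (Nat.le_succ _))
          (rootHom_mem hρ hij) (fun u hu => ⟨_, mul_rootHom_inv_mem hρ hij hu, u.entry i j, ?_⟩)
          (fun s hs a => comm_mem_rootFiltration hρ hs (rootHom_mem hρ hij a))
          (fun s hs c hc => conj_mem_rootFiltration hρ hs hc) ih
        rw [inv_mul_cancel_right]
      · push Not at h
        rw [← rootFiltration_succ_of_forall_ne hρ h]
        exact ih
    · rw [rootFiltration_eq_bot hρ fun i j _ => hM i j]
      exact .bot

variable (n F)

theorem centralTower_subgroupN :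
    CentralTower (subgroupN n (Adele F)) (subgroupN n (Adele F)) := by
  have h := centralTower_rootFiltration (F := F) (isRootOrder_heightOrder n) 0
  rwa [rootFiltration_zero] at h

theorem centralTower_subgroupU :
    CentralTower (subgroupN n (Adele F)) (subgroupU n (Adele F)) := by
  rw [subgroupU_eq_rootFiltration]
  exact centralTower_rootFiltration _ _

theorem centralTower_parabolicRadical_one :
    CentralTower (subgroupN n (Adele F)) (parabolicRadical n (Adele F) 1) := by
  rw [parabolicRadical_one_eq_rootFiltration]
  exact centralTower_rootFiltration _ _

theorem subgroupU_le_subgroupN : subgroupU n (Adele F) ≤ subgroupN n (Adele F) := fun _ h => h.1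

theorem parabolicRadical_one_le_subgroupN :
    parabolicRadical n (Adele F) 1 ≤ subgroupN n (Adele F) := by
  rw [parabolicRadical_one_eq_rootFiltration]
  exact rootFiltration_le _ _

end Towers

/-! ### The adelic quotients are compact Hausdorff. -/

section Quotients

open NumberField

variable {n : ℕ} {F : Type*} [Field F] [NumberField F]

theorem continuous_entry {R : Type*} [CommRing R] [TopologicalSpace R] (i j : Fin (2 * n)) :
    Continuous fun g : Sp n R => g.entry i j :=
  (Units.continuous_val.comp continuous_subtype_val).matrix_elem i j

theorem algebraMap_adele_injective : Function.Injective (algebraMap F (Adele F)) := by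
  obtain ⟨W, hW, h⟩ := exists_nhds_inter_principal (F := F)
  refine (injective_iff_map_eq_zero _).2 fun ξ hξ => h ξ ?_
  rw [hξ]
  exact mem_of_mem_nhds hW

theorem mem_rationalPoints_iff (g : Sp n (Adele F)) : g ∈ rationalPoints n F ↔
    ∀ i j, g.entry i j ∈ AdeleRing.principalSubgroup (𝓞 F) F ∧
      (g⁻¹).entry i j ∈ AdeleRing.principalSubgroup (𝓞 F) F := by
  constructor
  · rintro ⟨γ, rfl⟩ i j
    rw [← map_inv, Sp.entry_map, Sp.entry_map]
    exact ⟨mem_principalSubgroup _, mem_principalSubgroup _⟩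
  · intro h
    choose M hM using fun i j => (h i j).1
    choose M' hM' using fun i j => (h i j).2
    have hinj : Function.Injective
        (fun A : Matrix (Fin (2 * n)) (Fin (2 * n)) F => A.map (algebraMap F (Adele F))) :=
      Matrix.map_injective algebraMap_adele_injective
    have e1 : (Matrix.of M).map (algebraMap F (Adele F)) = (g : GL (Fin (2 * n)) (Adele F)).val :=
      Matrix.ext hM
    have e2 : (Matrix.of M').map (algebraMap F (Adele F)) =
        ((g⁻¹ : Sp n (Adele F)) : GL (Fin (2 * n)) (Adele F)).val := Matrix.ext hM'
    refine ⟨⟨⟨Matrix.of M, Matrix.of M', hinj ?_, hinj ?_⟩, hinj ?_⟩, Sp.ext_entry fun i j => hM i j⟩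
    · change (_ * _ : Matrix _ _ _).map _ = (1 : Matrix _ _ _).map _
      rw [Matrix.map_mul, e1, e2, Matrix.map_one _ (map_zero _) (map_one _)]
      exact (g : GL (Fin (2 * n)) (Adele F)).mul_inv
    · change (_ * _ : Matrix _ _ _).map _ = (1 : Matrix _ _ _).map _
      rw [Matrix.map_mul, e1, e2, Matrix.map_one _ (map_zero _) (map_one _)]
      exact (g : GL (Fin (2 * n)) (Adele F)).inv_mul
    · change ((Matrix.of M)ᵀ * formJ n F * (Matrix.of M)).map _ = (formJ n F).map _
      rw [Matrix.map_mul, Matrix.map_mul, Matrix.transpose_map, e1, formJ_map]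
      exact g.2

/-- The entries of g and g⁻¹ must lie in F, which is closed in 𝔸. This makes the adelic quotients
Hausdorff. -/
theorem isClosed_rationalPoints : IsClosed (rationalPoints n F : Set (Sp n (Adele F))) := by
  have h : (rationalPoints n F : Set (Sp n (Adele F))) = ⋂ i, ⋂ j,
      {g | g.entry i j ∈ AdeleRing.principalSubgroup (𝓞 F) F} ∩
      {g | (g⁻¹).entry i j ∈ AdeleRing.principalSubgroup (𝓞 F) F} := by
    ext g
    simp only [SetLike.mem_coe, mem_rationalPoints_iff, Set.mem_iInter, Set.mem_inter_iff,
      Set.mem_ofPred_eq]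
  rw [h]
  refine isClosed_iInter fun i => isClosed_iInter fun j => IsClosed.inter ?_ ?_
  · exact isClosed_principalSubgroup.preimage (continuous_entry i j)
  · exact isClosed_principalSubgroup.preimage ((continuous_entry i j).comp continuous_inv)

variable {H : Subgroup (Sp n (Adele F))}

/-- The class of an element of `H` in `(H ∩ Sp_{2n}(F)) \ H`. -/
def AdelicQuotient.mk (u : H) : AdelicQuotient H := Quotient.mk _ u

theorem AdelicQuotient.mk_eq_mk {u v : H} :
    AdelicQuotient.mk u = AdelicQuotient.mk v ↔ ((v * u⁻¹ : H) : Sp n (Adele F)) ∈ rationalPoints n F :=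
  Quotient.eq.trans QuotientGroup.rightRel_apply

theorem AdelicQuotient.mk_rep (q : AdelicQuotient H) : AdelicQuotient.mk q.rep = q :=
  Quotient.out_eq q

theorem AdelicQuotient.isOpenQuotientMap_mk : IsOpenQuotientMap (AdelicQuotient.mk (H := H)) where
  surjective := Quotient.mk_surjective
  continuous := continuous_quotient_mk'
  isOpenMap :=
    have : ContinuousConstSMul ((rationalPoints n F).subgroupOf H) H :=
      ⟨fun γ => continuous_const_mul (γ : H)⟩
    isOpenMap_quotient_mk'_mul

theorem AdelicQuotient.rightTranslate_mk (h u : H) :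
    AdelicQuotient.rightTranslate h (AdelicQuotient.mk u) = AdelicQuotient.mk (u * h) := rfl

theorem AdelicQuotient.continuous_rightTranslate (h : H) :
    Continuous (AdelicQuotient.rightTranslate h) :=
  AdelicQuotient.isOpenQuotientMap_mk.isQuotientMap.continuous_iff.2
    (AdelicQuotient.isOpenQuotientMap_mk.continuous.comp (continuous_mul_const h))

instance : T2Space (AdelicQuotient H) := by
  rw [t2Space_iff_of_isOpenQuotientMap AdelicQuotient.isOpenQuotientMap_mk]
  simp only [AdelicQuotient.mk_eq_mk]
  exact isClosed_rationalPoints.preimage (by fun_prop :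
    Continuous fun q : H × H => ((q.2 * q.1⁻¹ : H) : Sp n (Adele F)))

theorem CentralTower.exists_isCompact {S : Subgroup (Sp n (Adele F))} (hT : CentralTower S H) :
    H ≤ S → ∃ C : Set (Sp n (Adele F)), IsCompact C ∧ C ⊆ H ∧
      ∀ u ∈ H, ∃ γ ∈ rationalPoints n F, γ ∈ H ∧ ∃ c ∈ C, u = γ * c := by
  induction hT with
  | bot =>
    refine fun _ => ⟨{1}, isCompact_singleton, by simp,
      fun u hu => ⟨1, one_mem _, one_mem _, 1, rfl, ?_⟩⟩
    rw [Subgroup.mem_bot.1 hu, mul_one]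
  | @step H H' x hxc hadd hrat hle hx hH' hcomm hconj hH ih =>
    intro hS
    obtain ⟨C, hC, hCH, h⟩ := ih (hle.trans hS)
    obtain ⟨D, hD, hD'⟩ := exists_isCompact_adele (F := F)
    refine ⟨(fun z : Sp n (Adele F) × Adele F => z.1 * x z.2) '' (C ×ˢ D),
      (hC.prod hD).image (by fun_prop), ?_, fun u hu => ?_⟩
    · rintro _ ⟨z, ⟨h1, -⟩, rfl⟩
      exact mul_mem (hle (hCH h1)) (hx _)
    · obtain ⟨c, hc, a, rfl⟩ := hH' u hu
      obtain ⟨ξ, d, hd, rfl⟩ := hD' a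
      set y := x (algebraMap F (Adele F) ξ) with hy
      have hyH : y ∈ H' := hx _
      -- Write u = c·y·x(d) with y rational. Moving y to the left replaces c by its conjugate under
      -- y⁻¹, which stays in H, and the inductive decomposition applies to it.
      obtain ⟨γ, hγ, hγH, c', hc', h1⟩ := h (y⁻¹ * c * y)
        (by simpa using hconj y⁻¹ (inv_mem (hS hyH)) c hc)
      refine ⟨y * γ, mul_mem (hrat ξ) hγ, mul_mem hyH (hle hγH), c' * x d,
        ⟨(c', d), ⟨hc', hd⟩, rfl⟩, ?_⟩
      have h2 : y * γ * (c' * x d) = y * (γ * c') * x d := by group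
      rw [h2, ← h1, hadd, ← hy]
      group

theorem CentralTower.compactSpace {S : Subgroup (Sp n (Adele F))} (hT : CentralTower S H)
    (hS : H ≤ S) : CompactSpace (AdelicQuotient H) := by
  obtain ⟨C, hC, hCH, h⟩ := hT.exists_isCompact hS
  have hC' : IsCompact ((↑) ⁻¹' C : Set H) :=
    Topology.IsInducing.subtypeVal.isCompact_preimage' hC (by simpa using hCH)
  refine ⟨(hC'.image AdelicQuotient.isOpenQuotientMap_mk.continuous).of_isClosed_subset
    isClosed_univ fun q _ => ?_⟩
  obtain ⟨γ, hγ, hγH, c, hc, h1⟩ := h q.rep q.rep.2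
  refine ⟨⟨c, hCH hc⟩, hc, ?_⟩
  rw [← q.mk_rep, AdelicQuotient.mk_eq_mk]
  change (q.rep : Sp n (Adele F)) * c⁻¹ ∈ _
  rwa [h1, mul_inv_cancel_right]

end Quotients

/-! ### Functions invariant under H see elements commuting modulo H as commuting. -/

section CommutingTranslates

variable {G V : Type*} [Group G] {S H : Subgroup G} {h : S → V}
  (hinv : ∀ u : S, (u : G) ∈ H → ∀ s, h (u * s) = h s)

include hinv in
theorem apply_comm {x y : S} (hcomm : (((x * y) * (y * x)⁻¹ : S) : G) ∈ H) (m : S) :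
    h (x * y * m) = h (y * x * m) := by
  rw [← hinv _ hcomm (y * x * m)]
  congr 1
  group

include hinv in
theorem apply_mul_of_mem {s c : S} (hconj : ((s * c * s⁻¹ : S) : G) ∈ H) (m : S) :
    h (s * (c * m)) = h (s * m) := by
  rw [← hinv _ hconj (s * m)]
  congr 1
  group

end CommutingTranslates

/-! ### Averaging automorphic functions over a one-parameter subgroup. -/

section Averages

variable {n : ℕ} {F : Type*} [Field F] [NumberField F]
  {S : Subgroup (Sp n (Adele F))} {V : Type*} [NormedAddCommGroup V]

/-- Continuous functions on a subgroup `S` of `Sp_{2n}(𝔸)` which are left invariant under the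
rational points in `S`. -/
structure IsAutomorphic (h : S → V) : Prop where
  continuous : Continuous h
  left_inv : ∀ γ : S, (γ : Sp n (Adele F)) ∈ rationalPoints n F → ∀ s, h (γ * s) = h s

theorem IsAutomorphic.add {h k : S → V} (hh : IsAutomorphic h) (hk : IsAutomorphic k) :
    IsAutomorphic (h + k) :=
  ⟨hh.continuous.add hk.continuous, fun γ hγ s => by
    rw [Pi.add_apply, hh.left_inv γ hγ, hk.left_inv γ hγ, Pi.add_apply]⟩

theorem IsAutomorphic.const_smul [NormedSpace ℝ V] {h : S → V} (hh : IsAutomorphic h) (c : ℝ) :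
    IsAutomorphic (c • h) :=
  ⟨hh.continuous.const_smul c, fun γ hγ s => by
    rw [Pi.smul_apply, hh.left_inv γ hγ, Pi.smul_apply]⟩

theorem IsAutomorphic.comp_mul_right {h : S → V} (hh : IsAutomorphic h) (m : S) :
    IsAutomorphic fun s => h (s * m) :=
  ⟨hh.continuous.comp (continuous_mul_const m), fun γ hγ s => by
    rw [mul_assoc, hh.left_inv γ hγ]⟩

theorem adeleClass_out (a : Adele F) :
    ∃ ξ : F, (a : AdeleClass F).out = algebraMap F (Adele F) ξ + a := by
  obtain ⟨ξ, hξ⟩ := QuotientAddGroup.eq.1 (QuotientAddGroup.out_eq' (a : AdeleClass F)).symm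
  exact ⟨ξ, by rw [hξ]; abel⟩

theorem isOpenQuotientMap_adeleClass_mk :
    IsOpenQuotientMap (fun a : Adele F => (a : AdeleClass F)) :=
  QuotientAddGroup.isOpenQuotientMap_mk

variable {K : Subgroup (Sp n (Adele F))}

theorem continuous_subgroup_inclusion (hK : K ≤ S) : Continuous (Subgroup.inclusion hK) :=
  continuous_subtype_val.subtype_mk _

theorem IsAutomorphic.apply_rep {h : S → V} (hh : IsAutomorphic h) (hK : K ≤ S) (k : K) (s : S) :
    h (Subgroup.inclusion hK (AdelicQuotient.mk k).rep * s) = h (Subgroup.inclusion hK k * s) := by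
  have h1 : AdelicQuotient.mk k = AdelicQuotient.mk (AdelicQuotient.mk k).rep :=
    (AdelicQuotient.mk_rep _).symm
  rw [AdelicQuotient.mk_eq_mk] at h1
  rw [← hh.left_inv (Subgroup.inclusion hK ((AdelicQuotient.mk k).rep * k⁻¹)) h1
    (Subgroup.inclusion hK k * s), ← mul_assoc,
    ← map_mul, inv_mul_cancel_right]

theorem IsAutomorphic.continuous_rep {h : S → V} (hh : IsAutomorphic h) (hK : K ≤ S) (s : S) :
    Continuous fun q : AdelicQuotient K => h (Subgroup.inclusion hK q.rep * s) := by
  refine AdelicQuotient.isOpenQuotientMap_mk.isQuotientMap.continuous_iff.2 ?_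
  simp only [Function.comp_def, hh.apply_rep hK]
  exact hh.continuous.comp ((continuous_subgroup_inclusion hK).mul continuous_const)

theorem IsAutomorphic.apply_out {x : Adele F → S} (hadd : ∀ a b, x (a + b) = x a * x b)
    (hrat : ∀ ξ : F, (x (algebraMap F (Adele F) ξ) : Sp n (Adele F)) ∈ rationalPoints n F)
    {h : S → V} (hh : IsAutomorphic h) (a : Adele F) (s : S) :
    h (x (a : AdeleClass F).out * s) = h (x a * s) := by
  obtain ⟨ξ, hξ⟩ := adeleClass_out a
  rw [hξ, hadd, mul_assoc, hh.left_inv _ (hrat ξ)]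

theorem IsAutomorphic.continuous_out {x : Adele F → S} (hxc : Continuous x)
    (hadd : ∀ a b, x (a + b) = x a * x b)
    (hrat : ∀ ξ : F, (x (algebraMap F (Adele F) ξ) : Sp n (Adele F)) ∈ rationalPoints n F)
    {h : S → V} (hh : IsAutomorphic h) :
    Continuous fun z : S × AdeleClass F => h (x z.2.out * z.1) := by
  refine (IsOpenQuotientMap.prodMap IsOpenQuotientMap.id
    isOpenQuotientMap_adeleClass_mk).isQuotientMap.continuous_iff.2 ?_
  simp only [Function.comp_def, Prod.map_snd, Prod.map_fst, hh.apply_out hadd hrat]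
  have := hh.continuous
  simp only [id]
  fun_prop

theorem IsAutomorphic.integrable_out {x : Adele F → S} (hxc : Continuous x)
    (hadd : ∀ a b, x (a + b) = x a * x b)
    (hrat : ∀ ξ : F, (x (algebraMap F (Adele F) ξ) : Sp n (Adele F)) ∈ rationalPoints n F)
    {h : S → V} (hh : IsAutomorphic h) (s : S) :
    Integrable (fun t : AdeleClass F => h (x t.out * s)) (adeleClassMeasure F) :=
  ((hh.continuous_out hxc hadd hrat).comp (.prodMk_right s)).integrable_of_hasCompactSupport
    (HasCompactSupport.of_compactSpace _)

theorem IsAutomorphic.integral_rep_mul [NormedSpace ℝ V] [SecondCountableTopology V] {h : S → V}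
    (hh : IsAutomorphic h) (hK : K ≤ S) {μ : Measure (AdelicQuotient K)}
    (hμ : IsInvariantProbability μ) (y : K) (s : S) :
    ∫ q, h (Subgroup.inclusion hK q.rep * (Subgroup.inclusion hK y * s)) ∂μ =
      ∫ q, h (Subgroup.inclusion hK q.rep * s) ∂μ := by
  have h1 : Continuous fun q : AdelicQuotient K => h (Subgroup.inclusion hK q.rep * s) :=
    hh.continuous_rep hK s
  have h2 := integral_map (μ := μ) (AdelicQuotient.continuous_rightTranslate y).aemeasurable
    h1.aestronglyMeasurable
  rw [hμ.map_rightTranslate] at h2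
  rw [h2]
  refine integral_congr_ae (ae_of_all _ fun q => ?_)
  have h3 : AdelicQuotient.rightTranslate y q = AdelicQuotient.mk (q.rep * y) := by
    conv_lhs => rw [← q.mk_rep]
    rfl
  dsimp only
  rw [h3, hh.apply_rep, map_mul, mul_assoc]

/-- Changing the representative of q is harmless only when it stands on the left. Since x is central
modulo H and h is H-invariant, the two factors can be swapped for this purpose. -/
theorem IsAutomorphic.continuous_out_rep {x : Adele F → S} (hxc : Continuous x)
    (hadd : ∀ a b, x (a + b) = x a * x b)
    (hrat : ∀ ξ : F, (x (algebraMap F (Adele F) ξ) : Sp n (Adele F)) ∈ rationalPoints n F)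
    {h : S → V} (hh : IsAutomorphic h) {H : Subgroup (Sp n (Adele F))}
    (hcomm : ∀ (s : S) a, (((s * x a) * (x a * s)⁻¹ : S) : Sp n (Adele F)) ∈ H)
    (hinv : ∀ u : S, (u : Sp n (Adele F)) ∈ H → ∀ s, h (u * s) = h s) (hK : K ≤ S) (s : S) :
    Continuous (Function.uncurry fun (q : AdelicQuotient K) (t : AdeleClass F) =>
      h (x t.out * (Subgroup.inclusion hK q.rep * s))) := by
  refine (IsOpenQuotientMap.prodMap AdelicQuotient.isOpenQuotientMap_mk
    isOpenQuotientMap_adeleClass_mk).isQuotientMap.continuous_iff.2 ?_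
  have h1 : ∀ z : K × Adele F, h (x z.2 * (Subgroup.inclusion hK (AdelicQuotient.mk z.1).rep * s))
      = h (x z.2 * (Subgroup.inclusion hK z.1 * s)) := fun z => by
    rw [← mul_assoc, ← apply_comm hinv (hcomm _ _), mul_assoc, hh.apply_rep, ← mul_assoc,
      apply_comm hinv (hcomm _ _), mul_assoc]
  simp only [Function.comp_def, Function.uncurry_def, Prod.map_snd, Prod.map_fst,
    hh.apply_out hadd hrat, h1]
  exact hh.continuous.comp ((hxc.comp continuous_snd).mul
    (((continuous_subgroup_inclusion hK).comp continuous_fst).mul continuous_const))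

variable [NormedSpace ℝ V]

/-- Averaging a function over a one-parameter subgroup. -/
def oneParamAverage (x : Adele F → S) (h : S → V) (s : S) : V :=
  ∫ t : AdeleClass F, h (x t.out * s) ∂adeleClassMeasure F

section OneParam

variable {x : Adele F → S} (hxc : Continuous x) (hadd : ∀ a b, x (a + b) = x a * x b)
  (hrat : ∀ ξ : F, (x (algebraMap F (Adele F) ξ) : Sp n (Adele F)) ∈ rationalPoints n F)
  {h : S → V} (hh : IsAutomorphic h)

include hxc hadd hrat hh in
theorem continuous_oneParamAverage : Continuous (oneParamAverage x h) := by
  rw [← continuousOn_univ]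
  refine continuousOn_integral_of_compact_support (k := Set.univ) isCompact_univ ?_
    (fun _ _ _ h => absurd (Set.mem_univ _) h)
  exact (hh.continuous_out hxc hadd hrat).continuousOn

include hadd hrat hh in
theorem oneParamAverage_mul (a : Adele F) (s : S) :
    oneParamAverage x h (x a * s) = oneParamAverage x h s := by
  have h1 := integral_add_right_eq_self (μ := adeleClassMeasure F)
    (fun t : AdeleClass F => h (x t.out * s)) (a : AdeleClass F)
  rw [oneParamAverage, oneParamAverage, ← h1]
  congr 1
  funext t
  obtain ⟨b, rfl⟩ := QuotientAddGroup.mk_surjective t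
  rw [← QuotientAddGroup.mk_add, hh.apply_out hadd hrat, hh.apply_out hadd hrat, hadd, mul_assoc]

variable {H : Subgroup (Sp n (Adele F))}
  (hcomm : ∀ (s : S) a, (((s * x a) * (x a * s)⁻¹ : S) : Sp n (Adele F)) ∈ H)
  (hconj : ∀ (s c : S), (c : Sp n (Adele F)) ∈ H → ((s * c * s⁻¹ : S) : Sp n (Adele F)) ∈ H)
  (hinv : ∀ u : S, (u : Sp n (Adele F)) ∈ H → ∀ s, h (u * s) = h s)

include hconj hinv in
theorem oneParamAverage_mul_of_mem {c : S} (hc : (c : Sp n (Adele F)) ∈ H) (s : S) :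
    oneParamAverage x h (c * s) = oneParamAverage x h s := by
  simp only [oneParamAverage, apply_mul_of_mem hinv (hconj _ c hc)]

include hxc hadd hrat hh hcomm hinv in
theorem isAutomorphic_oneParamAverage : IsAutomorphic (oneParamAverage x h) := by
  refine ⟨continuous_oneParamAverage hxc hadd hrat hh, fun γ hγ s => ?_⟩
  unfold oneParamAverage
  congr 1
  funext t
  rw [← mul_assoc, ← apply_comm hinv (hcomm _ _), mul_assoc, hh.left_inv γ hγ]

include hxc hadd hrat hh hcomm hinv in
-- Interchange the integrals. For fixed t, centrality modulo H moves x(t) to the right of the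
-- representative, where invariance of μ absorbs it; the inner integral does not depend on t.
theorem integral_oneParamAverage [SecondCountableTopology V] [CompleteSpace V] (hK : K ≤ S)
    (hxK : ∀ a, (x a : Sp n (Adele F)) ∈ K) [CompactSpace (AdelicQuotient K)]
    {μ : Measure (AdelicQuotient K)} (hμ : IsInvariantProbability μ) (s : S) :
    ∫ q, oneParamAverage x h (Subgroup.inclusion hK q.rep * s) ∂μ =
      ∫ q, h (Subgroup.inclusion hK q.rep * s) ∂μ := by
  have := hμ.isProbabilityMeasure
  have hcont := hh.continuous_out_rep hxc hadd hrat hcomm hinv hK s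
  have hint : ∀ a : Adele F, ∫ q, h (x a * (Subgroup.inclusion hK q.rep * s)) ∂μ =
      ∫ q, h (Subgroup.inclusion hK q.rep * s) ∂μ := fun a => by
    rw [← hh.integral_rep_mul hK hμ ⟨x a, hxK a⟩ s]
    refine integral_congr_ae (ae_of_all _ fun q => ?_)
    dsimp only
    rw [← mul_assoc, ← apply_comm hinv (hcomm _ _), mul_assoc]
    rfl
  have hswap := integral_integral_swap_of_hasCompactSupport hcont
    (HasCompactSupport.of_compactSpace _) (μ := μ) (ν := adeleClassMeasure F)
  have h1 : ∀ t : AdeleClass F, ∫ q, h (x t.out * (Subgroup.inclusion hK q.rep * s)) ∂μ =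
      ∫ q, h (Subgroup.inclusion hK q.rep * s) ∂μ := fun t => hint t.out
  simp_rw [h1] at hswap
  rw [integral_const, probReal_univ, one_smul] at hswap
  exact hswap

end OneParam

end Averages

/-! ### Iterated averages and existence of invariant probability measures. -/

section AverageOperators

variable {n : ℕ} {F : Type*} [Field F] [NumberField F]

/-- Operators which average functions on `S` over the subgroup `H` of `S`. -/
structure IsAverage (S H : Subgroup (Sp n (Adele F))) {V : Type*} [NormedAddCommGroup V]
    [NormedSpace ℝ V] (E : (S → V) → (S → V)) : Prop where
  isAutomorphic : ∀ {h}, IsAutomorphic h → IsAutomorphic (E h)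
  invariant : ∀ {h}, IsAutomorphic h → ∀ u : S, (u : Sp n (Adele F)) ∈ H → ∀ s, E h (u * s) = E h s
  integral : ∀ {h}, IsAutomorphic h → ∀ {K : Subgroup (Sp n (Adele F))}, H ≤ K → ∀ (hK : K ≤ S),
    CompactSpace (AdelicQuotient K) → ∀ {μ : Measure (AdelicQuotient K)},
      IsInvariantProbability μ → ∀ s, ∫ q, E h (Subgroup.inclusion hK q.rep * s) ∂μ =
        ∫ q, h (Subgroup.inclusion hK q.rep * s) ∂μ
  add : ∀ {h k}, IsAutomorphic h → IsAutomorphic k → E (h + k) = E h + E k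
  smul : ∀ (c : ℝ) h, E (c • h) = c • E h
  const : ∀ v, E (fun _ => v) = fun _ => v
  nonneg : ∀ {h}, IsAutomorphic h → ∀ L : V →L[ℝ] ℝ, (∀ s, 0 ≤ L (h s)) → ∀ s, 0 ≤ L (E h s)
  translate : ∀ h m, E (fun s => h (s * m)) = fun s => E h (s * m)

/-- Each step of the tower composes the preceding operator with one average over 𝔸/F. The result is
invariant under the new group because the preceding one was invariant under H and x is central
modulo H. -/
theorem CentralTower.exists_isAverage {S H : Subgroup (Sp n (Adele F))} (hT : CentralTower S H)
    (V : Type*) [NormedAddCommGroup V] [NormedSpace ℝ V] [CompleteSpace V]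
    [SecondCountableTopology V] :
    H ≤ S → ∃ E : (S → V) → (S → V), IsAverage S H E := by
  induction hT with
  | bot =>
    refine fun _ => ⟨id, ⟨id, fun _ u hu s => ?_, fun _ _ _ _ _ _ _ _ => rfl, fun _ _ => rfl,
      fun _ _ => rfl, fun _ => rfl, fun _ _ => id, fun _ _ => rfl⟩⟩
    rw [show u = 1 from Subtype.ext (Subgroup.mem_bot.1 hu), one_mul]
  | @step H H' x₀ hxc₀ hadd₀ hrat hle hx hH' hcomm₀ hconj₀ hH ih =>
    intro hS
    obtain ⟨E, hE⟩ := ih (hle.trans hS)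
    let x : Adele F → S := fun a => ⟨x₀ a, hS (hx a)⟩
    have hxc : Continuous x := hxc₀.subtype_mk _
    have hadd : ∀ a b, x (a + b) = x a * x b := fun a b => Subtype.ext (hadd₀ a b)
    have hcomm : ∀ (s : S) a, (((s * x a) * (x a * s)⁻¹ : S) : Sp n (Adele F)) ∈ H :=
      fun s a => hcomm₀ s s.2 a
    have hconj : ∀ (s c : S), (c : Sp n (Adele F)) ∈ H →
        ((s * c * s⁻¹ : S) : Sp n (Adele F)) ∈ H := fun s c => hconj₀ s s.2 c
    refine ⟨fun h => oneParamAverage x (E h), ?_⟩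
    constructor
    · intro h hh
      exact isAutomorphic_oneParamAverage hxc hadd hrat (hE.isAutomorphic hh) hcomm (hE.invariant hh)
    · intro h hh u hu s
      obtain ⟨c, hc, a, hca⟩ := hH' u hu
      have h1 : u = ⟨c, hS (hle hc)⟩ * x a := Subtype.ext hca
      rw [h1, mul_assoc, oneParamAverage_mul_of_mem hconj (hE.invariant hh) hc,
        oneParamAverage_mul hadd hrat (hE.isAutomorphic hh)]
    · intro h hh K hK hKS hKc μ hμ s
      rw [integral_oneParamAverage hxc hadd hrat (hE.isAutomorphic hh) hcomm (hE.invariant hh) hKS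
        (fun a => hK (hx a)) hμ, hE.integral hh (hle.trans hK) hKS hKc hμ]
    · intro h k hh hk
      funext s
      rw [hE.add hh hk]
      exact integral_add ((hE.isAutomorphic hh).integrable_out hxc hadd hrat s)
        ((hE.isAutomorphic hk).integrable_out hxc hadd hrat s)
    · intro c h
      funext s
      rw [hE.smul]
      exact integral_smul c _
    · intro v
      funext s
      rw [hE.const, oneParamAverage, integral_const, probReal_univ, one_smul]
    · intro h hh L hL s
      rw [oneParamAverage,
        ← L.integral_comp_comm ((hE.isAutomorphic hh).integrable_out hxc hadd hrat s)]
      exact integral_nonneg fun t => hE.nonneg hh L hL _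
    · intro h m
      funext s
      rw [hE.translate]
      simp only [oneParamAverage, mul_assoc]

/-- The Riesz–Markov theorem applied to f ↦ (E f)(1). Cuspidality speaks of all invariant measures
on the radical, and would be void without one. -/
theorem CentralTower.exists_isInvariantProbability {H : Subgroup (Sp n (Adele F))}
    (hT : CentralTower H H) : ∃ μ : Measure (AdelicQuotient H), IsInvariantProbability μ := by
  obtain ⟨E, hE⟩ := hT.exists_isAverage ℝ le_rfl
  have hcomp : CompactSpace (AdelicQuotient H) := hT.compactSpace le_rfl
  have haut : ∀ f : AdelicQuotient H → ℝ, Continuous f →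
      IsAutomorphic fun s : H => f (AdelicQuotient.mk s) := fun f hf =>
    ⟨hf.comp AdelicQuotient.isOpenQuotientMap_mk.continuous, fun γ hγ s => by
      congr 1
      rw [AdelicQuotient.mk_eq_mk, mul_inv_rev, mul_inv_cancel_left]
      exact inv_mem hγ⟩
  let Λ : CompactlySupportedContinuousMap (AdelicQuotient H) ℝ →ₚ[ℝ] ℝ := PositiveLinearMap.mk₀
    { toFun := fun f => E (fun s => f (AdelicQuotient.mk s)) 1
      map_add' := fun f g => congrFun (hE.add (haut f f.continuous) (haut g g.continuous)) 1
      map_smul' := fun c f => congrFun (hE.smul c _) 1 }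
    (fun f hf => hE.nonneg (haut f f.continuous) (ContinuousLinearMap.id ℝ ℝ) (fun s => hf _) 1)
  have hint : ∀ f : AdelicQuotient H → ℝ, Continuous f → ∫ q, f q ∂(RealRMK.rieszMeasure Λ) =
      E (fun s => f (AdelicQuotient.mk s)) 1 := fun f hf =>
    RealRMK.integral_rieszMeasure Λ ⟨⟨f, hf⟩, HasCompactSupport.of_compactSpace _⟩
  refine ⟨RealRMK.rieszMeasure Λ, ⟨?_⟩, fun m => ?_⟩
  · have h1 := hint (fun _ => 1) continuous_const
    rw [hE.const, integral_const, smul_eq_mul, mul_one, Measure.real,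
      ENNReal.toReal_eq_one_iff] at h1
    exact h1
  · let e : AdelicQuotient H ≃ₜ AdelicQuotient H :=
      { toFun := AdelicQuotient.rightTranslate m
        invFun := AdelicQuotient.rightTranslate m⁻¹
        left_inv := fun q => by
          rw [← q.mk_rep, AdelicQuotient.rightTranslate_mk, AdelicQuotient.rightTranslate_mk,
            mul_inv_cancel_right]
        right_inv := fun q => by
          rw [← q.mk_rep, AdelicQuotient.rightTranslate_mk, AdelicQuotient.rightTranslate_mk,
            inv_mul_cancel_right]
        continuous_toFun := AdelicQuotient.continuous_rightTranslate m
        continuous_invFun := AdelicQuotient.continuous_rightTranslate m⁻¹ }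
    have hreg : ((RealRMK.rieszMeasure Λ).map (AdelicQuotient.rightTranslate m)).Regular :=
      Measure.Regular.map e
    refine Measure.ext_of_integral_eq_on_compactlySupported fun f => ?_
    have hc := AdelicQuotient.continuous_rightTranslate m
    have hf : Continuous (f : AdelicQuotient H → ℝ) := f.continuous
    rw [integral_map hc.aemeasurable hf.aestronglyMeasurable, hint _ hf,
      hint (fun q => f (AdelicQuotient.rightTranslate m q)) (hf.comp hc)]
    simp only [AdelicQuotient.rightTranslate_mk]
    -- Right translation of f by m moves the evaluation point from 1 to m, and m lies in the group
    -- under which E f is left invariant.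
    rw [hE.translate fun s => f (AdelicQuotient.mk s)]
    dsimp only
    rw [one_mul, ← mul_one m, hE.invariant (haut f hf) m m.2]

end AverageOperators

/-! ### Iterated differences of C^k functions. -/

section Differences

/-- The difference of a function and its composition with a self-map. -/
def mapDiff {X G : Type*} [Sub G] (τ : X → X) (f : X → G) (x : X) : G := f (τ x) - f x

theorem mapDiff_iterate_succ {X G : Type*} [Sub G] (τ : X → X) (f : X → G) (k : ℕ) (x : X) :
    (mapDiff τ)^[k + 1] f x = (mapDiff τ)^[k] f (τ x) - (mapDiff τ)^[k] f x := by
  rw [Function.iterate_succ_apply']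
  rfl

theorem mapDiff_iterate_congr {X Y R : Type*} [CommRing R] {τ : X → X} {τ' : Y → Y}
    {f : X → R} {f' : Y → R} (c : R) (k : ℕ) : ∀ {x : X} {y : Y},
      (∀ j ≤ k, f (τ^[j] x) = c * f' (τ'^[j] y)) →
      (mapDiff τ)^[k] f x = c * (mapDiff τ')^[k] f' y := by
  induction k with
  | zero => exact fun h => h 0 le_rfl
  | succ k ih =>
    intro x y h
    rw [mapDiff_iterate_succ, mapDiff_iterate_succ, mul_sub, ih fun j hj => h j (by omega),
      ih fun j hj => h (j + 1) (by omega)]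

theorem norm_mapDiff_iterate_le {X G : Type*} [NormedAddCommGroup G] {τ : X → X} {f : X → G}
    {M : ℝ} (hM : ∀ x, ‖f x‖ ≤ M) (k : ℕ) : ∀ x, ‖(mapDiff τ)^[k] f x‖ ≤ 2 ^ k * M := by
  induction k with
  | zero => simpa using hM
  | succ k ih =>
    intro x
    rw [mapDiff_iterate_succ]
    refine (norm_sub_le _ _).trans ?_
    have h1 := ih x
    have h2 := ih (τ x)
    rw [pow_succ]
    linarith

variable {E : Type*} [NormedAddCommGroup E] [NormedSpace ℝ E]

theorem hasFDerivAt_mapDiff_iterate {G : Type*} [NormedAddCommGroup G] [NormedSpace ℝ G]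
    {f : E → G} {f' : E → E →L[ℝ] G} (b : E) (k : ℕ) : ∀ {z : E},
      (∀ j ≤ k, HasFDerivAt f (f' (z + j • b)) (z + j • b)) →
      HasFDerivAt ((mapDiff (· + b))^[k] f) ((mapDiff (· + b))^[k] f' z) z := by
  induction k with
  | zero => exact fun h => by simpa using h 0 le_rfl
  | succ k ih =>
    intro z h
    have h1 := ih (z := z) fun j hj => h j (by omega)
    have h2 := ih (z := z + b) fun j hj => by
      have := h (j + 1) (by omega)
      rwa [add_smul, one_smul, add_comm (j • b), ← add_assoc] at this
    have h3 : HasFDerivAt (fun z => (mapDiff (· + b))^[k] f (z + b))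
        ((mapDiff (· + b))^[k] f' (z + b)) z := (hasFDerivAt_comp_add_right b).2 h2
    rw [mapDiff_iterate_succ]
    have h4 : (mapDiff (· + b))^[k + 1] f = fun z => (mapDiff (· + b))^[k] f (z + b) -
      (mapDiff (· + b))^[k] f z := funext fun z => mapDiff_iterate_succ _ _ _ _
    rw [h4]
    exact h3.sub h1

/-- Mean value inequality on [z, z + b] for the k-th difference of f, whose derivative is the k-th
difference of f'. Each derivative thus gains one factor ‖b‖. -/
theorem eventually_norm_mapDiff_succ_le {G : Type*} [NormedAddCommGroup G] [NormedSpace ℝ G]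
    {f : E → G} {f' : E → E →L[ℝ] G} {z₀ : E} {u : Set E} (hu : u ∈ 𝓝 z₀)
    (hf : ∀ z ∈ u, HasFDerivAt f (f' z) z) {k : ℕ} {C : ℝ}
    (hC : ∀ᶠ p : E × E in 𝓝 (z₀, 0), ‖(mapDiff (· + p.2))^[k] f' p.1‖ ≤ C * ‖p.2‖ ^ k) :
    ∀ᶠ p : E × E in 𝓝 (z₀, 0), ‖(mapDiff (· + p.2))^[k + 1] f p.1‖ ≤ C * ‖p.2‖ ^ (k + 1) := by
  obtain ⟨δ₁, hδ₁, h1⟩ := Metric.eventually_nhds_iff.1 hC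
  obtain ⟨δ₂, hδ₂, h2⟩ := Metric.mem_nhds_iff.1 hu
  have hδ : 0 < min δ₁ δ₂ := lt_min hδ₁ hδ₂
  have hk : (0 : ℝ) < k + 2 := by positivity
  -- The points w + jb with w in [z, z + b] and j ≤ k stay within k + 2 times this radius of z₀.
  refine Metric.eventually_nhds_iff.2 ⟨min δ₁ δ₂ / (k + 2), div_pos hδ hk, ?_⟩
  rintro ⟨z, b⟩ hzb
  rw [Prod.dist_eq, max_lt_iff, dist_zero_right] at hzb
  obtain ⟨hz, hb⟩ := hzb
  dsimp only at hz hb ⊢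
  have hsmall : ∀ w ∈ segment ℝ z (z + b), ∀ j ≤ k, dist (w + j • b) z₀ < min δ₁ δ₂ := by
    intro w hw j hj
    rw [segment_eq_image'] at hw
    obtain ⟨θ, ⟨hθ0, hθ1⟩, rfl⟩ := hw
    rw [add_sub_cancel_left, dist_eq_norm]
    have e : z + θ • b + j • b - z₀ = (z - z₀) + (θ + j) • b := by
      rw [add_smul, Nat.cast_smul_eq_nsmul]; abel
    rw [e]
    have hjk : (j : ℝ) ≤ k := by exact_mod_cast hj
    calc _ ≤ ‖z - z₀‖ + ‖(θ + j) • b‖ := norm_add_le _ _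
      _ = ‖z - z₀‖ + (θ + j) * ‖b‖ := by
          rw [norm_smul, Real.norm_of_nonneg (by positivity)]
      _ < min δ₁ δ₂ / (k + 2) + (1 + k) * (min δ₁ δ₂ / (k + 2)) := by
          rw [dist_eq_norm] at hz
          refine add_lt_add_of_lt_of_le hz ?_
          gcongr
      _ = min δ₁ δ₂ := by field_simp; ring
  have h3 := (convex_segment z (z + b)).norm_image_sub_le_of_norm_hasFDerivWithin_le
    (f := (mapDiff (· + b))^[k] f) (f' := (mapDiff (· + b))^[k] f') (C := C * ‖b‖ ^ k)
    (fun w hw => (hasFDerivAt_mapDiff_iterate b k fun j hj => hf _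
      (h2 ((hsmall w hw j hj).trans_le (min_le_right _ _)))).hasFDerivWithinAt)
    (fun w hw => h1 (y := (w, b)) (by
      rw [Prod.dist_eq, max_lt_iff, dist_zero_right]
      have := hsmall w hw 0 (Nat.zero_le _)
      rw [zero_smul, add_zero] at this
      refine ⟨this.trans_le (min_le_left _ _), hb.trans_le ?_⟩
      exact (div_le_self hδ.le (by linarith [Nat.cast_nonneg (α := ℝ) k])).trans (min_le_left _ _)))
    (left_mem_segment ℝ z (z + b)) (right_mem_segment ℝ z (z + b))
  rw [mapDiff_iterate_succ, pow_succ, ← mul_assoc]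
  simpa using h3

theorem exists_eventually_norm_mapDiff_zero_le {E G : Type*} [NormedAddCommGroup E]
    [NormedAddCommGroup G] {f : E → G}
    {z₀ : E} (hf : ContinuousAt f z₀) :
    ∃ C, ∀ᶠ p : E × E in 𝓝 (z₀, 0), ‖(mapDiff (· + p.2))^[0] f p.1‖ ≤ C * ‖p.2‖ ^ 0 := by
  refine ⟨‖f z₀‖ + 1, ?_⟩
  have h1 : ContinuousAt (fun p : E × E => ‖f p.1‖) (z₀, 0) :=
    (hf.comp (f := Prod.fst) (x := (z₀, (0 : E))) continuousAt_fst).norm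
  filter_upwards [h1.eventually_lt continuousAt_const (lt_add_one ‖f z₀‖)] with p hp
  simpa using hp.le

universe u in
-- The induction replaces the target G by the space of linear maps from E to G, so both are kept in
-- one universe; for target ℂ a first derivative moves into the universe of E.
theorem exists_eventually_norm_mapDiff_le_aux {E : Type u} [NormedAddCommGroup E]
    [NormedSpace ℝ E] {z₀ : E} (k : ℕ) : ∀ {G : Type u} [NormedAddCommGroup G] [NormedSpace ℝ G]
    {f : E → G}, ContDiffAt ℝ k f z₀ →
    ∃ C, ∀ᶠ p : E × E in 𝓝 (z₀, 0), ‖(mapDiff (· + p.2))^[k] f p.1‖ ≤ C * ‖p.2‖ ^ k := by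
  induction k with
  | zero => exact fun hf => exists_eventually_norm_mapDiff_zero_le hf.continuousAt
  | succ k ih =>
    intro G _ _ f hf
    obtain ⟨f', ⟨u, hu, hfu⟩, hf'⟩ := contDiffAt_succ_iff_hasFDerivAt.1 (by exact_mod_cast hf)
    obtain ⟨C, hC⟩ := ih hf'
    exact ⟨C, eventually_norm_mapDiff_succ_le hu hfu hC⟩

/-- Iterated differences of a function with `k` continuous derivatives. -/
theorem exists_eventually_norm_mapDiff_le {z₀ : E} {f : E → ℂ} (k : ℕ)
    (hf : ContDiffAt ℝ k f z₀) :
    ∃ C, ∀ᶠ p : E × E in 𝓝 (z₀, 0), ‖(mapDiff (· + p.2))^[k] f p.1‖ ≤ C * ‖p.2‖ ^ k := by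
  cases k with
  | zero => exact exists_eventually_norm_mapDiff_zero_le hf.continuousAt
  | succ k =>
    obtain ⟨f', ⟨u, hu, hfu⟩, hf'⟩ := contDiffAt_succ_iff_hasFDerivAt.1 (by exact_mod_cast hf)
    obtain ⟨C, hC⟩ := exists_eventually_norm_mapDiff_le_aux k hf'
    exact ⟨C, eventually_norm_mapDiff_succ_le hu hfu hC⟩

end Differences

/-! ### Smooth functions on the group along a root subgroup, locally. -/

section Smoothness

open IsDedekindDomain HeightOneSpectrum NumberField mixedEmbedding
open scoped Classical

variable {n : ℕ} {F : Type*} [Field F] [NumberField F]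

/-- The component of an adele at an archimedean place, as a complex number. -/
def archEval (v : InfinitePlace F) : Adele F →+* ℂ :=
  (InfinitePlace.Completion.extensionEmbedding v).comp
    ((Pi.evalRingHom (fun v : InfinitePlace F => v.Completion) v).comp
      (RingHom.fst (InfiniteAdeleRing F) (FiniteAdeleRing (𝓞 F) F)))

theorem continuous_archEval (v : InfinitePlace F) : Continuous (archEval (F := F) v) :=
  (InfinitePlace.Completion.isometry_extensionEmbedding v).continuous.comp
    (continuous_adele_infinite v)

theorem archCoord_apply (g : Sp n (Adele F)) (i j : Fin (2 * n)) (v : InfinitePlace F) :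
    archCoord g i j v = archEval v (g.entry i j) := rfl

theorem continuous_archCoord : Continuous (archCoord (n := n) (F := F)) :=
  continuous_pi fun i => continuous_pi fun j => continuous_pi fun v =>
    (continuous_archEval v).comp (continuous_entry i j)

theorem archEval_finiteAdele (v : InfinitePlace F) (y : FiniteAdeleRing (𝓞 F) F) :
    archEval v (finiteAdele y) = 0 := map_zero (InfinitePlace.Completion.extensionEmbedding v)

/-- A continuous additive map between real vector spaces is real linear, hence bounded here. -/
theorem exists_norm_archEval_archAdele_le : ∃ C, 0 ≤ C ∧ ∀ (v : InfinitePlace F) (h : mixedSpace F),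
    ‖archEval v (archAdele h)‖ ≤ C * ‖h‖ := by
  let L : InfinitePlace F → mixedSpace F →L[ℝ] ℂ := fun v =>
    ((archEval v).toAddMonoidHom.comp archAdele).toRealLinearMap
      ((continuous_archEval v).comp continuous_archAdele)
  refine ⟨∑ v, ‖L v‖, Finset.sum_nonneg fun v _ => norm_nonneg _, fun v h => ?_⟩
  refine ((L v).le_opNorm h).trans (mul_le_mul_of_nonneg_right ?_ (norm_nonneg _))
  exact Finset.single_le_sum (f := fun v => ‖L v‖) (fun _ _ => norm_nonneg _) (Finset.mem_univ v)

variable {i₀ j₀ : Fin (2 * n)} (hij : i₀ ≠ j₀) (g : Sp n (Adele F))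

/-- The derivative of the entries of `s x(t) g` in the parameter `t` of a root subgroup. -/
def rootVelocity (i₀ j₀ : Fin (2 * n)) (g s : Sp n (Adele F)) :
    Matrix (Fin (2 * n)) (Fin (2 * n)) (Adele F) :=
  (s : GL (Fin (2 * n)) (Adele F)).val * rootMatrix (Adele F) i₀ j₀ *
    (g : GL (Fin (2 * n)) (Adele F)).val

theorem entry_mul_rootHom_mul (s : Sp n (Adele F)) (t : Adele F) (i j : Fin (2 * n)) :
    (s * rootHom hij t * g).entry i j = (s * g).entry i j + t * rootVelocity i₀ j₀ g s i j := by
  change ((s : GL (Fin (2 * n)) (Adele F)).val * (1 + t • rootMatrix (Adele F) i₀ j₀) *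
    (g : GL (Fin (2 * n)) (Adele F)).val) i j = _
  rw [mul_add, mul_one, add_mul, Matrix.mul_smul, Matrix.smul_mul]
  rfl

theorem continuous_rootVelocity (i j : Fin (2 * n)) :
    Continuous fun s : Sp n (Adele F) => rootVelocity i₀ j₀ g s i j := by
  have h1 : Continuous fun s : Sp n (Adele F) => (s : GL (Fin (2 * n)) (Adele F)).val :=
    Units.continuous_val.comp continuous_subtype_val
  exact ((h1.matrix_mul continuous_const).matrix_mul continuous_const).matrix_elem i j

theorem archCoord_mul_finiteAdele (s : Sp n (Adele F)) (y : FiniteAdeleRing (𝓞 F) F) :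
    archCoord (s * rootHom hij (finiteAdele y) * g) = archCoord (s * g) := by
  funext i j v
  rw [archCoord_apply, entry_mul_rootHom_mul, map_add, map_mul, archEval_finiteAdele, zero_mul,
    add_zero, archCoord_apply]

/-- The displacement of the archimedean coordinates of `s g` under a root subgroup. -/
def archShift (i₀ j₀ : Fin (2 * n)) (g : Sp n (Adele F)) (p : Sp n (Adele F) × mixedSpace F) :
    Fin (2 * n) → Fin (2 * n) → InfinitePlace F → ℂ :=
  fun i j v => archEval v (archAdele p.2) * archEval v (rootVelocity i₀ j₀ g p.1 i j)

theorem continuous_archShift : Continuous (archShift (F := F) i₀ j₀ g) :=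
  continuous_pi fun i => continuous_pi fun j => continuous_pi fun v =>
    ((continuous_archEval v).comp (continuous_archAdele.comp continuous_snd)).mul
      ((continuous_archEval v).comp ((continuous_rootVelocity g i j).comp continuous_fst))

theorem archCoord_mul_archAdele (s : Sp n (Adele F)) (h : mixedSpace F) (j : ℕ) :
    archCoord (s * rootHom hij (archAdele (j • h)) * g) =
      archCoord (s * g) + j • archShift i₀ j₀ g (s, h) := by
  funext a b v
  rw [archCoord_apply, entry_mul_rootHom_mul, map_add, map_mul, map_nsmul, map_nsmul]
  simp only [Pi.add_apply, Pi.smul_apply, archShift, archCoord_apply, smul_mul_assoc]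

theorem rootHom_nsmul {R : Type*} [CommRing R] (t : R) (j : ℕ) :
    rootHom hij (j • t) = rootHom hij t ^ j := by
  induction j with
  | zero =>
    rw [zero_smul, pow_zero]
    have h := rootHom_add hij (0 : R) 0
    rw [add_zero] at h
    exact left_eq_mul.1 h
  | succ j ih => rw [add_smul, one_smul, rootHom_add, ih, pow_succ]

theorem rootHom_zero {R : Type*} [CommRing R] : rootHom hij (0 : R) = 1 := by
  simpa using rootHom_nsmul hij (0 : R) 0

theorem exists_eventually_norm_archShift_le (s₀ : Sp n (Adele F)) :
    ∃ C, ∀ᶠ s in 𝓝 s₀, ∀ h, ‖archShift i₀ j₀ g (s, h)‖ ≤ C * ‖h‖ := by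
  obtain ⟨c, hc0, hc⟩ := exists_norm_archEval_archAdele_le (F := F)
  let m : Sp n (Adele F) → (Fin (2 * n) → Fin (2 * n) → InfinitePlace F → ℂ) :=
    fun s i j v => archEval v (rootVelocity i₀ j₀ g s i j)
  have hm : Continuous m := continuous_pi fun i => continuous_pi fun j => continuous_pi fun v =>
    (continuous_archEval v).comp (continuous_rootVelocity g i j)
  refine ⟨c * (‖m s₀‖ + 1), ?_⟩
  filter_upwards [hm.norm.continuousAt.eventually_lt continuousAt_const (lt_add_one ‖m s₀‖)]
    with s hs h
  have h0 : 0 ≤ c * (‖m s₀‖ + 1) * ‖h‖ := by positivity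
  refine (pi_norm_le_iff_of_nonneg h0).2 fun i => (pi_norm_le_iff_of_nonneg h0).2 fun j =>
    (pi_norm_le_iff_of_nonneg h0).2 fun v => ?_
  have h1 : ‖m s i j v‖ ≤ ‖m s₀‖ + 1 :=
    ((norm_le_pi_norm _ v).trans ((norm_le_pi_norm _ j).trans (norm_le_pi_norm _ i))).trans hs.le
  calc _ = ‖archEval v (archAdele h)‖ * ‖m s i j v‖ := norm_mul _ _
    _ ≤ (c * ‖h‖) * (‖m s₀‖ + 1) := mul_le_mul (hc v h) h1 (norm_nonneg _) (by positivity)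
    _ = _ := by ring

variable {φ : Sp n (Adele F) → ℂ}

theorem IsSmooth.continuous (hφ : IsSmooth φ) : Continuous φ := by
  refine continuous_iff_continuousAt.2 fun g => ?_
  obtain ⟨Φ, hΦ, h⟩ := hφ g
  exact (hΦ.continuousAt.comp continuous_archCoord.continuousAt).congr_of_eventuallyEq h

/-- A finite-adelic displacement leaves the archimedean coordinates fixed, and near the base point φ
depends on nothing else. -/
theorem IsSmooth.eventually_finiteAdele (hφ : IsSmooth φ) (s₀ : Sp n (Adele F)) :
    ∀ᶠ p : Sp n (Adele F) × FiniteAdeleRing (𝓞 F) F in 𝓝 (s₀, 0),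
      φ (p.1 * rootHom hij (finiteAdele p.2) * g) = φ (p.1 * g) := by
  obtain ⟨Φ, -, h⟩ := hφ (s₀ * g)
  have h1 : Tendsto (fun p : Sp n (Adele F) × FiniteAdeleRing (𝓞 F) F =>
      p.1 * rootHom hij (finiteAdele p.2) * g) (𝓝 (s₀, 0)) (𝓝 (s₀ * g)) := by
    have hc : Continuous fun p : Sp n (Adele F) × FiniteAdeleRing (𝓞 F) F =>
        p.1 * rootHom hij (finiteAdele p.2) * g :=
      (continuous_fst.mul ((continuous_rootHom hij).comp
        (continuous_finiteAdele.comp continuous_snd))).mul continuous_const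
    have := hc.tendsto (s₀, 0)
    simpa only [map_zero, rootHom_zero, mul_one] using this
  have h2 : Tendsto (fun p : Sp n (Adele F) × FiniteAdeleRing (𝓞 F) F => p.1 * g)
      (𝓝 (s₀, 0)) (𝓝 (s₀ * g)) := (continuous_fst.mul continuous_const).tendsto (s₀, 0)
  filter_upwards [h1.eventually h, h2.eventually h] with p hp1 hp2
  rw [hp1, hp2, archCoord_mul_finiteAdele]

/-- Entries are affine in the root parameter, so right translation by the root subgroup shifts the
archimedean coordinates along a fixed vector of size O(‖h‖), and differences of φ become differences
of the smooth function Φ. -/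
theorem IsSmooth.exists_eventually_norm_le (hφ : IsSmooth φ) (k : ℕ) (s₀ : Sp n (Adele F)) :
    ∃ C, ∀ᶠ p : Sp n (Adele F) × mixedSpace F in 𝓝 (s₀, 0),
      ‖(mapDiff (· * rootHom hij (archAdele p.2)))^[k] (fun s => φ (s * g)) p.1‖ ≤
        C * ‖p.2‖ ^ k := by
  obtain ⟨Φ, hΦ, h⟩ := hφ (s₀ * g)
  obtain ⟨C, hC⟩ := exists_eventually_norm_mapDiff_le k (hΦ.of_le (by exact_mod_cast le_top))
  obtain ⟨c, hc⟩ := exists_eventually_norm_archShift_le (i₀ := i₀) (j₀ := j₀) g s₀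
  refine ⟨|C| * |c| ^ k, ?_⟩
  have h1 : ∀ j : ℕ, Tendsto (fun p : Sp n (Adele F) × mixedSpace F =>
      p.1 * rootHom hij (archAdele (j • p.2)) * g) (𝓝 (s₀, 0)) (𝓝 (s₀ * g)) := by
    intro j
    have hc : Continuous fun p : Sp n (Adele F) × mixedSpace F =>
        p.1 * rootHom hij (archAdele (j • p.2)) * g :=
      (continuous_fst.mul ((continuous_rootHom hij).comp
        (continuous_archAdele.comp (continuous_snd.const_smul j)))).mul continuous_const
    have := hc.tendsto (s₀, 0)
    simpa only [smul_zero, map_zero, rootHom_zero, mul_one] using this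
  have h2 : ∀ᶠ p : Sp n (Adele F) × mixedSpace F in 𝓝 (s₀, 0), ∀ j ∈ Finset.range (k + 1),
      φ (p.1 * rootHom hij (archAdele (j • p.2)) * g) =
        Φ (archCoord (p.1 * rootHom hij (archAdele (j • p.2)) * g)) :=
    (Finset.eventually_all _).2 fun j _ => (h1 j).eventually h
  have h3 : Tendsto (fun p : Sp n (Adele F) × mixedSpace F =>
      (archCoord (p.1 * g), archShift i₀ j₀ g p)) (𝓝 (s₀, 0)) (𝓝 (archCoord (s₀ * g), 0)) := by
    have hc : Continuous fun p : Sp n (Adele F) × mixedSpace F =>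
        (archCoord (p.1 * g), archShift i₀ j₀ g p) :=
      (continuous_archCoord.comp (continuous_fst.mul continuous_const)).prodMk
        (continuous_archShift g)
    have h0 : archShift i₀ j₀ g (s₀, 0) = 0 := by
      funext i j v
      simp [archShift]
    simpa only [h0] using hc.tendsto (s₀, 0)
  filter_upwards [h2, h3.eventually hC, (continuous_fst.tendsto (s₀, (0 : mixedSpace F))).eventually hc]
    with p hp2 hpC hpc
  have h4 : (mapDiff (· * rootHom hij (archAdele p.2)))^[k] (fun s => φ (s * g)) p.1 =
      1 * (mapDiff (· + archShift i₀ j₀ g p))^[k] Φ (archCoord (p.1 * g)) := by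
    refine mapDiff_iterate_congr 1 k fun j hj => ?_
    rw [mul_right_iterate, add_right_iterate, one_mul]
    dsimp only
    rw [← rootHom_nsmul, ← map_nsmul, hp2 j (Finset.mem_range.2 (by omega)),
      archCoord_mul_archAdele]
  rw [h4, one_mul]
  refine hpC.trans ?_
  calc C * ‖archShift i₀ j₀ g p‖ ^ k ≤ |C| * (|c| * ‖p.2‖) ^ k := by
        gcongr
        · exact le_abs_self C
        · exact (hpc p.2).trans (by gcongr; exact le_abs_self c)
    _ = _ := by rw [mul_pow]; ring

end Smoothness

/-! ### The same estimates uniformly on N(𝔸). -/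

section UniformSmoothness

open IsDedekindDomain HeightOneSpectrum NumberField mixedEmbedding
open scoped Classical

variable {n : ℕ} {F : Type*} [Field F] [NumberField F]

/-- A positive root subgroup, with values in `N`. -/
def rootN {R : Type*} [CommRing R] {i j : Fin (2 * n)} (hij : i < j) (t : R) : subgroupN n R :=
  ⟨rootHom hij.ne t, (rootHom_mem (isRootOrder_heightOrder n) hij t).1⟩

variable {i₀ j₀ : Fin (2 * n)} (hij : i₀ < j₀) (g : Sp n (Adele F))

theorem rootN_add {R : Type*} [CommRing R] (s t : R) :
    rootN hij (s + t) = rootN hij s * rootN hij t := Subtype.ext (rootHom_add hij.ne s t)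

theorem rootN_nsmul {R : Type*} [CommRing R] (t : R) (j : ℕ) :
    rootN hij (j • t) = rootN hij t ^ j := Subtype.ext (rootHom_nsmul hij.ne t j)

theorem rootN_zero {R : Type*} [CommRing R] : rootN hij (0 : R) = 1 :=
  Subtype.ext (rootHom_zero hij.ne)

theorem continuous_rootN : Continuous (rootN hij : Adele F → subgroupN n (Adele F)) :=
  (continuous_rootHom hij.ne).subtype_mk _

variable {φ : Sp n (Adele F) → ℂ} (hφ : IsSmoothCuspForm φ)

include hφ in
-- The local statement becomes uniform on a compact set of representatives for N(F)\N(𝔸); rational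
-- factors on the left do not interfere with a translation on the right.
theorem exists_finiteAdele_invariant : ∃ N : ℕ, N ≠ 0 ∧ ∀ s : subgroupN n (Adele F),
    ∀ y ∈ integralFiniteAdeles F,
      φ ((s * rootN hij (finiteAdele ((N : FiniteAdeleRing (𝓞 F) F) * y)) :
        subgroupN n (Adele F)) * g) = φ (s * g) := by
  obtain ⟨C, hC, -, h⟩ := (centralTower_subgroupN n F).exists_isCompact le_rfl
  have h1 := hC.eventually_forall_of_forall_eventually (x₀ := (0 : FiniteAdeleRing (𝓞 F) F))
    (P := fun y s => φ (s * rootHom hij.ne (finiteAdele y) * g) = φ (s * g)) fun s₀ _ =>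
      (continuous_swap.tendsto (0, s₀)).eventually (hφ.smooth.eventually_finiteAdele hij.ne g s₀)
  obtain ⟨N, hN, hW⟩ := exists_nat_mul_integralFiniteAdeles_subset h1
  refine ⟨N, hN, fun s y hy => ?_⟩
  obtain ⟨γ, hγ, -, c, hc, hs⟩ := h s s.2
  have h2 := hW y hy c hc
  rw [Subgroup.coe_mul, hs, mul_assoc, mul_assoc, hφ.left_invariant γ hγ, mul_assoc γ c g,
    hφ.left_invariant γ hγ, ← mul_assoc]
  exact h2

include hφ in
theorem exists_norm_mul_le : ∃ M, ∀ s : subgroupN n (Adele F), ‖φ (s * g)‖ ≤ M := by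
  obtain ⟨C, hC, -, h⟩ := (centralTower_subgroupN n F).exists_isCompact le_rfl
  obtain ⟨M, hM⟩ := hC.exists_bound_of_continuousOn (f := fun s => φ (s * g))
    (hφ.smooth.continuous.comp (continuous_mul_const g)).continuousOn
  refine ⟨M, fun s => ?_⟩
  obtain ⟨γ, hγ, -, c, hc, hs⟩ := h s s.2
  rw [hs, mul_assoc, hφ.left_invariant γ hγ]
  exact hM c hc

include hφ in
theorem exists_eventually_norm_mapDiff_rootN_le (k : ℕ) :
    ∃ B : ℝ, ∀ᶠ h in 𝓝 (0 : mixedSpace F), ∀ s : subgroupN n (Adele F),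
      ‖(mapDiff (· * rootN hij (archAdele h)))^[k]
        (fun s : subgroupN n (Adele F) => φ (s * g)) s‖ ≤ B * ‖h‖ ^ k := by
  obtain ⟨C, hC, -, hCN⟩ := (centralTower_subgroupN n F).exists_isCompact le_rfl
  obtain ⟨B, hB⟩ : ∃ B : ℝ, ∀ᶠ h in 𝓝 (0 : mixedSpace F), ∀ s ∈ C,
      ‖(mapDiff (· * rootHom hij.ne (archAdele h)))^[k] (fun s => φ (s * g)) s‖ ≤ B * ‖h‖ ^ k := by
    refine hC.induction_on (p := fun A => ∃ B : ℝ, ∀ᶠ h in 𝓝 (0 : mixedSpace F), ∀ s ∈ A,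
      ‖(mapDiff (· * rootHom hij.ne (archAdele h)))^[k] (fun s => φ (s * g)) s‖ ≤ B * ‖h‖ ^ k)
      ⟨0, by simp⟩ ?_ ?_ ?_
    · rintro A A' hA ⟨B, hB⟩
      exact ⟨B, hB.mono fun h hh s hs => hh s (hA hs)⟩
    · rintro A A' ⟨B, hB⟩ ⟨B', hB'⟩
      refine ⟨max B B', (hB.and hB').mono fun h hh s hs => ?_⟩
      rcases hs with hs | hs
      · exact (hh.1 s hs).trans (by gcongr; exact le_max_left _ _)
      · exact (hh.2 s hs).trans (by gcongr; exact le_max_right _ _)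
    · intro s₀ _
      obtain ⟨B, hB⟩ := hφ.smooth.exists_eventually_norm_le hij.ne g k s₀
      rw [nhds_prod_eq] at hB
      obtain ⟨pa, ha, pb, hb, hab⟩ := eventually_prod_iff.1 hB
      exact ⟨{s | pa s}, mem_nhdsWithin_of_mem_nhds ha, B, hb.mono fun h hh s hs => hab hs hh⟩
  refine ⟨B, hB.mono fun h hh s => ?_⟩
  obtain ⟨γ, hγ, -, c, hc, hs⟩ := hCN s s.2
  have h1 : (mapDiff (· * rootN hij (archAdele h)))^[k]
      (fun s : subgroupN n (Adele F) => φ (s * g)) s =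
      1 * (mapDiff (· * rootHom hij.ne (archAdele h)))^[k] (fun s => φ (s * g)) c := by
    refine mapDiff_iterate_congr 1 k fun j _ => ?_
    rw [mul_right_iterate, mul_right_iterate, one_mul]
    dsimp only
    rw [Subgroup.coe_mul, hs, mul_assoc, mul_assoc, hφ.left_invariant γ hγ, ← mul_assoc]
    rfl
  rw [h1, one_mul]
  exact hh c hc

include hφ in
/-- Uniform bounds for the iterated differences of a cusp form along a root subgroup. -/
theorem exists_norm_mapDiff_rootN_le (k : ℕ) :
    ∃ B : ℝ, ∀ (h : mixedSpace F) (s : subgroupN n (Adele F)),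
      ‖(mapDiff (· * rootN hij (archAdele h)))^[k]
        (fun s : subgroupN n (Adele F) => φ (s * g)) s‖ ≤ B * ‖h‖ ^ k := by
  obtain ⟨B, hB⟩ := exists_eventually_norm_mapDiff_rootN_le hij g hφ k
  obtain ⟨M, hM⟩ := exists_norm_mul_le g hφ
  obtain ⟨δ, hδ, hB'⟩ := Metric.eventually_nhds_iff.1 hB
  -- For ‖h‖ ≥ δ the trivial bound 2^k M on the k-th difference is at most (2^k M / δ^k)‖h‖^k.
  refine ⟨max B (2 ^ k * M / δ ^ k), fun h s => ?_⟩
  rcases lt_or_ge ‖h‖ δ with hh | hh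
  · refine (hB' (by rwa [dist_zero_right]) s).trans ?_
    gcongr
    exact le_max_left _ _
  · have hM0 : 0 ≤ M := (norm_nonneg _).trans (hM 1)
    refine (norm_mapDiff_iterate_le hM k s).trans ?_
    calc 2 ^ k * M = 2 ^ k * M / δ ^ k * δ ^ k := by field_simp
      _ ≤ max B (2 ^ k * M / δ ^ k) * ‖h‖ ^ k := by
        gcongr
        exact le_max_right _ _

end UniformSmoothness

/-! ### The characters of N and their behaviour on U, on the radical and under α. -/

section Characters

variable {n : ℕ} {F : Type*} [Field F] [NumberField F]

/-- The linear form `ξ u₁₂ + u₂₃ + ⋯ + u_{n,n+1}` (numbered from `1`) on `N`. -/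
def simpleRootSum (ξ : F) (s : Sp n (Adele F)) : Adele F :=
  ∑ i : Fin n, algebraMap F (Adele F) (if (i : ℕ) = 0 then ξ else 1) *
    s.entry ⟨i, by omega⟩ ⟨i + 1, by omega⟩

theorem psiN_eq (ψ : AddChar (Adele F) ℂ) (s : Sp n (Adele F)) :
    psiN ψ s = ψ (simpleRootSum 1 s) := by
  simp [psiN, simpleRootSum]

theorem continuous_simpleRootSum (ξ : F) : Continuous (simpleRootSum (n := n) ξ) :=
  continuous_finsetSum _ fun _ _ => continuous_const.mul (continuous_entry _ _)

theorem simpleRootSum_mul (ξ : F) {s t : Sp n (Adele F)} (hs : s ∈ subgroupN n (Adele F))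
    (ht : t ∈ subgroupN n (Adele F)) :
    simpleRootSum ξ (s * t) = simpleRootSum ξ s + simpleRootSum ξ t := by
  rw [simpleRootSum, simpleRootSum, simpleRootSum, ← Finset.sum_add_distrib]
  refine Finset.sum_congr rfl fun i _ => ?_
  rw [entry_mul_of_succ hs ht rfl, mul_add]

theorem simpleRootSum_rational (ξ : F) {γ : Sp n (Adele F)} (hγ : γ ∈ rationalPoints n F) :
    ∃ η : F, simpleRootSum ξ γ = algebraMap F (Adele F) η := by
  obtain ⟨γ, rfl⟩ := hγ
  refine ⟨∑ i : Fin n, (if (i : ℕ) = 0 then ξ else 1) *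
    γ.entry ⟨i, by omega⟩ ⟨i + 1, by omega⟩, ?_⟩
  rw [map_sum, simpleRootSum]
  refine Finset.sum_congr rfl fun i _ => ?_
  rw [map_mul, Sp.entry_map]

theorem simpleRootSum_eq_add (hn : 2 ≤ n) (ξ : F) (s : Sp n (Adele F)) : simpleRootSum ξ s =
    simpleRootSum 0 s + algebraMap F (Adele F) ξ * s.entry ⟨0, by omega⟩ ⟨1, by omega⟩ := by
  have h : algebraMap F (Adele F) ξ * s.entry ⟨0, by omega⟩ ⟨1, by omega⟩ =
      ∑ i : Fin n, if i = ⟨0, by omega⟩ then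
        algebraMap F (Adele F) ξ * s.entry ⟨i, by omega⟩ ⟨i + 1, by omega⟩ else 0 := by
    rw [Finset.sum_ite_eq' Finset.univ]
    simp
  rw [h, simpleRootSum, simpleRootSum, ← Finset.sum_add_distrib]
  refine Finset.sum_congr rfl fun i _ => ?_
  by_cases hi : (i : ℕ) = 0
  · simp [hi, Fin.ext_iff]
  · simp [hi, Fin.ext_iff]

theorem entry_zero_one_mul (hn : 2 ≤ n) {u s : Sp n (Adele F)} (hu : u ∈ subgroupU n (Adele F))
    (hs : s ∈ subgroupN n (Adele F)) :
    (u * s).entry ⟨0, by omega⟩ ⟨1, by omega⟩ = s.entry ⟨0, by omega⟩ ⟨1, by omega⟩ := by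
  rw [entry_mul_of_succ hu.1 hs rfl, hu.2 _ _ rfl (.inl rfl), zero_add]

theorem entry_zero_one_rootHom (hn : 2 ≤ n) (t : Adele F) (h : (⟨0, by omega⟩ : Fin (2 * n)) ≠ ⟨1, by omega⟩) :
    (rootHom h t).entry ⟨0, by omega⟩ ⟨1, by omega⟩ = t := by
  rw [entry_rootHom, Matrix.one_apply_ne h, zero_add]
  simp [rootMatrix]

theorem simpleRootSum_zero_rootHom (hn : 2 ≤ n) (t : Adele F)
    (h : (⟨0, by omega⟩ : Fin (2 * n)) ≠ ⟨1, by omega⟩) : simpleRootSum 0 (rootHom h t) = 0 := by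
  refine Finset.sum_eq_zero fun i _ => ?_
  by_cases hi : (i : ℕ) = 0
  · rw [if_pos hi, map_zero, zero_mul]
  · have := i.isLt
    rw [entry_rootHom, Matrix.one_apply_ne (by simp), rootMatrix_eq_zero, mul_zero, add_zero,
      mul_zero]
    · simp [hi]
    · simp only [Fin.ext_iff, Fin.val_rev]
      omega

/-- The radical meets the simple roots only in the first one, whose coefficient is zero here. -/
theorem simpleRootSum_zero_radical (hn : 2 ≤ n) {r : Sp n (Adele F)}
    (hr : r ∈ parabolicRadical n (Adele F) 1) : simpleRootSum 0 r = 0 := by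
  refine Finset.sum_eq_zero fun i _ => ?_
  by_cases hi : (i : ℕ) = 0
  · rw [if_pos hi, map_zero, zero_mul]
  · have := i.isLt
    rw [hr _ _ (by dsimp only; split_ifs <;> omega), Matrix.one_apply_ne (by simp), mul_zero]

theorem entry_alpha_inv_mul_mul_alpha {R : Type*} [CommRing R] (t : Rˣ) (s : Sp n R)
    (i j : Fin (2 * n)) : ((alpha n t)⁻¹ * s * alpha n t).entry i j =
      alphaDiag n t⁻¹ i * s.entry i j * alphaDiag n t j := by
  change (Matrix.diagonal (alphaDiag n t⁻¹) * (s : GL (Fin (2 * n)) R).val *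
    Matrix.diagonal (alphaDiag n t)) i j = _
  rw [Matrix.mul_diagonal, Matrix.diagonal_mul]
  rfl

theorem alpha_conj_mem {R : Type*} [CommRing R] (t : Rˣ) {s : Sp n R} (hs : s ∈ subgroupN n R) :
    (alpha n t)⁻¹ * s * alpha n t ∈ subgroupN n R := by
  intro i j hij
  rw [entry_alpha_inv_mul_mul_alpha, hs i j hij]
  by_cases h : i = j
  · subst h
    rw [Matrix.one_apply_eq, mul_one]
    simp only [alphaDiag]
    split_ifs <;> simp
  · rw [Matrix.one_apply_ne h, mul_zero, zero_mul]

theorem alpha_inv {R : Type*} [CommRing R] (t : Rˣ) : (alpha n t)⁻¹ = alpha n t⁻¹ := by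
  refine Sp.ext_entry fun i j => ?_
  rfl

theorem alpha_mem_rationalPoints (ξ : Fˣ) :
    alpha n (Units.map (algebraMap F (Adele F)).toMonoidHom ξ) ∈ rationalPoints n F := by
  refine ⟨alpha n ξ, Sp.ext_entry fun i j => ?_⟩
  rw [Sp.entry_map]
  change algebraMap F (Adele F) (Matrix.diagonal (alphaDiag n ξ) i j) =
    Matrix.diagonal (alphaDiag n _) i j
  by_cases h : i = j
  · subst h
    rw [Matrix.diagonal_apply_eq, Matrix.diagonal_apply_eq]
    simp only [alphaDiag]
    split_ifs
    · rfl
    · rfl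
    · exact map_one _
  · rw [Matrix.diagonal_apply_ne _ h, Matrix.diagonal_apply_ne _ h, map_zero]

/-- Conjugation divides the entry (1, 2) by ξ. The other entries of the sum are untouched since, for
n ≥ 2, none lies in the last column. -/
theorem simpleRootSum_alpha_conj (hn : 2 ≤ n) (ξ : Fˣ) (s : Sp n (Adele F)) :
    simpleRootSum (ξ : F) ((alpha n (Units.map (algebraMap F (Adele F)).toMonoidHom ξ))⁻¹ * s *
      alpha n (Units.map (algebraMap F (Adele F)).toMonoidHom ξ)) = simpleRootSum 1 s := by
  refine Finset.sum_congr rfl fun i _ => ?_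
  have := i.isLt
  rw [entry_alpha_inv_mul_mul_alpha]
  by_cases hi : (i : ℕ) = 0
  · have h1 : ¬ (1 + 1 = 2 * n) := by omega
    have h2 : algebraMap F (Adele F) ξ * ((Units.map (algebraMap F (Adele F)).toMonoidHom ξ)⁻¹ :
        (Adele F)ˣ) = 1 := (Units.map (algebraMap F (Adele F)).toMonoidHom ξ).mul_inv
    simp only [alphaDiag, hi, if_true, zero_add, one_ne_zero, if_false, h1, mul_one, map_one,
      one_mul, ← mul_assoc, h2]
  · have h1 : ¬ ((i : ℕ) + 1 = 2 * n) := by omega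
    have h2 : ¬ ((i : ℕ) + 1 + 1 = 2 * n) := by omega
    simp [alphaDiag, hi, h1, h2]

end Characters

/-! ### Averages commute with differences and compute integrals. -/

section AverageDifferences

variable {n : ℕ} {F : Type*} [Field F] [NumberField F] {S H : Subgroup (Sp n (Adele F))}

theorem IsAutomorphic.mapDiff {h : S → ℂ} (hh : IsAutomorphic h) (m : S) :
    IsAutomorphic (mapDiff (· * m) h) := by
  have h1 := (hh.comp_mul_right m).add (hh.const_smul (-1))
  refine ⟨h1.continuous.congr fun s => ?_, fun γ hγ s => ?_⟩
  · simp [SpUnfolding.mapDiff, sub_eq_add_neg]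
  · simp only [SpUnfolding.mapDiff, mul_assoc, hh.left_inv γ hγ]

theorem IsAutomorphic.mapDiff_iterate {h : S → ℂ} (hh : IsAutomorphic h) (m : S) (k : ℕ) :
    IsAutomorphic ((SpUnfolding.mapDiff (· * m))^[k] h) := by
  induction k with
  | zero => exact hh
  | succ k ih =>
    rw [Function.iterate_succ_apply']
    exact ih.mapDiff m

theorem IsAverage.mapDiff {E : (S → ℂ) → (S → ℂ)} (hE : IsAverage S H E) {h : S → ℂ}
    (hh : IsAutomorphic h) (m : S) :
    E (SpUnfolding.mapDiff (· * m) h) = SpUnfolding.mapDiff (· * m) (E h) := by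
  have h1 : SpUnfolding.mapDiff (· * m) h = (fun s => h (s * m)) + (-1 : ℝ) • h := by
    funext s
    simp [SpUnfolding.mapDiff, sub_eq_add_neg]
  rw [h1, hE.add (hh.comp_mul_right m) (hh.const_smul (-1)), hE.smul, hE.translate]
  funext s
  simp [SpUnfolding.mapDiff, sub_eq_add_neg]

theorem IsAverage.mapDiff_iterate {E : (S → ℂ) → (S → ℂ)} (hE : IsAverage S H E) {h : S → ℂ}
    (hh : IsAutomorphic h) (m : S) (k : ℕ) :
    E ((SpUnfolding.mapDiff (· * m))^[k] h) = (SpUnfolding.mapDiff (· * m))^[k] (E h) := by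
  induction k with
  | zero => rfl
  | succ k ih =>
    rw [Function.iterate_succ_apply', Function.iterate_succ_apply',
      hE.mapDiff (hh.mapDiff_iterate m k), ih]

/-- Averaging first makes the integrand constant along H, so the same value arises for every
invariant probability measure. -/
theorem IsAverage.integral_eq {V : Type*} [NormedAddCommGroup V] [NormedSpace ℝ V]
    [CompleteSpace V] {E : (S → V) → (S → V)} (hE : IsAverage S H E) (hH : H ≤ S)
    [hc : CompactSpace (AdelicQuotient H)] {μ : Measure (AdelicQuotient H)}
    (hμ : IsInvariantProbability μ) {h : S → V} (hh : IsAutomorphic h) (s : S) :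
    ∫ q, h (Subgroup.inclusion hH q.rep * s) ∂μ = E h s := by
  have := hμ.isProbabilityMeasure
  rw [← hE.integral hh le_rfl hH hc hμ]
  have h1 : ∀ q : AdelicQuotient H, E h (Subgroup.inclusion hH q.rep * s) = E h s := fun q =>
    hE.invariant hh _ q.rep.2 s
  simp_rw [h1]
  rw [integral_const, probReal_univ, one_smul]

theorem IsAverage.norm_le {V : Type*} [NormedAddCommGroup V] [NormedSpace ℝ V]
    [CompleteSpace V] {E : (S → V) → (S → V)} (hE : IsAverage S H E) (hH : H ≤ S)
    [hc : CompactSpace (AdelicQuotient H)] {μ : Measure (AdelicQuotient H)}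
    (hμ : IsInvariantProbability μ) {h : S → V} (hh : IsAutomorphic h) {B : ℝ}
    (hB : ∀ s, ‖h s‖ ≤ B) (s : S) : ‖E h s‖ ≤ B := by
  have := hμ.isProbabilityMeasure
  rw [← hE.integral_eq hH hμ hh s]
  refine (norm_integral_le_of_norm_le_const (ae_of_all _ fun q => hB _)).trans ?_
  rw [probReal_univ, mul_one]

theorem classDiff_iterate {F : Type*} [Field F] [NumberField F] (f : C(AdeleClass F, ℂ))
    (a : Adele F) (k : ℕ) :
    ⇑((fun g => classDiff g a)^[k] f) = (mapDiff (· + (a : AdeleClass F)))^[k] f := by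
  induction k with
  | zero => rfl
  | succ k ih =>
    rw [Function.iterate_succ_apply', Function.iterate_succ_apply', ← ih]
    rfl

end AverageDifferences

/-! ### The cusp form twisted by a character of N. -/

section Twist

variable {n : ℕ} {F : Type*} [Field F] [NumberField F] {ψ : AddChar (Adele F) ℂ}
  (hψ_cont : Continuous ψ) (hψ_F : ∀ x : F, ψ (algebraMap F (Adele F) x) = 1)
  {φ : Sp n (Adele F) → ℂ} (hφ : IsSmoothCuspForm φ) (g : Sp n (Adele F))

/-- The function `s ↦ φ(s g) ψ(ξ s₁₂ + s₂₃ + ⋯ + s_{n,n+1})⁻¹` on `N`. -/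
def twist (ψ : AddChar (Adele F) ℂ) (φ : Sp n (Adele F) → ℂ) (g : Sp n (Adele F)) (ξ : F)
    (s : subgroupN n (Adele F)) : ℂ :=
  φ (s * g) * (ψ (simpleRootSum ξ (s : Sp n (Adele F))))⁻¹

include hψ_cont hψ_F hφ in
theorem isAutomorphic_twist (ξ : F) : IsAutomorphic (twist ψ φ g ξ) where
  continuous := by
    refine (hφ.smooth.continuous.comp (continuous_subtype_val.mul continuous_const)).mul
      (Continuous.inv₀ (hψ_cont.comp ((continuous_simpleRootSum ξ).comp continuous_subtype_val))
        fun s => ?_)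
    rw [← norm_ne_zero_iff, norm_addChar hψ_cont hψ_F]
    exact one_ne_zero
  left_inv := fun γ hγ s => by
    obtain ⟨η, hη⟩ := simpleRootSum_rational ξ hγ
    rw [twist, Subgroup.coe_mul, mul_assoc, hφ.left_invariant γ hγ,
      simpleRootSum_mul ξ γ.2 s.2, hη, addChar_algebraMap_add hψ_F, twist]

variable (hn : 2 ≤ n)

include hn in
theorem zero_lt_one_index : (⟨0, by omega⟩ : Fin (2 * n)) < ⟨1, by omega⟩ := Nat.zero_lt_one

/-- At ξ = 0 the character ignores the first simple root, so smoothness estimates for φ along it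
pass to the twist unchanged. -/
theorem twist_mul_rootN (s : subgroupN n (Adele F)) (t : Adele F) :
    twist ψ φ g 0 (s * rootN (zero_lt_one_index hn) t) =
      (ψ (simpleRootSum 0 (s : Sp n (Adele F))))⁻¹ *
        φ ((s * rootN (zero_lt_one_index hn) t : subgroupN n (Adele F)) * g) := by
  rw [twist, Subgroup.coe_mul, simpleRootSum_mul 0 s.2 (rootN (zero_lt_one_index hn) t).2]
  have h : simpleRootSum 0 ((rootN (zero_lt_one_index hn) t : subgroupN n (Adele F)) :
      Sp n (Adele F)) = 0 := simpleRootSum_zero_rootHom hn t (zero_lt_one_index hn).ne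
  rw [h, add_zero, mul_comm]

open scoped Classical in
include hψ_cont hψ_F hφ in
theorem exists_norm_mapDiff_twist_le (k : ℕ) : ∃ B : ℝ,
    ∀ (h : NumberField.mixedEmbedding.mixedSpace F) (s : subgroupN n (Adele F)),
      ‖(mapDiff (· * rootN (zero_lt_one_index hn) (archAdele h)))^[k] (twist ψ φ g 0) s‖ ≤
        B * ‖h‖ ^ k := by
  obtain ⟨B, hB⟩ := exists_norm_mapDiff_rootN_le (zero_lt_one_index hn) g hφ k
  refine ⟨B, fun h s => ?_⟩
  rw [mapDiff_iterate_congr (τ' := (· * rootN (zero_lt_one_index hn) (archAdele h)))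
    (f' := fun s : subgroupN n (Adele F) => φ (s * g))
    (ψ (simpleRootSum 0 (s : Sp n (Adele F))))⁻¹ k (x := s) (y := s), norm_mul, norm_inv,
    norm_addChar hψ_cont hψ_F, inv_one, one_mul]
  · exact hB h s
  · intro j _
    rw [mul_right_iterate]
    dsimp only
    rw [← rootN_nsmul, twist_mul_rootN g hn]

theorem twist_eq_mul (ξ : F) (s : subgroupN n (Adele F)) : twist ψ φ g ξ s =
    (ψ (algebraMap F (Adele F) ξ * (s : Sp n (Adele F)).entry ⟨0, by omega⟩ ⟨1, by omega⟩))⁻¹ *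
      twist ψ φ g 0 s := by
  rw [twist, simpleRootSum_eq_add hn, AddChar.map_add_eq_mul, mul_inv, twist]
  ring

end Twist

/-! ### Integrals over N as Fourier coefficients of the period over U. -/

section FourierCoefficients

variable {n : ℕ} {F : Type*} [Field F] [NumberField F] {ψ : AddChar (Adele F) ℂ}
  (hψ_cont : Continuous ψ) (hψ_F : ∀ x : F, ψ (algebraMap F (Adele F) x) = 1)
  {φ : Sp n (Adele F) → ℂ} (hφ : IsSmoothCuspForm φ) (g : Sp n (Adele F)) (hn : 2 ≤ n)
  {μU : Measure (AdelicQuotient (subgroupU n (Adele F)))} (hμU : IsInvariantProbability μU)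

instance : CompactSpace (AdelicQuotient (subgroupU n (Adele F))) :=
  (centralTower_subgroupU n F).compactSpace (subgroupU_le_subgroupN n F)

instance : CompactSpace (AdelicQuotient (subgroupN n (Adele F))) :=
  (centralTower_subgroupN n F).compactSpace le_rfl

instance : CompactSpace (AdelicQuotient (parabolicRadical n (Adele F) 1)) :=
  (centralTower_parabolicRadical_one n F).compactSpace (parabolicRadical_one_le_subgroupN n F)

variable {E : (subgroupN n (Adele F) → ℂ) → (subgroupN n (Adele F) → ℂ)}
  (hE : IsAverage (subgroupN n (Adele F)) (subgroupU n (Adele F)) E)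

include hψ_cont hψ_F hφ hμU hE in
-- Left multiplication by U does not change the entry (1, 2), so the factor depending on ξ comes out
-- of the average.
theorem average_twist (ξ : F) (s : subgroupN n (Adele F)) : E (twist ψ φ g ξ) s =
    (ψ (algebraMap F (Adele F) ξ * (s : Sp n (Adele F)).entry ⟨0, by omega⟩ ⟨1, by omega⟩))⁻¹ *
      E (twist ψ φ g 0) s := by
  rw [← hE.integral_eq (subgroupU_le_subgroupN n F) hμU
    (isAutomorphic_twist hψ_cont hψ_F hφ g ξ) s, ← hE.integral_eq (subgroupU_le_subgroupN n F) hμU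
    (isAutomorphic_twist hψ_cont hψ_F hφ g 0) s, ← integral_const_mul]
  refine integral_congr_ae (ae_of_all _ fun q => ?_)
  dsimp only
  rw [twist_eq_mul g hn]
  congr 4
  exact entry_zero_one_mul hn q.rep.2 s.2

theorem rootN_comm (s : subgroupN n (Adele F)) (a : Adele F) :
    (((s * rootN (zero_lt_one_index hn) a) * (rootN (zero_lt_one_index hn) a * s)⁻¹ :
      subgroupN n (Adele F)) : Sp n (Adele F)) ∈ subgroupU n (Adele F) := by
  rw [subgroupU_eq_rootFiltration]
  have h := comm_mem_rootFiltration (isRootOrder_heightOrder n) s.2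
    (rootHom_mem (isRootOrder_heightOrder n) (zero_lt_one_index hn) a)
  have h1 : heightOrder n ⟨0, by omega⟩ ⟨1, by omega⟩ = 2 * n := by simp [heightOrder]
  rw [h1] at h
  exact h

theorem exists_eq_mul_rootN (s : subgroupN n (Adele F)) :
    ∃ u : subgroupN n (Adele F), (u : Sp n (Adele F)) ∈ subgroupU n (Adele F) ∧
      ∃ a, s = u * rootN (zero_lt_one_index hn) a := by
  have h1 : heightOrder n ⟨0, by omega⟩ ⟨1, by omega⟩ = 2 * n := by simp [heightOrder]
  have hs : (s : Sp n (Adele F)) ∈ rootFiltration (Adele F) (isRootOrder_heightOrder n)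
      (heightOrder n ⟨0, by omega⟩ ⟨1, by omega⟩) := by
    refine ⟨s.2, fun a b hab hr => ?_⟩
    rw [h1, heightOrder] at hr
    have hab' : (a : ℕ) < b := hab
    have h2 := Nat.mul_le_mul_right (2 * n) (show 1 ≤ (b : ℕ) - a by omega)
    omega
  have h := mul_rootHom_inv_mem (isRootOrder_heightOrder n) (zero_lt_one_index hn) hs
  rw [h1, ← subgroupU_eq_rootFiltration] at h
  exact ⟨⟨_, h.1⟩, h, _, Subtype.ext (inv_mul_cancel_right _ _).symm⟩

theorem subgroupU_conj_mem (s c : subgroupN n (Adele F))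
    (hc : (c : Sp n (Adele F)) ∈ subgroupU n (Adele F)) :
    ((s * c * s⁻¹ : subgroupN n (Adele F)) : Sp n (Adele F)) ∈ subgroupU n (Adele F) := by
  rw [subgroupU_eq_rootFiltration] at hc ⊢
  exact conj_mem_rootFiltration _ s.2 hc

theorem rootN_algebraMap_mem {i j : Fin (2 * n)} (hij : i < j) (ξ : F) :
    ((rootN hij (algebraMap F (Adele F) ξ) : subgroupN n (Adele F)) : Sp n (Adele F)) ∈
      rationalPoints n F := rootHom_algebraMap_mem hij.ne ξ

/-- The function `t ↦ ∫_{U(F) \ U(𝔸)} φ(u x₁₂(t) g) ψ_N(u)⁻¹ du` on `𝔸 / F`, in terms of an average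
operator for `U`. -/
def averageOnRoot (h : subgroupN n (Adele F) → ℂ) (hh : IsAutomorphic h) :
    C(AdeleClass F, ℂ) where
  toFun := adeleLift (fun t => h (rootN (zero_lt_one_index hn) t)) (fun ξ a => by
    rw [rootN_add, hh.left_inv _ (rootN_algebraMap_mem _ ξ)])
  continuous_toFun := continuous_adeleLift _ (hh.continuous.comp (continuous_rootN _))

theorem averageOnRoot_mk (h : subgroupN n (Adele F) → ℂ) (hh : IsAutomorphic h) (t : Adele F) :
    averageOnRoot hn h hh (t : AdeleClass F) = h (rootN (zero_lt_one_index hn) t) := rfl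

include hμU in
-- Averaging over U and then over x₁₂ preserves the integral over N and yields a constant, since N =
-- U · x₁₂(𝔸). The right side does not involve ν, so the value is the same for all invariant ν.
theorem integral_twist {ν : Measure (AdelicQuotient (subgroupN n (Adele F)))}
    (hν : IsInvariantProbability ν) (ξ : F) :
    ∫ q : AdelicQuotient (subgroupN n (Adele F)), twist ψ φ g ξ q.rep ∂ν =
      adeleClassIntegral (averageOnRoot hn (E (twist ψ φ g 0))
        (hE.isAutomorphic (isAutomorphic_twist hψ_cont hψ_F hφ g 0)) *
          classChar hψ_cont hψ_F (-ξ)) := by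
  have := hν.isProbabilityMeasure
  have haut := isAutomorphic_twist hψ_cont hψ_F hφ g ξ
  have haut' := hE.isAutomorphic haut
  have h1 := hE.integral haut (subgroupU_le_subgroupN n F) le_rfl inferInstance hν 1
  have h2 := integral_oneParamAverage (continuous_rootN (zero_lt_one_index hn))
    (rootN_add (zero_lt_one_index hn)) (rootN_algebraMap_mem (zero_lt_one_index hn)) haut'
    (rootN_comm hn) (hE.invariant haut) le_rfl (fun a => (rootN (zero_lt_one_index hn) a).2) hν 1
  rw [h1] at h2
  have h3 : ∀ s, oneParamAverage (rootN (zero_lt_one_index hn)) (E (twist ψ φ g ξ)) s =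
      oneParamAverage (rootN (zero_lt_one_index hn)) (E (twist ψ φ g ξ)) 1 := by
    intro s
    obtain ⟨u, hu, a, rfl⟩ := exists_eq_mul_rootN hn s
    rw [oneParamAverage_mul_of_mem subgroupU_conj_mem (hE.invariant haut) hu, ← mul_one (rootN _ a),
      oneParamAverage_mul (rootN_add _) (rootN_algebraMap_mem _) haut']
  simp_rw [h3, mul_one] at h2
  rw [integral_const, probReal_univ, one_smul] at h2
  refine Eq.trans ?_ (h2.symm.trans ?_)
  · rfl
  · rw [adeleClassIntegral_apply, oneParamAverage]
    refine integral_congr_ae (ae_of_all _ fun t => ?_)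
    obtain ⟨a, rfl⟩ := QuotientAddGroup.mk_surjective t
    dsimp only
    rw [haut'.apply_out (rootN_add _) (rootN_algebraMap_mem _), mul_one,
      average_twist hψ_cont hψ_F hφ g hn hμU hE, ContinuousMap.mul_apply, averageOnRoot_mk,
      classChar_mk, map_neg, neg_mul, AddChar.map_neg_eq_inv, mul_comm]
    congr 4
    exact entry_zero_one_rootHom hn a (zero_lt_one_index hn).ne

end FourierCoefficients

/-! ### Rational torus conjugation, and vanishing of the zeroth coefficient. -/

section Conjugation

variable {n : ℕ} {F : Type*} [Field F] [NumberField F]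

/-- Conjugation by `α(ξ)⁻¹` on `N(𝔸)`. -/
def alphaConj (ξ : Fˣ) (s : subgroupN n (Adele F)) : subgroupN n (Adele F) :=
  ⟨(alpha n (Units.map (algebraMap F (Adele F)).toMonoidHom ξ))⁻¹ * s *
    alpha n (Units.map (algebraMap F (Adele F)).toMonoidHom ξ), alpha_conj_mem _ s.2⟩

theorem alphaConj_mul (ξ : Fˣ) (s t : subgroupN n (Adele F)) :
    alphaConj ξ (s * t) = alphaConj ξ s * alphaConj ξ t :=
  Subtype.ext (by simp only [alphaConj, Subgroup.coe_mul]; group)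

theorem alphaConj_inv_apply (ξ : Fˣ) (s : subgroupN n (Adele F)) :
    alphaConj ξ (alphaConj ξ⁻¹ s) = s :=
  Subtype.ext (by simp only [alphaConj, map_inv, ← alpha_inv]; group)

theorem alphaConj_mem (ξ : Fˣ) {s : subgroupN n (Adele F)}
    (hs : (s : Sp n (Adele F)) ∈ rationalPoints n F) :
    (alphaConj ξ s : Sp n (Adele F)) ∈ rationalPoints n F :=
  mul_mem (mul_mem (inv_mem (alpha_mem_rationalPoints ξ)) hs) (alpha_mem_rationalPoints ξ)

theorem continuous_alphaConj (ξ : Fˣ) : Continuous (alphaConj (n := n) (F := F) ξ) :=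
  ((continuous_const.mul continuous_subtype_val).mul continuous_const).subtype_mk _

/-- Conjugation by `α(ξ)⁻¹` on `N(F) \ N(𝔸)`. -/
def alphaConjQuotient (ξ : Fˣ) :
    AdelicQuotient (subgroupN n (Adele F)) → AdelicQuotient (subgroupN n (Adele F)) :=
  Quotient.lift (fun s => AdelicQuotient.mk (alphaConj ξ s)) fun s t h => by
    have h1 : ((t * s⁻¹ : subgroupN n (Adele F)) : Sp n (Adele F)) ∈ rationalPoints n F :=
      AdelicQuotient.mk_eq_mk.1 (Quotient.sound h)
    rw [AdelicQuotient.mk_eq_mk]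
    have h2 := alphaConj_mem ξ h1
    have h3 : alphaConj ξ t * (alphaConj ξ s)⁻¹ = alphaConj ξ (t * s⁻¹) := by
      rw [mul_inv_eq_iff_eq_mul, ← alphaConj_mul, inv_mul_cancel_right]
    rwa [h3]

theorem alphaConjQuotient_mk (ξ : Fˣ) (s : subgroupN n (Adele F)) :
    alphaConjQuotient ξ (AdelicQuotient.mk s) = AdelicQuotient.mk (alphaConj ξ s) := rfl

theorem continuous_alphaConjQuotient (ξ : Fˣ) :
    Continuous (alphaConjQuotient (n := n) (F := F) ξ) :=
  AdelicQuotient.isOpenQuotientMap_mk.isQuotientMap.continuous_iff.2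
    (AdelicQuotient.isOpenQuotientMap_mk.continuous.comp (continuous_alphaConj ξ))

/-- Conjugation intertwines right translations. The image measure need not be identified with μ: it
is enough that it is again invariant. -/
theorem IsInvariantProbability.map_alphaConjQuotient (ξ : Fˣ)
    {μ : Measure (AdelicQuotient (subgroupN n (Adele F)))} (hμ : IsInvariantProbability μ) :
    IsInvariantProbability (μ.map (alphaConjQuotient ξ)) := by
  have := hμ.isProbabilityMeasure
  have hc := (continuous_alphaConjQuotient (n := n) ξ).measurable
  refine ⟨Measure.isProbabilityMeasure_map hc.aemeasurable, fun m => ?_⟩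
  rw [Measure.map_map (AdelicQuotient.continuous_rightTranslate m).measurable hc]
  have h1 : AdelicQuotient.rightTranslate m ∘ alphaConjQuotient ξ =
      alphaConjQuotient ξ ∘ AdelicQuotient.rightTranslate (alphaConj ξ⁻¹ m) := by
    funext q
    rw [← q.mk_rep, Function.comp_apply, Function.comp_apply, alphaConjQuotient_mk,
      AdelicQuotient.rightTranslate_mk, AdelicQuotient.rightTranslate_mk, alphaConjQuotient_mk,
      alphaConj_mul, alphaConj_inv_apply]
  rw [h1, ← Measure.map_map hc (AdelicQuotient.continuous_rightTranslate _).measurable,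
    hμ.map_rightTranslate]

variable {ψ : AddChar (Adele F) ℂ}
  (hψ_cont : Continuous ψ) (hψ_F : ∀ x : F, ψ (algebraMap F (Adele F) x) = 1)
  {φ : Sp n (Adele F) → ℂ} (hφ : IsSmoothCuspForm φ) (g : Sp n (Adele F)) (hn : 2 ≤ n)

include hφ hn in
theorem twist_one_alpha (ξ : Fˣ) (s : subgroupN n (Adele F)) :
    twist ψ φ (alpha n (Units.map (algebraMap F (Adele F)).toMonoidHom ξ) * g) 1 s =
      twist ψ φ g ξ (alphaConj ξ s) := by
  rw [twist, twist]
  have h1 := simpleRootSum_alpha_conj hn ξ (s : Sp n (Adele F))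
  have h2 := hφ.left_invariant _ (inv_mem (alpha_mem_rationalPoints (n := n) ξ))
    (s * (alpha n (Units.map (algebraMap F (Adele F)).toMonoidHom ξ) * g))
  rw [← h2, ← h1]
  congr 2
  simp only [alphaConj, mul_assoc]

include hψ_cont hψ_F hφ hn in
-- Write uα(ξ) = α(ξ)(α(ξ)⁻¹uα(ξ)) and drop the rational α(ξ) on the left; the change of variable
-- turns ψ_N into the character with coefficient ξ at u₁₂.
theorem whittaker_alpha {μN : Measure (AdelicQuotient (subgroupN n (Adele F)))} (ξ : Fˣ) :
    whittaker μN ψ φ (alpha n (Units.map (algebraMap F (Adele F)).toMonoidHom ξ) * g) =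
      ∫ q : AdelicQuotient (subgroupN n (Adele F)), twist ψ φ g (ξ : F) q.rep
        ∂(μN.map (alphaConjQuotient ξ)) := by
  have haut := isAutomorphic_twist hψ_cont hψ_F hφ g (ξ : F)
  have h1 : Continuous fun q : AdelicQuotient (subgroupN n (Adele F)) =>
      twist ψ φ g (ξ : F) q.rep := by
    have h2 := haut.continuous_rep le_rfl 1
    simp only [mul_one] at h2
    exact h2
  rw [integral_map (continuous_alphaConjQuotient ξ).aemeasurable h1.aestronglyMeasurable]
  refine integral_congr_ae (ae_of_all _ fun q => ?_)
  have h2 := haut.apply_rep le_rfl (alphaConj ξ q.rep) 1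
  rw [← alphaConjQuotient_mk, q.mk_rep, mul_one, mul_one] at h2
  refine Eq.trans ?_ h2.symm
  refine Eq.trans ?_ (twist_one_alpha hφ g hn ξ q.rep)
  simp only [fourierIntegrand, psiN_eq]
  rfl

theorem integrable_fourierIntegrand {H : Subgroup (Sp n (Adele F))}
    (hH : H ≤ subgroupN n (Adele F)) [CompactSpace (AdelicQuotient H)]
    {μ : Measure (AdelicQuotient H)} (hμ : IsInvariantProbability μ)
    (hψ_cont : Continuous ψ) (hψ_F : ∀ x : F, ψ (algebraMap F (Adele F) x) = 1)
    (hφ : IsSmoothCuspForm φ) : Integrable (fourierIntegrand H ψ φ g) μ := by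
  have := hμ.isProbabilityMeasure
  have h1 := (isAutomorphic_twist hψ_cont hψ_F hφ g 1).continuous_rep hH 1
  have h2 : (fun q : AdelicQuotient H => twist ψ φ g 1 (Subgroup.inclusion hH q.rep * 1)) =
      fourierIntegrand H ψ φ g := by
    funext q
    rw [mul_one, fourierIntegrand, psiN_eq]
    rfl
  rw [h2] at h1
  exact h1.integrable_of_hasCompactSupport (HasCompactSupport.of_compactSpace _)

include hψ_cont hψ_F hφ hn in
-- The average over the radical is a multiple of the constant term of φ, because the character is
-- trivial there; cuspidality with k = 1 makes it vanish.
theorem integral_twist_zero {μN : Measure (AdelicQuotient (subgroupN n (Adele F)))}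
    (hμN : IsInvariantProbability μN) :
    ∫ q : AdelicQuotient (subgroupN n (Adele F)), twist ψ φ g 0 q.rep ∂μN = 0 := by
  obtain ⟨μR, hμR⟩ := ((centralTower_parabolicRadical_one n F).mono
    (parabolicRadical_one_le_subgroupN n F)).exists_isInvariantProbability
  obtain ⟨E, hE⟩ := (centralTower_parabolicRadical_one n F).exists_isAverage ℂ
    (parabolicRadical_one_le_subgroupN n F)
  have haut := isAutomorphic_twist hψ_cont hψ_F hφ g 0
  have h1 := hE.integral haut (parabolicRadical_one_le_subgroupN n F) le_rfl inferInstance hμN 1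
  have h2 : ∀ s, E (twist ψ φ g 0) s = 0 := by
    intro s
    rw [← hE.integral_eq (parabolicRadical_one_le_subgroupN n F) hμR haut s]
    have h3 : ∀ q : AdelicQuotient (parabolicRadical n (Adele F) 1),
        twist ψ φ g 0 (Subgroup.inclusion (parabolicRadical_one_le_subgroupN n F) q.rep * s) =
          φ ((q.rep : Sp n (Adele F)) * (s * g)) *
            (ψ (simpleRootSum 0 (s : Sp n (Adele F))))⁻¹ := by
      intro q
      rw [twist, Subgroup.coe_mul, Subgroup.coe_inclusion, simpleRootSum_mul 0
        (parabolicRadical_one_le_subgroupN n F q.rep.2) s.2, simpleRootSum_zero_radical hn q.rep.2,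
        zero_add, mul_assoc]
    simp_rw [h3]
    rw [integral_mul_const, hφ.cuspidal 1 le_rfl (by omega) μR hμR, zero_mul]
  simp_rw [h2, integral_zero, mul_one] at h1
  exact h1.symm

end Conjugation

/-! ### The Fourier expansion of the U-period, and the theorem. -/

section MainArgument

open NumberField mixedEmbedding
open scoped Classical

variable {n : ℕ} {F : Type*} [Field F] [NumberField F] {ψ : AddChar (Adele F) ℂ}
  (hψ_cont : Continuous ψ) (hψ_F : ∀ x : F, ψ (algebraMap F (Adele F) x) = 1) (hψ_ne : ψ ≠ 1)
  {φ : Sp n (Adele F) → ℂ} (hφ : IsSmoothCuspForm φ) (g : Sp n (Adele F)) (hn : 2 ≤ n)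
  {μU : Measure (AdelicQuotient (subgroupU n (Adele F)))} (hμU : IsInvariantProbability μU)
  {E : (subgroupN n (Adele F) → ℂ) → (subgroupN n (Adele F) → ℂ)}
  (hE : IsAverage (subgroupN n (Adele F)) (subgroupU n (Adele F)) E)

include hψ_ne hμU in
/-- The Fourier expansion along the first simple root subgroup. -/
theorem hasSum_averageOnRoot : HasSum (fun ξ : F =>
      adeleClassIntegral (averageOnRoot hn (E (twist ψ φ g 0))
        (hE.isAutomorphic (isAutomorphic_twist hψ_cont hψ_F hφ g 0)) *
          classChar hψ_cont hψ_F (-ξ)))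
    (E (twist ψ φ g 0) 1) := by
  have haut := isAutomorphic_twist hψ_cont hψ_F hφ g 0
  set f := averageOnRoot hn (E (twist ψ φ g 0)) (hE.isAutomorphic haut) with hf
  obtain ⟨N, hN, hinv⟩ := exists_finiteAdele_invariant (zero_lt_one_index hn) g hφ
  have h0 : f 0 = E (twist ψ φ g 0) 1 := by
    rw [← QuotientAddGroup.mk_zero, hf, averageOnRoot_mk, rootN_zero]
  rw [← h0]
  refine hasSum_fourier_of_smooth hψ_cont hψ_F f hN (fun s y hy => ?_) (fun k => ?_) hψ_ne
  · obtain ⟨a, rfl⟩ := QuotientAddGroup.mk_surjective s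
    set z : Adele F := finiteAdele ((N : IsDedekindDomain.FiniteAdeleRing (𝓞 F) F) * y) with hz
    -- Right invariance of φ under M·Ô (M = `N` here) passes to the twist, and the average commutes
    -- with right translation.
    have h1 : (fun s => twist ψ φ g 0 (s * rootN (zero_lt_one_index hn) z)) = twist ψ φ g 0 := by
      funext s
      rw [twist_mul_rootN g hn, hz, hinv s y hy, mul_comm, twist]
    rw [← QuotientAddGroup.mk_add, hf, averageOnRoot_mk, averageOnRoot_mk, rootN_add]
    have h2 := hE.translate (twist ψ φ g 0) (rootN (zero_lt_one_index hn) z)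
    rw [h1] at h2
    exact (congrFun h2 _).symm
  · obtain ⟨B, hB⟩ := exists_norm_mapDiff_twist_le hψ_cont hψ_F hφ g hn k
    refine ⟨B, fun h s => ?_⟩
    obtain ⟨a, rfl⟩ := QuotientAddGroup.mk_surjective s
    rw [classDiff_iterate, mapDiff_iterate_congr
      (τ' := (· * rootN (zero_lt_one_index hn) (archAdele h))) (f' := E (twist ψ φ g 0)) 1 k
      (x := (a : AdeleClass F)) (y := rootN (zero_lt_one_index hn) a), one_mul,
      ← hE.mapDiff_iterate haut]
    · exact hE.norm_le (subgroupU_le_subgroupN n F) hμU (haut.mapDiff_iterate _ k) (hB h) _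
    · intro j _
      rw [mul_right_iterate, add_right_iterate, one_mul]
      dsimp only
      rw [← QuotientAddGroup.mk_nsmul, ← QuotientAddGroup.mk_add, hf, averageOnRoot_mk, rootN_add,
        rootN_nsmul]

end MainArgument

end SpUnfolding
end

open SpUnfolding in
theorem proposition2p2 {F : Type*} [Field F] [NumberField F] (n : ℕ) (hn : 2 ≤ n)
    (ψ : AddChar (Adele F) ℂ) (hψ_cont : Continuous ψ) (hψ_ne : ψ ≠ 1)
    (hψ_F : ∀ x : F, ψ (algebraMap F (Adele F) x) = 1)
    (φ : Sp n (Adele F) → ℂ) (hφ : IsSmoothCuspForm φ)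
    (μU : Measure (AdelicQuotient (subgroupU n (Adele F)))) (hμU : IsInvariantProbability μU)
    (μN : Measure (AdelicQuotient (subgroupN n (Adele F)))) (hμN : IsInvariantProbability μN)
    (g : Sp n (Adele F)) :
    Integrable (fourierIntegrand (subgroupU n (Adele F)) ψ φ g) μU ∧
    (∀ ξ : Fˣ, Integrable (fourierIntegrand (subgroupN n (Adele F)) ψ φ
      (alpha n (Units.map (algebraMap F (Adele F)).toMonoidHom ξ) * g)) μN) ∧
    HasSum
      (fun ξ : Fˣ =>
        whittaker μN ψ φ (alpha n (Units.map (algebraMap F (Adele F)).toMonoidHom ξ) * g))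
      (∫ q, fourierIntegrand (subgroupU n (Adele F)) ψ φ g q ∂μU) := by
  refine ⟨integrable_fourierIntegrand g (subgroupU_le_subgroupN n F) hμU hψ_cont hψ_F hφ,
    fun ξ => integrable_fourierIntegrand _ le_rfl hμN hψ_cont hψ_F hφ, ?_⟩
  obtain ⟨E, hE⟩ := (centralTower_subgroupU n F).exists_isAverage ℂ (subgroupU_le_subgroupN n F)
  have hsum := hasSum_averageOnRoot hψ_cont hψ_F hψ_ne hφ g hn hμU hE
  have hcoeff := fun (ν : Measure (AdelicQuotient (subgroupN n (Adele F))))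
    (hν : IsInvariantProbability ν) (ξ : F) => integral_twist hψ_cont hψ_F hφ g hn hμU hE hν ξ
  have hU : ∫ q, fourierIntegrand (subgroupU n (Adele F)) ψ φ g q ∂μU = E (twist ψ φ g 0) 1 := by
    rw [← hE.integral_eq (subgroupU_le_subgroupN n F) hμU
      (isAutomorphic_twist hψ_cont hψ_F hφ g 0) 1]
    refine integral_congr_ae (ae_of_all _ fun q => ?_)
    dsimp only
    -- On U the entry (1, 2) is zero, so ψ_N agrees with the character whose first coefficient is 0.
    rw [mul_one, fourierIntegrand, psiN_eq, simpleRootSum_eq_add hn,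
      q.rep.2.2 _ _ rfl (.inl rfl), mul_zero, add_zero]
    rfl
  rw [hU]
  have hW : (fun ξ : Fˣ => whittaker μN ψ φ
      (alpha n (Units.map (algebraMap F (Adele F)).toMonoidHom ξ) * g)) =
      (fun ξ : F => adeleClassIntegral (averageOnRoot hn (E (twist ψ φ g 0))
        (hE.isAutomorphic (isAutomorphic_twist hψ_cont hψ_F hφ g 0)) *
          classChar hψ_cont hψ_F (-ξ))) ∘ Units.val := by
    funext ξ
    rw [whittaker_alpha hψ_cont hψ_F hφ g hn ξ, hcoeff _ (hμN.map_alphaConjQuotient ξ)]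
    rfl
  -- The expansion runs over F; the only index outside Fˣ is 0, where the coefficient vanishes by
  -- cuspidality.
  rw [hW, Function.Injective.hasSum_iff Units.val_injective]
  · exact hsum
  · intro ξ hξ
    have h0 : ξ = 0 := by
      by_contra h
      exact hξ ⟨Units.mk0 ξ h, rfl⟩
    rw [h0, ← hcoeff μN hμN, integral_twist_zero hψ_cont hψ_F hφ g hn hμN]
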